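/- **Setting.** Let $\Delta\subset M=\mathbb Z^l$ be the set of lattice points of a full-dimensional integral convex polytope, and let $w=(w_m)_{m\in\Delta}$ be a real valued convex function on $\Delta$ all of whose cells are simplices; here a cell is a non-empty set $\{m\in\Delta: \alpha(m)=w_m\}$ with $\alpha$ an affine function satisfying $\alpha\le w$ on $\Delta$. Let $Z_{\rm top}$ be the set of cells with $l+1$ elements. For $m\in\Delta$ let $s_m(x)=\prod_i x_i^{m_i}$ on $(\mathbb C^*)^l$. For $t=re^{i\theta}$ with $r>0$, $\theta\in\mathbb R$, put $t^a=r^ae^{i\theta a}$ ($a\in\mathbb R$), and let $$s_t=\sum_{m\in\Delta}t^{w_m}s_m,\qquad X_t=\{s_t=0\}\subset(\mathbb C^*)^l,\qquad i_t=[t^{w_m}s_m]_{m\in\Delta}:(\mathbb C^*)^l\to\mathbb{CP}^{|\Delta|-1}.$$ For $S\in Z_{\rm top}$ let $i_{0,S}=[z_m]_{m\in\Delta}$ with $z_m=s_m$ for $m\in S$ and $z_m=0$ for $m\notin S$, and let $\tilde X_{0,S}=\{x\in(\mathbb C^*)^l:\sum_{m\in S}s_m(x)=0\}$. The smooth part of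 the canonical limit $\tilde X_0$ is the disjoint union $\tilde X_0\setminus{\rm Sing}(\tilde X_0)=\bigsqcup_{S\in Z_{\rm top}}\tilde X_{0,S}$. **Metrics.** Let $\omega_{FS}=\frac{i}{2\pi}\partial\bar\partial\log|z|^2$ be the Fubini–Study form. For $\kappa>0$ and a point $[z]\in\mathbb{CP}^{|\Delta|-1}$ put $\eta_m=|z_m|^2/\sum_{m'}|z_{m'}|^2$, $a_m=\kappa-\log\eta_m$ (if $z_m\ne 0$), and $A_S=\prod_{m\in S}a_m^{-1}$. Let $h_t=\kappa^2\sum_{S\in Z_{\rm top}}A_S^2\circ i_t$ on $(\mathbb C^*)^l$ and $h_{0,S}=\kappa^2A_S^2\circ i_{0,S}$ on $\tilde X_{0,S}$. Let $g_t$ be the approximate metric on $X_t$ with Kähler form $\omega_t=i_t^*\omega_{FS}+\frac{i}{2\pi}\partial\bar\partial\log h_t$, and let $\tilde g_0$ be the metric on $\bigsqcup_S\tilde X_{0,S}$ whose Kähler form on $\tilde X_{0,S}$ is $i_{0,S}^*\omega_{FS}+\frac{i}{2\pi}\partial\bar\partial\log h_{0,S}$. **Flow.** The Hamiltonian-gradient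 flow $\psi_t$ along the ray $t=re^{i\theta}$ ($\theta$ fixed) of the family $X_t\subset\mathbb{CP}^{|\Delta|-1}$ under the Fubini–Study metric maps $x\in\tilde X_{0,S}$ to the point $\psi_t(x)\in X_t$ such that $r\mapsto\psi_t(x)$ is differentiable for $r>0$, the velocity $\frac{d}{dr}i_t(\psi_t(x))$ is Fubini–Study orthogonal to the tangent space of $X_t$, and $\psi_0(x)=x$ in the toric gauge of $S$, i.e. $(t^{u_i}\psi_t(x)_i)_i\to x$ as $r\to0$, where $m\mapsto\langle u,m\rangle+c$ is the affine function that equals $w$ on $S$. **Proposition.** There is $\kappa_0>0$ (depending on $\Delta$ and $w$ only) such that for every $\kappa\ge\kappa_0$ the tensors $g_t$ are positive definite on $X_t$, the tensor $\tilde g_0$ is a complete Riemannian metric on $\tilde X_0\setminus{\rm Sing}(\tilde X_0)$, and $g_t$ converges to $\tilde g_0$ in the sense of Cheeger–Gromov: for every compact $F\subset\tilde X_0\setminus{\rm Sing}(\tilde X_0)$ there are an open neighbourhood $U$ of $F$ in $\tilde X_0\setminus{\rm Sing}(\tilde X_0)$ and $\rho>0$ such that for all $\theta$ the flow $\psi_t$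 exists and is unique on $U$ for $0<r<\rho$, each $\psi_t$ is a diffeomorphism of $U$ onto an open subset of the regular part of $X_t$, and for every $k$, $\psi_t^*g_t\to\tilde g_0$ on $F$ in the $C^k$ topology as $t=re^{i\theta}\to0$ (uniformly in $\theta$). -/

import Mathlib

open Set Filter Topology
open scoped ContDiff

noncomputable section

namespace Degeneration

/-! ### The polytope and its simplicial decomposition

The lattice is `M = ℤ^l`, `N ⊗ ℂˣ` is the complex torus `(ℂˣ)^l`, an open subset of `Fin l → ℂ`, and
`Δ` is the finite set of lattice points of the polytope. -/

/-- A lattice point as a point of `M ⊗ ℝ`. -/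
def realPt {l : ℕ} (m : Fin l → ℤ) : Fin l → ℝ := fun i => (m i : ℝ)

/-- `Δ` is the set of all lattice points of a full-dimensional integral convex polytope. -/
structure IsIntegralPolytope {l : ℕ} (Δ : Finset (Fin l → ℤ)) : Prop where
  saturated : ∀ m : Fin l → ℤ, realPt m ∈ convexHull ℝ (realPt '' (Δ : Set (Fin l → ℤ))) → m ∈ Δ
  full_dim : affineSpan ℝ (realPt '' (Δ : Set (Fin l → ℤ))) = ⊤

/-- The affine function `m ↦ ⟨u, m⟩ + c`. -/
def affineFn {l : ℕ} (u : Fin l → ℝ) (c : ℝ) (m : Fin l → ℤ) : ℝ := (∑ i, u i * (m i : ℝ)) + c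

/-- The affine function `m ↦ ⟨u, m⟩ + c` supports `w` from below and touches it exactly on `S`. -/
def Supports {l : ℕ} {Δ : Finset (Fin l → ℤ)} (w : Δ → ℝ) (S : Finset Δ) (u : Fin l → ℝ) (c : ℝ) :
    Prop :=
  (∀ m : Δ, affineFn u c m ≤ w m) ∧ ∀ m : Δ, m ∈ S ↔ affineFn u c m = w m

/-- `S` is (the vertex set of) a cell of the decomposition of the polytope determined by `w`. -/
def IsCell {l : ℕ} {Δ : Finset (Fin l → ℤ)} (w : Δ → ℝ) (S : Finset Δ) : Prop :=
  S.Nonempty ∧ ∃ u c, Supports w S u c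

/-- `w` is a convex function on the lattice points of the polytope, and all the cells of the
decomposition it determines are simplices. -/
structure IsSimplicialWeight {l : ℕ} {Δ : Finset (Fin l → ℤ)} (w : Δ → ℝ) : Prop where
  convex : ∃ f : (Fin l → ℝ) → ℝ,
    ConvexOn ℝ (convexHull ℝ (realPt '' (Δ : Set (Fin l → ℤ)))) f ∧ ∀ m : Δ, f (realPt m) = w m
  simplicial : ∀ S : Finset Δ, IsCell w S →
    AffineIndependent ℝ (fun m : S => realPt ((m : Δ) : Fin l → ℤ))

open Classical in
/-- The top-dimensional simplices. -/
def Ztop {l : ℕ} {Δ : Finset (Fin l → ℤ)} (w : Δ → ℝ) : Finset (Finset Δ) :=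
  Finset.univ.filter fun S => S.card = l + 1 ∧ IsCell w S

/-! ### The hypersurfaces -/

def torus (l : ℕ) : Set (Fin l → ℂ) := {x | ∀ i, x i ≠ 0}

/-- The monomial `s_m`. -/
def monomial {l : ℕ} (m : Fin l → ℤ) (x : Fin l → ℂ) : ℂ := ∏ i, x i ^ m i

/-- The power `t ^ a` for `t = r e^{iθ}` and real `a`, with the branch of `log t` given by `θ`. -/
def tpow (r θ a : ℝ) : ℂ := ((r ^ a : ℝ) : ℂ) * Complex.exp (Complex.I * (θ * a : ℝ))

/-- The homogeneous coordinates `(t ^ {w_m} s_m)_m` of the map `i_t` from the torus to projective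
space, with `t = r e^{iθ}`. -/
def emb {l : ℕ} {Δ : Finset (Fin l → ℤ)} (w : Δ → ℝ) (r θ : ℝ) (x : Fin l → ℂ) : Δ → ℂ :=
  fun m => tpow r θ (w m) * monomial m x

/-- The defining function `s_t`. -/
def section_ {l : ℕ} {Δ : Finset (Fin l → ℤ)} (w : Δ → ℝ) (r θ : ℝ) (x : Fin l → ℂ) : ℂ :=
  ∑ m, emb w r θ x m

/-- The hypersurface `X_t`. -/
def hyp {l : ℕ} {Δ : Finset (Fin l → ℤ)} (w : Δ → ℝ) (r θ : ℝ) : Set (Fin l → ℂ) :=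
  {x | x ∈ torus l ∧ section_ w r θ x = 0}

open Classical in
/-- The homogeneous coordinates of the limit map `i_{0,S}`: `s_m` for `m ∈ S`, and `0` otherwise. -/
def embZero {l : ℕ} {Δ : Finset (Fin l → ℤ)} (S : Finset Δ) (x : Fin l → ℂ) : Δ → ℂ :=
  fun m => if m ∈ S then monomial m x else 0

def sectionZero {l : ℕ} {Δ : Finset (Fin l → ℤ)} (S : Finset Δ) (x : Fin l → ℂ) : ℂ :=
  ∑ m, embZero S x m

/-- The generalized pair of pants `X̃_{0,S}`, the preimage under `i_{0,S}` of the hyperplane on which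
the sum of the homogeneous coordinates vanishes. The smooth part of the canonical limit `X̃_0` is the
disjoint union of the `X̃_{0,S}` over `S ∈ Ztop w`. -/
def pants {l : ℕ} {Δ : Finset (Fin l → ℤ)} (S : Finset Δ) : Set (Fin l → ℂ) :=
  {x | x ∈ torus l ∧ sectionZero S x = 0}

/-! ### The metrics -/

/-- The Fubini–Study metric, with Kähler form `(i / 2π) ∂∂̄ log |z|²`, as a (degenerate) symmetric
bilinear form in homogeneous coordinates. -/
def fubiniStudy {ι : Type*} [Fintype ι] (z a b : ι → ℂ) : ℝ :=
  (1 / Real.pi) * ((∑ i, a i * star (b i)) / (∑ i, z i * star (z i))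
    - (∑ i, a i * star (z i)) * (∑ i, z i * star (b i)) / (∑ i, z i * star (z i)) ^ 2 : ℂ).re

/-- The symmetric bilinear form `g(a, b) = ω(a, J b)` of the `(1,1)`-form `ω = (i / 2π) ∂∂̄ f`.
Restriction to a complex submanifold commutes with `∂∂̄`. -/
def ddbar {l : ℕ} (f : (Fin l → ℂ) → ℝ) (x a b : Fin l → ℂ) : ℝ :=
  (1 / (4 * Real.pi)) * (fderiv ℝ (fderiv ℝ f) x a b
    + fderiv ℝ (fderiv ℝ f) x (Complex.I • a) (Complex.I • b))

/-- `η_m`, as a function of homogeneous coordinates. -/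
def eta {ι : Type*} [Fintype ι] (z : ι → ℂ) (m : ι) : ℝ := ‖z m‖ ^ 2 / ∑ i, ‖z i‖ ^ 2

/-- `A_S = ∏_{m ∈ S} a_m⁻¹` with `a_m = κ - log η_m`. -/
def bigA {ι : Type*} [Fintype ι] (κ : ℝ) (S : Finset ι) (z : ι → ℂ) : ℝ :=
  (∏ m ∈ S, (κ - Real.log (eta z m)))⁻¹

/-- `h_t`. -/
def h {l : ℕ} {Δ : Finset (Fin l → ℤ)} (w : Δ → ℝ) (κ r θ : ℝ) (x : Fin l → ℂ) : ℝ :=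
  κ ^ 2 * ∑ S ∈ Ztop w, bigA κ S (emb w r θ x) ^ 2

/-- `h_{0,S}`. -/
def hZero {l : ℕ} {Δ : Finset (Fin l → ℤ)} (κ : ℝ) (S : Finset Δ) (x : Fin l → ℂ) : ℝ :=
  κ ^ 2 * bigA κ S (embZero S x) ^ 2

/-- The approximate metric `g_t` (to be restricted to `X_t`), with Kähler form
`e_t^* ω_FS + (i / 2π) ∂∂̄ log h_t`. -/
def gApprox {l : ℕ} {Δ : Finset (Fin l → ℤ)} (w : Δ → ℝ) (κ r θ : ℝ) (x a b : Fin l → ℂ) : ℝ :=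
  fubiniStudy (emb w r θ x) (fderiv ℂ (emb w r θ) x a) (fderiv ℂ (emb w r θ) x b)
    + ddbar (fun y => Real.log (h w κ r θ y)) x a b

/-- The metric `g̃_0` on the component `X̃_{0,S}`, with Kähler form
`e_0^* ω_FS + (i / 2π) ∂∂̄ log h_{0,S}`. -/
def gZero {l : ℕ} {Δ : Finset (Fin l → ℤ)} (κ : ℝ) (S : Finset Δ) (x a b : Fin l → ℂ) : ℝ :=
  fubiniStudy (embZero S x) (fderiv ℂ (embZero S) x a) (fderiv ℂ (embZero S) x b)
    + ddbar (fun y => Real.log (hZero κ S y)) x a b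

/-- `g` is positive definite on the tangent spaces of the hypersurface `X = {s = 0}`. -/
def IsPosDefOn {l : ℕ} (X : Set (Fin l → ℂ)) (s : (Fin l → ℂ) → ℂ)
    (g : (Fin l → ℂ) → (Fin l → ℂ) → (Fin l → ℂ) → ℝ) : Prop :=
  ∀ x ∈ X, ∀ v, fderiv ℂ s x v = 0 → v ≠ 0 → 0 < g x v v

/-- Riemannian distance on `X`: infimum of lengths of `C¹` paths in `X` (`∞` if there is none). -/
def riemDist {l : ℕ} (X : Set (Fin l → ℂ))
    (g : (Fin l → ℂ) → (Fin l → ℂ) → (Fin l → ℂ) → ℝ) (x y : Fin l → ℂ) : ENNReal :=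
  ⨅ (c : ℝ → Fin l → ℂ) (_ : ContDiffOn ℝ 1 c (Icc 0 1)) (_ : MapsTo c (Icc 0 1) X)
    (_ : c 0 = x) (_ : c 1 = y),
    ∫⁻ s in Icc (0 : ℝ) 1, ENNReal.ofReal (Real.sqrt (g (c s) (deriv c s) (deriv c s)))

/-- Every Cauchy sequence for the Riemannian distance converges in `X`. -/
def IsCompleteOn {l : ℕ} (X : Set (Fin l → ℂ))
    (g : (Fin l → ℂ) → (Fin l → ℂ) → (Fin l → ℂ) → ℝ) : Prop :=
  ∀ u : ℕ → Fin l → ℂ, (∀ n, u n ∈ X) →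
    (∀ ε : ENNReal, 0 < ε → ∃ n₀, ∀ i ≥ n₀, ∀ j ≥ n₀, riemDist X g (u i) (u j) < ε) →
    ∃ x ∈ X, Tendsto (fun n => riemDist X g (u n) x) atTop (𝓝 0)

/-! ### The Hamiltonian-gradient flow -/

/-- `γ` is the trajectory, for `0 < r < ρ` along the ray `t = r e^{iθ}`, of the Hamiltonian-gradient
flow of the family `X_t` in projective space under the Fubini–Study metric, starting at
`x ∈ X̃_{0,S}`.

On the total space with a metric inducing the Fubini–Study metric on the fibres, the
Hamiltonian-gradient field is `∇f / |∇f|²`, `f` being the coordinate `r` along the ray, that is, the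
field that lifts `∂/∂r` and is orthogonal to the fibres. So `γ r` lies on `X_t`, and the velocity in
projective space of the point `i_t(γ r)` is Fubini–Study orthogonal to the tangent space of `X_t`.
The starting point is expressed in the toric gauge of `S`: with `⟨u, m⟩ + c = w_m` on `S`, the
translation `y_i = t^{u_i} x_i` of the torus turns `w` into `w_m - ⟨u, m⟩ - c`, which vanishes on `S`;
in the coordinates `y` the trajectory tends to `x`. -/
structure IsFlowLine {l : ℕ} {Δ : Finset (Fin l → ℤ)} (w : Δ → ℝ) (S : Finset Δ) (θ ρ : ℝ)
    (x : Fin l → ℂ) (γ : ℝ → Fin l → ℂ) : Prop where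
  mem : ∀ r ∈ Ioo 0 ρ, γ r ∈ hyp w r θ
  diff : ∀ r ∈ Ioo 0 ρ, DifferentiableAt ℝ γ r
  horizontal : ∀ r ∈ Ioo 0 ρ, ∀ v, fderiv ℂ (section_ w r θ) (γ r) v = 0 →
    fubiniStudy (emb w r θ (γ r)) (deriv (fun r' => emb w r' θ (γ r')) r)
      (fderiv ℂ (emb w r θ) (γ r) v) = 0
  start : ∃ u c, Supports w S u c ∧
    Tendsto (fun r => fun i => tpow r θ (u i) * γ r i) (𝓝[>] 0) (𝓝 x)

/-- `ψ S θ r`, for `0 < r < ρ`, is the Hamiltonian-gradient flow `ψ_t`, `t = r e^{iθ}`, on the open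
part `⋃_S (U S ∩ X̃_{0,S})` of the smooth part of `X̃_0`. -/
def IsFlow {l : ℕ} {Δ : Finset (Fin l → ℤ)} (w : Δ → ℝ) (U : Finset Δ → Set (Fin l → ℂ)) (ρ : ℝ)
    (ψ : Finset Δ → ℝ → ℝ → (Fin l → ℂ) → (Fin l → ℂ)) : Prop :=
  ∀ S ∈ Ztop w, ∀ θ, ∀ x ∈ U S ∩ pants S, IsFlowLine w S θ ρ x (fun r => ψ S θ r x)

/-! ### Smoothness and convergence in charts -/

/-- `φ` is a smooth local parametrization (the inverse of a chart), with domain `V`, of the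
`(l-1)`-dimensional complex submanifold `X`, seen as a real manifold. -/
structure IsLocalParam {l : ℕ} (X : Set (Fin l → ℂ)) (V : Set (Fin (l - 1) → ℂ))
    (φ : (Fin (l - 1) → ℂ) → (Fin l → ℂ)) : Prop where
  isOpen : IsOpen V
  smooth : ContDiffOn ℝ ∞ φ V
  maps : MapsTo φ V X
  inj : InjOn φ V
  immersion : ∀ p ∈ V, Function.Injective (fderiv ℝ φ p)

/-- On the open part `⋃_S (U S ∩ X̃_{0,S})` of the smooth part of `X̃_0`, the map `ψ` to `X_t` is a
smooth injective immersion into the regular part of `X_t`, i.e. a diffeomorphism onto an open subset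
of it. -/
structure IsEmbeddingOn {l : ℕ} {Δ : Finset (Fin l → ℤ)} (w : Δ → ℝ) (r θ : ℝ)
    (U : Finset Δ → Set (Fin l → ℂ)) (ψ : Finset Δ → (Fin l → ℂ) → (Fin l → ℂ)) : Prop where
  regular : ∀ S ∈ Ztop w, ∀ x ∈ U S ∩ pants S,
    ψ S x ∈ hyp w r θ ∧ fderiv ℂ (section_ w r θ) (ψ S x) ≠ 0
  smooth : ∀ S ∈ Ztop w, ∀ V φ, IsLocalParam (pants S) V φ →
    ContDiffOn ℝ ∞ (ψ S ∘ φ) (V ∩ φ ⁻¹' U S)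
  immersion : ∀ S ∈ Ztop w, ∀ V φ, IsLocalParam (pants S) V φ →
    ∀ p ∈ V ∩ φ ⁻¹' U S, Function.Injective (fderiv ℝ (ψ S ∘ φ) p)
  inj : ∀ S ∈ Ztop w, ∀ S' ∈ Ztop w, ∀ x ∈ U S ∩ pants S, ∀ x' ∈ U S' ∩ pants S',
    ψ S x = ψ S' x' → S = S' ∧ x = x'

/-- The component in the directions `a`, `b` of the pullback of `g` under `f`. -/
def pullback {l n : ℕ} (g : (Fin l → ℂ) → (Fin l → ℂ) → (Fin l → ℂ) → ℝ)
    (f : (Fin n → ℂ) → (Fin l → ℂ)) (a b p : Fin n → ℂ) : ℝ :=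
  g (f p) (fderiv ℝ f p a) (fderiv ℝ f p b)

/-- `ψ_t^* g_t → g₀` in the `C^k` topology on the compact subset `F` of `X`, as `τ` runs along the
filter `L`: in every chart the components of the tensors converge, together with their derivatives of
order at most `k`, uniformly on compact sets that the chart maps into `F`. -/
def PullbackConvergesCk {l : ℕ} {T : Type*} (L : Filter T) (k : ℕ) (X F : Set (Fin l → ℂ))
    (g : T → (Fin l → ℂ) → (Fin l → ℂ) → (Fin l → ℂ) → ℝ) (ψ : T → (Fin l → ℂ) → (Fin l → ℂ))
    (g₀ : (Fin l → ℂ) → (Fin l → ℂ) → (Fin l → ℂ) → ℝ) : Prop :=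
  ∀ V φ, IsLocalParam X V φ → ∀ K ⊆ V, IsCompact K → φ '' K ⊆ F → ∀ j ≤ k, ∀ a b,
    TendstoUniformlyOn (fun τ p => iteratedFDeriv ℝ j (pullback (g τ) (ψ τ ∘ φ) a b) p)
      (fun p => iteratedFDeriv ℝ j (pullback g₀ φ a b) p) L K

end Degeneration

end

/-! Everything is phrased for the map `mon c` with coordinates `c_m s_m`: the coefficients `c_m =
t^{w_m}` give `X_t`, and the indicator function `ind S` gives the limit component of `S`.

Positivity. Since `log |s_m|` is pluriharmonic, each function `a_m` has `(i/2π) ∂∂̄ a_m` equal to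
the pulled back Fubini–Study form. The function `log h` is, up to a constant, a log-sum-exp of the
functions `-2 ∑_{m ∈ S} log a_m`. Log-sum-exp is convex, so `∂∂̄ log h` is bounded below by the
average of their `∂∂̄`. The only negative contribution comes from `-2 ∂∂̄ a_m / a_m`. As `a_m ≥ κ`
and each cell has `l + 1` vertices, `κ ≥ 4(l + 1)` makes this at most half of Fubini–Study. What
remains (`le_gGen`) is half of Fubini–Study, which is definite because the exponents affinely span,
plus an average of the squares `(d log a_m)²`.

Completeness. The second term makes `log a_m`, `m ∈ S`, Lipschitz for the limit metric. Hence a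
Cauchy sequence, and the short paths joining its terms, stay where these `a_m` are bounded. By
`exists_box` this region lies in a compact part of the torus, where the metric dominates a Euclidean
one. The Euclidean limit is also the limit for the Riemannian distance, because the pair of pants is
a smooth hypersurface (`exists_fderiv_sectionZero_eq_one`, `tendsto_riemDist`).

The flow. Translating the torus by `t^u` replaces `w` by the excess `ν`, which vanishes on `S` and
is positive elsewhere; the coefficients `t^ν` then tend to `ind S`. Orthogonality to the fibres is a
linear system with a Lagrange multiplier, so the flow is an ODE `y' = hfield y c c'`, linear in the
velocity `c'` of the coefficients. In the variable `r` this velocity can blow up at `0`; the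
substitution `r = R σ^N` with `N ν_m ≥ 2` off `S` cures this. The path `(c, dc/dσ)` on `[0, 1]` is
then a point of a Banach space that tends to the constant path `(ind S, 0)` as `R → 0`, uniformly in
`θ`. Along that constant path the field vanishes and the solutions are constant. The implicit
function theorem, applied to the integral equation, gives a solution smooth in the starting point
and in the path (`exists_smooth_solution`, `exists_localSolution`). A continuation argument
(`LocalSolution.eq_flow`) excludes other trajectories, and compactness glues the local solutions
(`exists_flow_near`).

Convergence. For `m ∉ S` the function `a_m` grows like `-2 ν_m log r`, and `a_m⁻¹` is a smooth
function of the bounded data and of `ε = -1 / log r`, vanishing at `ε = 0`. Another top cell has a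
vertex outside `S`, so its term in `h_t` disappears in the limit (`hExt_ind`). The pulled back
metric is therefore a smooth function of the point and of a parameter (path of coefficients, `ε`)
that converges as `t → 0`; all derivatives converge uniformly on compact sets
(`tendstoUniformlyOn_iteratedFDeriv`, `tendstoUniformlyOn_pullback`). -/

noncomputable section

namespace Degeneration

universe u

/-! ### The composition operator on continuous functions on a compact space -/

section Nemytskii

variable {K : Type*} [TopologicalSpace K] [CompactSpace K]
  {V W : Type u} [NormedAddCommGroup V] [NormedSpace ℝ V] [NormedAddCommGroup W] [NormedSpace ℝ W]

/-- A continuous family of continuous linear maps, as a continuous linear map between spaces of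
continuous functions. -/
def pointwiseCLM (A : C(K, V →L[ℝ] W)) : C(K, V) →L[ℝ] C(K, W) :=
  LinearMap.mkContinuous
    { toFun := fun h => ⟨fun s => A s (h s), A.continuous.clm_apply h.continuous⟩
      map_add' := fun h k => by ext; simp
      map_smul' := fun c h => by ext; simp } ‖A‖ fun h => by
    refine (ContinuousMap.norm_le _ (by positivity)).2 fun s => ?_
    exact ((A s).le_opNorm _).trans
      (mul_le_mul (A.norm_coe_le_norm s) (h.norm_coe_le_norm s) (norm_nonneg _) (norm_nonneg A))

lemma norm_pointwiseCLM_le (A : C(K, V →L[ℝ] W)) : ‖pointwiseCLM A‖ ≤ ‖A‖ :=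
  LinearMap.mkContinuous_norm_le _ (norm_nonneg A) _

@[simp] lemma pointwiseCLM_apply (A : C(K, V →L[ℝ] W)) (h : C(K, V)) (s : K) :
    pointwiseCLM A h s = A s (h s) := rfl

/-- `pointwiseCLM` as a continuous linear map. -/
def pointwiseCLML : C(K, V →L[ℝ] W) →L[ℝ] (C(K, V) →L[ℝ] C(K, W)) :=
  LinearMap.mkContinuous
    { toFun := fun A : C(K, V →L[ℝ] W) => (pointwiseCLM A : C(K, V) →L[ℝ] C(K, W))
      map_add' := fun A B => ContinuousLinearMap.ext fun h => by ext; simp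
      map_smul' := fun c A => ContinuousLinearMap.ext fun h => by ext; simp } 1 fun A => by
    rw [one_mul]
    exact norm_pointwiseCLM_le A

/-- The mean value inequality on each segment from `g s` to `g s + h s` bounds the remainder. It is
uniform in `s` because `g ↦ f' ∘ g` is continuous for the sup norm, so no local compactness of `V`
is needed. -/
lemma hasFDerivAt_comp_continuousMap (f : C(V, W)) (f' : C(V, V →L[ℝ] W))
    (hf : ∀ x, HasFDerivAt f (f' x) x) (g : C(K, V)) :
    HasFDerivAt (fun g : C(K, V) => f.comp g) (pointwiseCLM (f'.comp g)) g := by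
  rw [hasFDerivAt_iff_isLittleO_nhds_zero, Asymptotics.isLittleO_iff]
  intro ε hε
  have hc : Continuous fun h : C(K, V) => f'.comp h := ContinuousMap.continuous_postcomp f'
  obtain ⟨δ, hδ, hδ'⟩ := (Metric.continuousAt_iff (f := fun h : C(K, V) => f'.comp h)
    (a := g)).1 hc.continuousAt ε hε
  filter_upwards [Metric.ball_mem_nhds 0 hδ] with h hh
  refine (ContinuousMap.norm_le _ (by positivity)).2 fun s => ?_
  have key : ∀ x ∈ segment ℝ (g s) (g s + h s), ‖f' x - f' (g s)‖ ≤ ε := by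
    intro x hx
    rw [segment_eq_image'] at hx
    obtain ⟨τ, hτ, rfl⟩ := hx
    have h1 : dist (g + τ • h) g < δ := by
      rw [dist_eq_norm, add_sub_cancel_left, norm_smul, Real.norm_of_nonneg hτ.1]
      have := mem_ball_zero_iff.1 hh
      nlinarith [norm_nonneg h, hτ.2, hτ.1]
    have h2 := hδ' h1
    have h3 := (ContinuousMap.dist_lt_iff hε).1 h2 s
    rw [dist_eq_norm] at h3
    simpa using h3.le
  have := (convex_segment (g s) (g s + h s)).norm_image_sub_le_of_norm_hasFDerivWithin_le'
    (fun x _ => (hf x).hasFDerivWithinAt) key (left_mem_segment ℝ _ _) (right_mem_segment ℝ _ _)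
  simp only [add_sub_cancel_left] at this
  refine this.trans ?_
  gcongr
  exact h.norm_coe_le_norm s

/-- The composition operator of a smooth map is smooth. -/
lemma contDiff_comp_continuousMap (n : ℕ) : ∀ {W : Type u} [NormedAddCommGroup W] [NormedSpace ℝ W]
    (f : C(V, W)), ContDiff ℝ n f → ContDiff ℝ n (fun g : C(K, V) => f.comp g) := by
  -- The target `W` must vary in the induction, because the derivative is composition with `f'`,
  -- which has values in `V →L[ℝ] W`, followed by a continuous linear map.
  induction n with
  | zero =>
    intro W _ _ f _
    exact contDiff_zero.2 (ContinuousMap.continuous_postcomp f)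
  | succ n ih =>
    intro W _ _ f hf
    have hf' : ContDiff ℝ (n + 1) f := by exact_mod_cast hf
    obtain ⟨hd, -, hc⟩ := contDiff_succ_iff_fderiv.1 hf'
    let f' : C(V, V →L[ℝ] W) := ⟨fderiv ℝ f, hc.continuous⟩
    have hD : ∀ g : C(K, V), HasFDerivAt (fun g : C(K, V) => f.comp g)
        (pointwiseCLM (f'.comp g)) g := fun g =>
      hasFDerivAt_comp_continuousMap f f' (fun x => (hd x).hasFDerivAt) g
    have h1 : ContDiff ℝ ((n : WithTop ℕ∞) + 1) (fun g : C(K, V) => f.comp g) := by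
      refine contDiff_succ_iff_fderiv.2 ⟨fun g => (hD g).differentiableAt, by simp, ?_⟩
      have : fderiv ℝ (fun g : C(K, V) => f.comp g) = fun g => pointwiseCLML (f'.comp g) :=
        funext fun g => (hD g).fderiv
      rw [this]
      exact pointwiseCLML.contDiff.comp (ih f' hc)
    exact_mod_cast h1

end Nemytskii

/-! ### Integral equations with parameters -/

section IntegralEquation

variable {E B : Type u} [NormedAddCommGroup E] [NormedSpace ℝ E]
  [NormedAddCommGroup B] [NormedSpace ℝ B]

/-- The primitive vanishing at `0` of a continuous function on the unit interval. -/
def primitive : C(unitInterval, E) →L[ℝ] C(unitInterval, E) :=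
  LinearMap.mkContinuous
    { toFun := fun g => ⟨fun σ => ∫ τ in (0 : ℝ)..σ, IccExtend zero_le_one g τ,
        (intervalIntegral.continuous_primitive
          (fun a b => (g.continuous.Icc_extend' (h := zero_le_one)).intervalIntegrable a b) 0).comp
          continuous_subtype_val⟩
      map_add' := fun g h => by
        ext σ
        simp only [ContinuousMap.coe_mk, ContinuousMap.add_apply]
        rw [← intervalIntegral.integral_add
          ((g.continuous.Icc_extend' (h := zero_le_one)).intervalIntegrable _ _)
          ((h.continuous.Icc_extend' (h := zero_le_one)).intervalIntegrable _ _)]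
        rfl
      map_smul' := fun c g => by
        ext σ
        simp only [ContinuousMap.coe_mk, ContinuousMap.smul_apply, RingHom.id_apply]
        rw [← intervalIntegral.integral_smul]
        rfl } 1 fun g => by
    rw [one_mul]
    refine (ContinuousMap.norm_le _ (norm_nonneg _)).2 fun σ => ?_
    have h := intervalIntegral.norm_integral_le_of_norm_le_const (a := 0) (b := (σ : ℝ))
      (f := IccExtend zero_le_one g) (C := ‖g‖) fun τ _ => g.norm_coe_le_norm _
    refine h.trans ?_
    rw [sub_zero, abs_of_nonneg σ.2.1]
    exact mul_le_of_le_one_right (norm_nonneg _) σ.2.2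

lemma primitive_apply (g : C(unitInterval, E)) (σ : unitInterval) :
    primitive g σ = ∫ τ in (0 : ℝ)..σ, IccExtend zero_le_one g τ := rfl

/-- `C(I, E) × C(I, B) → C(I, E × B)`. -/
def pairCLM : C(unitInterval, E) × C(unitInterval, B) →L[ℝ] C(unitInterval, E × B) :=
  ((ContinuousLinearMap.inl ℝ E B).compLeftContinuous ℝ unitInterval).comp
      (ContinuousLinearMap.fst ℝ _ _) +
    ((ContinuousLinearMap.inr ℝ E B).compLeftContinuous ℝ unitInterval).comp
      (ContinuousLinearMap.snd ℝ _ _)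

lemma pairCLM_apply (y : C(unitInterval, E)) (b : C(unitInterval, B)) (σ : unitInterval) :
    pairCLM (y, b) σ = (y σ, b σ) := by
  simp [pairCLM]

/-- Constant paths. -/
def constCLM : E →L[ℝ] C(unitInterval, E) :=
  LinearMap.mkContinuous
    { toFun := fun x => ContinuousMap.const _ x
      map_add' := fun _ _ => rfl
      map_smul' := fun _ _ => rfl } 1 fun x => by
    rw [one_mul]
    exact (ContinuousMap.norm_le _ (norm_nonneg _)).2 fun σ => le_rfl

@[simp] lemma constCLM_apply (x : E) (σ : unitInterval) : constCLM x σ = x := rfl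

/-- `y` solves `y' = f(y, b)`, `y(0) = x`, in integral form. -/
def SolvesIntegral (f : E × B → E) (x : E) (b : C(unitInterval, B)) (y : C(unitInterval, E)) :
    Prop :=
  ∀ σ : unitInterval, y σ = x + ∫ τ in (0 : ℝ)..σ,
    f (IccExtend zero_le_one y τ, IccExtend zero_le_one b τ)

/-- The solution of an integral equation depends smoothly on the initial value and on a
path of parameters, near a constant path of parameters at which the field vanishes. -/
theorem exists_smooth_solution [CompleteSpace E] [CompleteSpace B] (f : E × B → E) (hf : ContDiff
    ℝ ∞ f) (b₀ : B)
    (h0 : ∀ y, f (y, b₀) = 0) (x₀ : E) :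
    ∃ Y : E × C(unitInterval, B) → C(unitInterval, E),
      Y (x₀, constCLM b₀) = constCLM x₀ ∧
      (∀ᶠ u in 𝓝 (x₀, (constCLM b₀ : C(unitInterval, B))), ContDiffAt ℝ ∞ Y u) ∧
      ∀ᶠ v in 𝓝 ((x₀, (constCLM b₀ : C(unitInterval, B))), (constCLM x₀ : C(unitInterval, E))),
        (SolvesIntegral f v.1.1 v.1.2 v.2 ↔ Y v.1 = v.2) := by
  let fc : C(E × B, E) := ⟨f, hf.continuous⟩
  let N : C(unitInterval, E × B) → C(unitInterval, E) := fun g => fc.comp g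
  have hN : ContDiff ℝ ∞ N := contDiff_infty.2 fun n =>
    contDiff_comp_continuousMap n fc (hf.of_le (by exact_mod_cast le_top))
  -- The zeros of `F` are the solutions of the integral equation.
  let F : (E × C(unitInterval, B)) × C(unitInterval, E) → C(unitInterval, E) := fun v =>
    v.2 - constCLM v.1.1 - primitive (N (pairCLM (v.2, v.1.2)))
  have hF : ContDiff ℝ ∞ F := by
    refine (contDiff_snd.sub ((constCLM (E := E)).contDiff.comp (contDiff_fst.comp
        contDiff_fst))).sub ?_
    exact (primitive (E := E)).contDiff.comp (hN.comp ((pairCLM (E := E) (B := B)).contDiff.comp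
      (contDiff_snd.prodMk (contDiff_snd.comp contDiff_fst))))
  set u₀ : (E × C(unitInterval, B)) × C(unitInterval, E) := ((x₀, constCLM b₀), constCLM x₀)
  have hsolve : ∀ v, SolvesIntegral f v.1.1 v.1.2 v.2 ↔ F v = 0 := by
    intro v
    have : ∀ σ, F v σ = v.2 σ - (v.1.1 + ∫ τ in (0 : ℝ)..σ,
        f (IccExtend zero_le_one v.2 τ, IccExtend zero_le_one v.1.2 τ)) := by
      intro σ
      simp only [F, ContinuousMap.sub_apply, constCLM_apply, primitive_apply]
      rw [sub_sub]
      congr 3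
      funext τ
      simp only [N, IccExtend, Function.comp, fc, ContinuousMap.comp_apply, ContinuousMap.coe_mk,
        pairCLM_apply]
    constructor
    · intro h
      ext σ
      rw [this, ← h σ, sub_self]; rfl
    · intro h σ
      have := this σ
      rw [h] at this
      exact (sub_eq_zero.1 this.symm)
  have hpart : ∀ y, F ((x₀, constCLM b₀), y) = y - constCLM x₀ := by
    intro y
    have : N (pairCLM (y, constCLM b₀)) = 0 := by
      ext σ
      simp [N, fc, pairCLM_apply, h0]
    simp [F, this]
  have hF0 : F u₀ = 0 := by rw [hpart, sub_self]
  -- With the parameters frozen at `(x₀, b₀)` the field vanishes identically, so `F` is a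
  -- translation in `y` and its partial derivative is the identity. No short time interval is
  -- needed.
  have hd2 : fderiv ℝ F u₀ ∘L .inr ℝ (E × C(unitInterval, B)) C(unitInterval, E) =
      ContinuousLinearMap.id ℝ _ := by
    have h1 : HasFDerivAt (fun y => F ((x₀, constCLM b₀), y))
        (fderiv ℝ F u₀ ∘L .inr ℝ (E × C(unitInterval, B)) C(unitInterval, E)) (constCLM x₀) :=
      HasFDerivAt.comp (constCLM x₀ : C(unitInterval, E))
        (hF.differentiable (by simp) u₀).hasFDerivAt
        (hasFDerivAt_prodMk_right (x₀, (constCLM b₀ : C(unitInterval, B))) (constCLM x₀))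
    have h2 : HasFDerivAt (fun y => F ((x₀, constCLM b₀), y))
        (ContinuousLinearMap.id ℝ C(unitInterval, E)) (constCLM x₀) := by
      simp_rw [hpart]
      exact (hasFDerivAt_id _).sub_const _
    exact h1.unique h2
  have hinv0 : (fderiv ℝ F u₀ ∘L
      .inr ℝ (E × C(unitInterval, B)) C(unitInterval, E)).IsInvertible := by
    rw [hd2]; exact ⟨ContinuousLinearEquiv.refl ℝ _, rfl⟩
  have hne : (∞ : WithTop ℕ∞) ≠ 0 := by simp
  have hFa : ∀ v, ContDiffAt ℝ ∞ F v := fun v => hF.contDiffAt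
  let Y := (hFa u₀).implicitFunction hne hinv0
  have hYc : ContDiffAt ℝ ∞ Y u₀.1 := (hFa u₀).contDiffAt_implicitFunction hne hinv0
  have hY0 : Y u₀.1 = u₀.2 := (hFa u₀).implicitFunction_apply_self hne hinv0
  refine ⟨Y, hY0, ?_, ?_⟩
  -- Being `C^∞` at one point does not give a neighbourhood on which this holds. So the implicit
  -- function theorem is applied again at the nearby points of the graph, where the partial
  -- derivative is still invertible, and its solution agrees with `Y` by local uniqueness.
  · have hcont : ∀ᶠ u in 𝓝 u₀.1, ContinuousAt Y u := by
      have h1 : ContDiffAt ℝ 1 Y u₀.1 := hYc.of_le (by exact_mod_cast le_top)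
      exact (h1.eventually (by simp)).mono fun u hu => hu.continuousAt
    have hsol : ∀ᶠ u in 𝓝 u₀.1, F (u, Y u) = 0 := by
      have := (hFa u₀).eventually_apply_implicitFunction hne hinv0
      rwa [hF0] at this
    have hopen : ∀ᶠ v in 𝓝 u₀, (fderiv ℝ F v ∘L
        .inr ℝ (E × C(unitInterval, B)) C(unitInterval, E)).IsInvertible := by
      have hc : Continuous fun v => fderiv ℝ F v ∘L
          .inr ℝ (E × C(unitInterval, B)) C(unitInterval, E) :=
        (hF.continuous_fderiv (by simp)).clm_comp continuous_const
      refine hc.continuousAt.eventually ?_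
      simp only []
      rw [hd2]
      exact ContinuousLinearEquiv.nhds (ContinuousLinearEquiv.refl ℝ C(unitInterval, E))
    have hgraph : Tendsto (fun u => (u, Y u)) (𝓝 u₀.1) (𝓝 u₀) := by
      have : ContinuousAt (fun u => (u, Y u)) u₀.1 := continuousAt_id.prodMk hYc.continuousAt
      have h2 := this.tendsto
      rwa [hY0] at h2
    filter_upwards [hcont, hsol.eventually_nhds, hgraph.eventually hopen] with u hu hs hi
    have h1 := (hFa (u, Y u)).contDiffAt_implicitFunction hne hi
    refine h1.congr_of_eventuallyEq ?_
    have h2 := (hFa (u, Y u)).eventually_apply_eq_iff_implicitFunction hne hi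
    have h3 : Tendsto (fun u' => (u', Y u')) (𝓝 u) (𝓝 (u, Y u)) :=
      (continuousAt_id.prodMk hu).tendsto
    filter_upwards [h3.eventually h2, hs] with u' h4 h5
    exact (h4.1 (by rw [h5, hs.self_of_nhds])).symm
  · have := (hFa u₀).eventually_apply_eq_iff_implicitFunction hne hinv0
    filter_upwards [this] with v hv
    rw [hsolve, ← hF0]
    exact hv

end IntegralEquation

/-! ### Monomials -/

section Monomials

variable {l : ℕ} {Δ : Finset (Fin l → ℤ)}

lemma isOpen_torus : IsOpen (torus l) := by
  have : torus l = ⋂ i, {x : Fin l → ℂ | x i ≠ 0} := by ext; simp [torus]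
  rw [this]
  exact isOpen_iInter_of_finite fun i => isOpen_ne_fun (continuous_apply i) continuous_const

lemma torus_mem_nhds {x : Fin l → ℂ} (hx : x ∈ torus l) : torus l ∈ 𝓝 x :=
  isOpen_torus.mem_nhds hx

lemma monomial_ne_zero (m : Fin l → ℤ) {x : Fin l → ℂ} (hx : x ∈ torus l) : monomial m x ≠ 0 :=
  Finset.prod_ne_zero_iff.2 fun i _ => zpow_ne_zero _ (hx i)

/-- The derivative of `log s_m` at `x` in the direction `a`. -/
def logDer (m : Fin l → ℤ) (x a : Fin l → ℂ) : ℂ := ∑ i, (m i : ℂ) * (a i / x i)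

lemma hasFDerivAt_monomial (m : Fin l → ℤ) {x : Fin l → ℂ} (hx : x ∈ torus l) :
    HasFDerivAt (𝕜 := ℂ) (monomial m) (∑ i, (monomial m x * ((m i : ℂ) / x i)) •
      ContinuousLinearMap.proj (R := ℂ) (φ := fun _ : Fin l => ℂ) i) x := by
  classical
  have h := HasFDerivAt.finsetProd (u := Finset.univ)
    (g := fun i (x : Fin l → ℂ) => x i ^ m i) (x := x)
    (g' := fun i => ((m i : ℂ) * x i ^ (m i - 1)) •
      ContinuousLinearMap.proj (R := ℂ) (φ := fun _ : Fin l => ℂ) i) fun i _ =>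
    HasDerivAt.comp_hasFDerivAt (h₂ := fun z : ℂ => z ^ m i) x
      (hasDerivAt_zpow (m i) (x i) (Or.inl (hx i)))
      (hasFDerivAt_apply (𝕜 := ℂ) (F' := fun _ : Fin l => ℂ) i x)
  refine h.congr_fderiv ?_
  refine Finset.sum_congr rfl fun i _ => ?_
  rw [smul_smul]
  congr 1
  unfold monomial
  rw [← Finset.mul_prod_erase _ _ (Finset.mem_univ i), zpow_sub_one₀ (hx i)]
  field_simp

lemma fderiv_monomial (m : Fin l → ℤ) {x : Fin l → ℂ} (hx : x ∈ torus l) (a : Fin l → ℂ) :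
    fderiv ℂ (monomial m) x a = monomial m x * logDer m x a := by
  rw [(hasFDerivAt_monomial m hx).fderiv, logDer, Finset.mul_sum]
  simp only [_root_.sum_apply, _root_.smul_apply,
    ContinuousLinearMap.proj_apply, smul_eq_mul]
  exact Finset.sum_congr rfl fun i _ => by ring

/-- The homogeneous coordinates `(c_m s_m)_m`. -/
def mon (c : Δ → ℂ) (x : Fin l → ℂ) : Δ → ℂ := fun m => c m * monomial m x

lemma emb_eq_mon (w : Δ → ℝ) (r θ : ℝ) : emb w r θ = mon fun m => tpow r θ (w m) := rfl

open Classical in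
/-- The indicator function of `S`. -/
def ind (S : Finset Δ) : Δ → ℂ := fun m => if m ∈ S then 1 else 0

lemma embZero_eq_mon (S : Finset Δ) : embZero S = mon (ind S) := by
  funext x m
  simp [embZero, mon, ind]

lemma hasFDerivAt_mon (c : Δ → ℂ) {x : Fin l → ℂ} (hx : x ∈ torus l) :
    HasFDerivAt (𝕜 := ℂ) (mon c) (ContinuousLinearMap.pi fun m : Δ =>
      c m • fderiv ℂ (monomial (m : Fin l → ℤ)) x) x := by
  refine hasFDerivAt_pi.2 fun m => ?_
  exact ((hasFDerivAt_monomial _ hx).differentiableAt.hasFDerivAt).const_mul (c m)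

/-- The derivative of `mon`. -/
def dmon (c : Δ → ℂ) (x a : Fin l → ℂ) : Δ → ℂ := fun m => mon c x m * logDer m x a

lemma fderiv_mon (c : Δ → ℂ) {x : Fin l → ℂ} (hx : x ∈ torus l) (a : Fin l → ℂ) :
    fderiv ℂ (mon c) x a = dmon c x a := by
  rw [(hasFDerivAt_mon c hx).fderiv]
  funext m
  simp only [ContinuousLinearMap.pi_apply, _root_.smul_apply, smul_eq_mul, dmon, mon,
    fderiv_monomial _ hx]
  ring

lemma fderiv_sum_mon (c : Δ → ℂ) {x : Fin l → ℂ} (hx : x ∈ torus l) (a : Fin l → ℂ) :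
    fderiv ℂ (fun y => ∑ m, mon c y m) x a = ∑ m, dmon c x a m := by
  have h := HasFDerivAt.fun_sum (u := Finset.univ) fun (m : Δ) _ =>
    (hasFDerivAt_pi'.1 (hasFDerivAt_mon c hx).differentiableAt.hasFDerivAt m)
  rw [h.fderiv, _root_.sum_apply]
  refine Finset.sum_congr rfl fun m _ => ?_
  rw [← fderiv_mon c hx]; rfl

lemma logDer_add (m : Fin l → ℤ) (x a b : Fin l → ℂ) :
    logDer m x (a + b) = logDer m x a + logDer m x b := by
  simp only [logDer, ← Finset.sum_add_distrib, Pi.add_apply]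
  exact Finset.sum_congr rfl fun i _ => by ring

lemma logDer_smul (m : Fin l → ℤ) (x a : Fin l → ℂ) (k : ℂ) :
    logDer m x (k • a) = k * logDer m x a := by
  simp only [logDer, Finset.mul_sum, Pi.smul_apply, smul_eq_mul]
  exact Finset.sum_congr rfl fun i _ => by ring

lemma dmon_add (c : Δ → ℂ) (x a b : Fin l → ℂ) : dmon c x (a + b) = dmon c x a + dmon c x b := by
  funext m; simp [dmon, logDer_add, mul_add]

lemma dmon_smul (c : Δ → ℂ) (x a : Fin l → ℂ) (k : ℂ) : dmon c x (k • a) = k • dmon c x a := by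
  funext m; simp [dmon, logDer_smul]; ring

lemma contDiffAt_zpow_complex {x : ℂ} (hx : x ≠ 0) (n : ℤ) {k : WithTop ℕ∞} :
    ContDiffAt ℂ k (fun z : ℂ => z ^ n) x := by
  cases n with
  | ofNat n => simpa using contDiffAt_id.pow n
  | negSucc n =>
    simp only [zpow_negSucc]
    exact (contDiffAt_id.pow (n + 1)).inv (pow_ne_zero _ hx)

lemma contDiffAt_monomial (m : Fin l → ℤ) {x : Fin l → ℂ} (hx : x ∈ torus l) {k : WithTop ℕ∞} :
    ContDiffAt ℝ k (monomial m) x := by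
  refine ContDiffAt.restrict_scalars (𝕜' := ℂ) ℝ ?_
  unfold monomial
  refine contDiffAt_prod fun i _ => ?_
  exact (contDiffAt_zpow_complex (hx i) (m i)).comp x (contDiffAt_apply ℂ ℂ i x)

end Monomials

/-! ### Variance -/

section Variance

variable {ι : Type*} [Fintype ι]

/-- The variance of `x` under the weights `p`. -/
def var (p x : ι → ℝ) : ℝ := ∑ i, p i * x i ^ 2 - (∑ i, p i * x i) ^ 2

lemma var_eq {p : ι → ℝ} (hp : ∑ i, p i = 1) (x : ι → ℝ) :
    var p x = ∑ i, p i * (x i - ∑ j, p j * x j) ^ 2 := by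
  set M := ∑ j, p j * x j
  have : ∀ i, p i * (x i - M) ^ 2 = p i * x i ^ 2 - 2 * M * (p i * x i) + M ^ 2 * p i := by
    intro i; ring
  simp only [this, Finset.sum_add_distrib, Finset.sum_sub_distrib, ← Finset.mul_sum, hp, var]
  change _ - M ^ 2 = _ - 2 * M * M + M ^ 2 * 1
  ring

lemma var_nonneg {p : ι → ℝ} (hp : ∑ i, p i = 1) (h0 : ∀ i, 0 ≤ p i) (x : ι → ℝ) :
    0 ≤ var p x := by
  rw [var_eq hp]
  exact Finset.sum_nonneg fun i _ => mul_nonneg (h0 i) (sq_nonneg _)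

/-- The variance is a sum of non-negative squares about the mean, so each term vanishes. This is the
rigidity behind the definiteness of the Fubini–Study pullback. -/
lemma eq_of_var_eq_zero {p : ι → ℝ} (hp : ∑ i, p i = 1) (h0 : ∀ i, 0 ≤ p i) {x : ι → ℝ}
    (hx : var p x = 0) {i : ι} (hi : 0 < p i) : x i = ∑ j, p j * x j := by
  rw [var_eq hp, Finset.sum_eq_zero_iff_of_nonneg
    fun i _ => mul_nonneg (h0 i) (sq_nonneg _)] at hx
  have := hx i (Finset.mem_univ i)
  rcases mul_eq_zero.1 this with h | h
  · exact absurd h hi.ne'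
  · exact sub_eq_zero.1 (pow_eq_zero_iff two_ne_zero |>.1 h)

end Variance

/-! ### The Fubini–Study form -/

section FubiniStudy

variable {ι : Type*} [Fintype ι]

/-- The Hermitian form whose real part is `π` times the Fubini–Study metric. -/
def herm (z a b : ι → ℂ) : ℂ :=
  (∑ i, a i * star (b i)) / (∑ i, z i * star (z i))
    - (∑ i, a i * star (z i)) * (∑ i, z i * star (b i)) / (∑ i, z i * star (z i)) ^ 2

lemma fubiniStudy_eq (z a b : ι → ℂ) : fubiniStudy z a b = (1 / Real.pi) * (herm z a b).re := rfl

lemma fubiniStudy_eq_zero_iff (z a b : ι → ℂ) : fubiniStudy z a b = 0 ↔ (herm z a b).re = 0 := by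
  rw [fubiniStudy_eq]
  simp [Real.pi_ne_zero]

lemma sum_mul_star (z : ι → ℂ) : ∑ i, z i * star (z i) = ((∑ i, ‖z i‖ ^ 2 : ℝ) : ℂ) := by
  push_cast
  exact Finset.sum_congr rfl fun i _ => Complex.mul_conj' (z i)

lemma sum_sq_pos {z : ι → ℂ} (hz : ∃ i, z i ≠ 0) : 0 < ∑ i, ‖z i‖ ^ 2 := by
  obtain ⟨i, hi⟩ := hz
  exact Finset.sum_pos' (fun _ _ => by positivity) ⟨i, Finset.mem_univ i, by positivity⟩

lemma herm_add_left (z a a' b : ι → ℂ) : herm z (a + a') b = herm z a b + herm z a' b := by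
  simp only [herm, Pi.add_apply, add_mul, Finset.sum_add_distrib]
  ring

lemma herm_smul_left (z a b : ι → ℂ) (k : ℂ) : herm z (k • a) b = k * herm z a b := by
  simp only [herm, Pi.smul_apply, smul_eq_mul, mul_assoc, ← Finset.mul_sum]
  ring

lemma herm_add_right (z a b b' : ι → ℂ) : herm z a (b + b') = herm z a b + herm z a b' := by
  simp only [herm, Pi.add_apply, star_add, mul_add, Finset.sum_add_distrib]
  ring

lemma herm_smul_right (z a b : ι → ℂ) (k : ℂ) : herm z a (k • b) = star k * herm z a b := by
  have : ∀ x : ι → ℂ, ∑ i, x i * star ((k • b) i) = star k * ∑ i, x i * star (b i) := by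
    intro x
    rw [Finset.mul_sum]
    exact Finset.sum_congr rfl fun i _ => by simp [Pi.smul_apply]; ring
  simp only [herm, this]
  ring

/-- The radial direction is in the kernel. Together with `herm_smul_smul` this lets the form descend
to projective space, so it is insensitive to a common factor that moves with time. -/
lemma herm_self_left {z : ι → ℂ} (hz : ∃ i, z i ≠ 0) (b : ι → ℂ) : herm z z b = 0 := by
  have : (∑ i, z i * star (z i)) ≠ 0 := by
    rw [sum_mul_star]
    exact_mod_cast (sum_sq_pos hz).ne'
  simp only [herm]
  field_simp
  ring

lemma herm_smul_smul {k : ℂ} (hk : k ≠ 0) (z a b : ι → ℂ) :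
    herm (k • z) (k • a) (k • b) = herm z a b := by
  have h : ∀ x y : ι → ℂ, ∑ i, (k • x) i * star ((k • y) i) =
      (k * star k) * ∑ i, x i * star (y i) := by
    intro x y
    rw [Finset.mul_sum]
    exact Finset.sum_congr rfl fun i _ => by simp [Pi.smul_apply]; ring
  have hk' : k * star k ≠ 0 := mul_ne_zero hk (star_ne_zero.2 hk)
  simp only [herm, h]
  generalize k * star k = K at hk'
  rw [mul_div_mul_left _ _ hk', mul_pow, show K * (∑ i, a i * star (z i)) *
    (K * ∑ i, z i * star (b i)) = K ^ 2 * ((∑ i, a i * star (z i)) * ∑ i, z i * star (b i)) by ring,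
    mul_div_mul_left _ _ (pow_ne_zero 2 hk')]

lemma sum_eta {z : ι → ℂ} (hz : ∃ i, z i ≠ 0) : ∑ i, eta z i = 1 := by
  simp only [eta, ← Finset.sum_div]
  exact div_self (sum_sq_pos hz).ne'

lemma eta_nonneg (z : ι → ℂ) (i : ι) : 0 ≤ eta z i := by
  unfold eta; positivity

lemma eta_pos {z : ι → ℂ} {i : ι} (hi : z i ≠ 0) : 0 < eta z i :=
  div_pos (by positivity) (sum_sq_pos ⟨i, hi⟩)

lemma eta_le_one (z : ι → ℂ) (i : ι) : eta z i ≤ 1 :=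
  div_le_one_of_le₀ (Finset.single_le_sum (f := fun i => ‖z i‖ ^ 2) (fun _ _ => by positivity)
    (Finset.mem_univ i)) (Finset.sum_nonneg fun _ _ => by positivity)

lemma log_eta_nonpos (z : ι → ℂ) (i : ι) : Real.log (eta z i) ≤ 0 :=
  Real.log_nonpos (eta_nonneg z i) (eta_le_one z i)

/-- In logarithmic directions the form is the variance of the complex variable `τ` under the weights
`η`, split into real and imaginary parts. -/
lemma herm_mul_self (z τ : ι → ℂ) :
    (herm z (fun i => z i * τ i) (fun i => z i * τ i)).re =
      var (eta z) (fun i => (τ i).re) + var (eta z) (fun i => (τ i).im) := by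
  set Z : ℝ := ∑ i, ‖z i‖ ^ 2
  have h1 : ∀ f : ι → ℂ, (∑ i, z i * star (z i) * f i) / ((Z : ℝ) : ℂ) =
      ∑ i, ((eta z i : ℝ) : ℂ) * f i := by
    intro f
    rw [Finset.sum_div]
    refine Finset.sum_congr rfl fun i _ => ?_
    rw [show z i * star (z i) = ((‖z i‖ ^ 2 : ℝ) : ℂ) by
      rw [Complex.ofReal_pow]; exact Complex.mul_conj' (z i)]
    simp only [eta, Complex.ofReal_div]
    change _ = _ / ((Z : ℝ) : ℂ) * f i
    ring
  have h2 : herm z (fun i => z i * τ i) (fun i => z i * τ i) =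
      ∑ i, ((eta z i : ℝ) : ℂ) * (τ i * star (τ i)) -
        (∑ i, ((eta z i : ℝ) : ℂ) * τ i) * ∑ i, ((eta z i : ℝ) : ℂ) * star (τ i) := by
    rw [← h1, ← h1, ← h1]
    simp only [herm, sum_mul_star, star_mul']
    rw [div_mul_div_comm, ← sq]
    congr 2
    · exact Finset.sum_congr rfl fun i _ => by ring
    · congr 1
      · exact Finset.sum_congr rfl fun i _ => by ring
      · exact Finset.sum_congr rfl fun i _ => by ring
  rw [h2]
  simp only [var, Complex.sub_re, Complex.re_sum, Complex.mul_re, Complex.im_sum, Complex.mul_im,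
    Complex.ofReal_re, Complex.ofReal_im, zero_mul, sub_zero, add_zero, Complex.star_def,
    Complex.conj_re, Complex.conj_im]
  simp only [mul_neg, Finset.sum_neg_distrib, sub_neg_eq_add, mul_add, Finset.sum_add_distrib,
    ← sq]
  ring

end FubiniStudy

/-! ### Affinely spanning sets of lattice points -/

section Separating

variable {l : ℕ} {Δ : Finset (Fin l → ℤ)}

/-- No non-zero linear form is constant on `T`. -/
def Separating (T : Set (Fin l → ℤ)) : Prop :=
  ∀ (β : Fin l → ℝ) (k : ℝ), (∀ m ∈ T, ∑ i, (m i : ℝ) * β i = k) → β = 0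

lemma separating_of_affineSpan {T : Set (Fin l → ℤ)} (hT : affineSpan ℝ (realPt '' T) = ⊤) :
    Separating T := by
  intro β k h
  have h1 := AffineSubspace.vectorSpan_eq_top_of_affineSpan_eq_top ℝ (Fin l → ℝ) (Fin l → ℝ) hT
  let L : (Fin l → ℝ) →ₗ[ℝ] ℝ := ∑ i, β i • LinearMap.proj i
  have hL : ∀ x, L x = ∑ i, x i * β i := fun x => by
    simp [L, LinearMap.sum_apply, mul_comm]
  have h2 : vectorSpan ℝ (realPt '' T) ≤ LinearMap.ker L := by
    rw [vectorSpan_def, Submodule.span_le]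
    rintro _ ⟨_, ⟨m, hm, rfl⟩, _, ⟨m', hm', rfl⟩, rfl⟩
    change L (realPt m - realPt m') = 0
    rw [map_sub, hL, hL]
    simp only [realPt]
    rw [h m hm, h m' hm', sub_self]
  rw [h1] at h2
  funext i
  classical
  have := h2 (Submodule.mem_top (x := Pi.single i (1 : ℝ)))
  rw [LinearMap.mem_ker, hL] at this
  simpa [Pi.single_apply] using this

/-- A top cell consists of `l + 1` affinely independent points, hence spans the whole space. -/
lemma separating_of_mem_Ztop {w : Δ → ℝ} (hw : IsSimplicialWeight w) {S : Finset Δ}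
    (hS : S ∈ Ztop w) : Separating ((fun m : Δ => (m : Fin l → ℤ)) '' (S : Set Δ)) := by
  classical
  simp only [Ztop, Finset.mem_filter, Finset.mem_univ, true_and] at hS
  have hi := hw.simplicial S hS.2
  refine separating_of_affineSpan ?_
  have := (hi.affineSpan_eq_top_iff_card_eq_finrank_add_one).2 (by simp [hS.1])
  rw [← this]
  congr 1
  ext x
  simp

lemma separating_univ (hΔ : IsIntegralPolytope Δ) : Separating (Δ : Set (Fin l → ℤ)) :=
  separating_of_affineSpan hΔ.full_dim

lemma Separating.complex {T : Set (Fin l → ℤ)} (hT : Separating T) {β : Fin l → ℂ} {k : ℂ}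
    (h : ∀ m ∈ T, ∑ i, (m i : ℂ) * β i = k) : β = 0 := by
  have h1 := hT (fun i => (β i).re) k.re fun m hm => by
    rw [← h m hm, Complex.re_sum]
    exact Finset.sum_congr rfl fun i _ => by simp [Complex.mul_re]
  have h2 := hT (fun i => (β i).im) k.im fun m hm => by
    rw [← h m hm, Complex.im_sum]
    exact Finset.sum_congr rfl fun i _ => by simp [Complex.mul_im]
  funext i
  exact Complex.ext (congrFun h1 i) (congrFun h2 i)

/-- The support of `c`, as a set of lattice points, is separating. -/
def SepSupport (c : Δ → ℂ) : Prop :=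
  Separating ((fun m : Δ => (m : Fin l → ℤ)) '' {m | c m ≠ 0})

/-- Zero variance would make the logarithmic derivatives `∑ m_i a_i / x_i` equal for all `m` in the
support of `c`, and a separating support then forces `a = 0`. So the monomial map is an immersion
into projective space. -/
lemma herm_dmon_pos {c : Δ → ℂ} (hc : SepSupport c) (hne : ∃ m, c m ≠ 0)
    {x : Fin l → ℂ} (hx : x ∈ torus l) {a : Fin l → ℂ} (ha : a ≠ 0) :
    0 < (herm (mon c x) (dmon c x a) (dmon c x a)).re := by
  obtain ⟨m₀, hm₀⟩ := hne
  have hz : ∃ m, mon c x m ≠ 0 := ⟨m₀, mul_ne_zero hm₀ (monomial_ne_zero _ hx)⟩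
  have hp := sum_eta hz
  have h0 := eta_nonneg (mon c x)
  change 0 < (herm (mon c x) (fun m => mon c x m * logDer m x a) _).re
  change 0 < (herm (mon c x) _ (fun m => mon c x m * logDer m x a)).re
  rw [herm_mul_self]
  have v1 := var_nonneg hp h0 fun m => (logDer m x a).re
  have v2 := var_nonneg hp h0 fun m => (logDer m x a).im
  refine lt_of_le_of_ne (add_nonneg v1 v2) fun h => ha ?_
  have e1 : var (eta (mon c x)) (fun m => (logDer m x a).re) = 0 := by linarith
  have e2 : var (eta (mon c x)) (fun m => (logDer m x a).im) = 0 := by linarith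
  have key : (fun i => a i / x i) = 0 := by
    refine hc.complex (k := ⟨∑ j, eta (mon c x) j * (logDer j x a).re,
      ∑ j, eta (mon c x) j * (logDer j x a).im⟩) ?_
    rintro _ ⟨m, hm, rfl⟩
    have hpm : 0 < eta (mon c x) m := eta_pos (mul_ne_zero hm (monomial_ne_zero _ hx))
    exact Complex.ext (eq_of_var_eq_zero hp h0 e1 hpm) (eq_of_var_eq_zero hp h0 e2 hpm)
  funext i
  have := congrFun key i
  simpa [hx i] using this

lemma sepSupport_ind {w : Δ → ℝ} (hw : IsSimplicialWeight w) {S : Finset Δ}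
    (hS : S ∈ Ztop w) : SepSupport (ind S) := by
  have : {m : Δ | ind S m ≠ 0} = (S : Set Δ) := by ext m; simp [ind]
  rw [SepSupport, this]
  exact separating_of_mem_Ztop hw hS

lemma nonempty_of_mem_Ztop {w : Δ → ℝ} {S : Finset Δ} (hS : S ∈ Ztop w) : S.Nonempty := by
  classical
  simp only [Ztop, Finset.mem_filter, Finset.mem_univ, true_and] at hS
  exact hS.2.1

lemma card_of_mem_Ztop {w : Δ → ℝ} {S : Finset Δ} (hS : S ∈ Ztop w) : S.card = l + 1 := by
  classical
  simp only [Ztop, Finset.mem_filter, Finset.mem_univ, true_and] at hS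
  exact hS.1

lemma sepSupport_of_ne_zero (hΔ : IsIntegralPolytope Δ) {c : Δ → ℂ} (hc : ∀ m, c m ≠ 0) :
    SepSupport c := by
  have : (fun m : Δ => (m : Fin l → ℤ)) '' {m | c m ≠ 0} = (Δ : Set (Fin l → ℤ)) := by
    ext m; simp [hc]
  rw [SepSupport, this]
  exact separating_univ hΔ

lemma nonempty_of_isIntegralPolytope (hΔ : IsIntegralPolytope Δ) : ∃ _ : Δ, True := by
  by_contra! h
  have : (Δ : Set (Fin l → ℤ)) = ∅ := by
    ext m; simp; exact fun hm => h ⟨m, hm⟩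
  have h2 := hΔ.full_dim
  rw [this, image_empty, AffineSubspace.span_empty] at h2
  exact AffineSubspace.bot_ne_top ℝ (Fin l → ℝ) (Fin l → ℝ) h2

end Separating

/-! ### Second order jets of functions of a real variable -/

section Jets

/-- `f` is differentiable near `0` with `f'(0) = f₁` and `f''(0) = f₂`. -/
def Jet (f : ℝ → ℝ) (f₁ f₂ : ℝ) : Prop :=
  ∃ f' : ℝ → ℝ, (∀ᶠ s in 𝓝 0, HasDerivAt f (f' s) s) ∧ f' 0 = f₁ ∧ HasDerivAt f' f₂ 0

lemma Jet.unique {f : ℝ → ℝ} {a b a' b' : ℝ} (h : Jet f a b) (h' : Jet f a' b') :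
    a = a' ∧ b = b' := by
  obtain ⟨f', h1, h2, h3⟩ := h
  obtain ⟨g', k1, k2, k3⟩ := h'
  have : f' =ᶠ[𝓝 0] g' := by
    filter_upwards [h1, k1] with s hs ks using hs.unique ks
  exact ⟨by rw [← h2, ← k2, this.eq_of_nhds], h3.unique (k3.congr_of_eventuallyEq this)⟩

lemma Jet.congr {f g : ℝ → ℝ} {a b : ℝ} (h : Jet f a b) (hfg : g =ᶠ[𝓝 0] f) : Jet g a b := by
  obtain ⟨f', h1, h2, h3⟩ := h
  refine ⟨f', ?_, h2, h3⟩
  filter_upwards [h1, hfg.eventually_nhds] with s hs hs' using hs.congr_of_eventuallyEq hs'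

lemma Jet.differentiableAt {f : ℝ → ℝ} {a b : ℝ} (h : Jet f a b) : DifferentiableAt ℝ f 0 := by
  obtain ⟨f', h1, -, -⟩ := h
  exact h1.self_of_nhds.differentiableAt

lemma jet_const (c : ℝ) : Jet (fun _ => c) 0 0 :=
  ⟨fun _ => 0, Eventually.of_forall fun s => hasDerivAt_const s c, rfl, hasDerivAt_const 0 0⟩

lemma Jet.add {f g : ℝ → ℝ} {a b a' b' : ℝ} (h : Jet f a b) (h' : Jet g a' b') :
    Jet (fun s => f s + g s) (a + a') (b + b') := by
  obtain ⟨f', h1, h2, h3⟩ := h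
  obtain ⟨g', k1, k2, k3⟩ := h'
  refine ⟨fun s => f' s + g' s, ?_, by simp only [h2, k2], h3.add k3⟩
  filter_upwards [h1, k1] with s hs ks using hs.add ks

lemma Jet.const_mul {f : ℝ → ℝ} {a b : ℝ} (h : Jet f a b) (k : ℝ) :
    Jet (fun s => k * f s) (k * a) (k * b) := by
  obtain ⟨f', h1, h2, h3⟩ := h
  refine ⟨fun s => k * f' s, ?_, by simp only [h2], h3.const_mul k⟩
  filter_upwards [h1] with s hs using hs.const_mul k

lemma jet_sum {ι : Type*} (T : Finset ι) {f : ι → ℝ → ℝ} {a b : ι → ℝ}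
    (h : ∀ i ∈ T, Jet (f i) (a i) (b i)) :
    Jet (fun s => ∑ i ∈ T, f i s) (∑ i ∈ T, a i) (∑ i ∈ T, b i) := by
  classical
  induction T using Finset.induction_on with
  | empty => simpa using jet_const 0
  | insert i T hi ih =>
    simp only [Finset.sum_insert hi]
    exact (h i (Finset.mem_insert_self i T)).add
      (ih fun j hj => h j (Finset.mem_insert_of_mem hj))

lemma Jet.comp {f : ℝ → ℝ} {a b : ℝ} (h : Jet f a b) {g g₁ : ℝ → ℝ} {g₂ : ℝ}
    (hg : ∀ᶠ u in 𝓝 (f 0), HasDerivAt g (g₁ u) u) (hg₁ : HasDerivAt g₁ g₂ (f 0)) :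
    Jet (fun s => g (f s)) (g₁ (f 0) * a) (g₂ * a ^ 2 + g₁ (f 0) * b) := by
  have hc := h.differentiableAt.continuousAt
  obtain ⟨f', h1, h2, h3⟩ := h
  refine ⟨fun s => g₁ (f s) * f' s, ?_, by simp only [h2], ?_⟩
  · filter_upwards [h1, hc.eventually hg] with s hs hs' using hs'.comp s hs
  · have h4 := (hg₁.comp 0 h1.self_of_nhds).mul h3
    rw [h2] at h4
    refine h4.congr_deriv ?_
    simp only [Function.comp_apply]
    ring

lemma Jet.exp {f : ℝ → ℝ} {a b : ℝ} (h : Jet f a b) :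
    Jet (fun s => Real.exp (f s)) (Real.exp (f 0) * a) (Real.exp (f 0) * (b + a ^ 2)) := by
  have := h.comp (Eventually.of_forall fun u => Real.hasDerivAt_exp u) (Real.hasDerivAt_exp (f 0))
  convert this using 1
  ring

lemma Jet.log {f : ℝ → ℝ} {a b : ℝ} (h : Jet f a b) (h0 : f 0 ≠ 0) :
    Jet (fun s => Real.log (f s)) (a / f 0) (b / f 0 - (a / f 0) ^ 2) := by
  have := h.comp (g := Real.log) (g₂ := -(f 0 ^ 2)⁻¹) (g₁ := fun u => u⁻¹) ?_ (hasDerivAt_inv h0)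
  · convert this using 1
    · field_simp
    · field_simp; ring
  · filter_upwards [isOpen_ne.mem_nhds h0] with u hu using Real.hasDerivAt_log hu

/-- The jet of a log-sum-exp function. -/
lemma jet_log_sum_exp {ι : Type*} [Fintype ι] {C : ι → ℝ} {f : ι → ℝ → ℝ} {u q p : ι → ℝ}
    (h : ∀ i, Jet (f i) (u i) (q i)) (hZ : ∑ i, C i * Real.exp (f i 0) ≠ 0)
    (hp : ∀ i, p i = C i * Real.exp (f i 0) / ∑ j, C j * Real.exp (f j 0)) :
    Jet (fun s => Real.log (∑ i, C i * Real.exp (f i s))) (∑ i, p i * u i)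
      (∑ i, p i * q i + var p u) := by
  have h1 := (jet_sum Finset.univ fun i _ => ((h i).exp.const_mul (C i))).log hZ
  have e1 : ∑ i, p i * u i = (∑ i, C i * (Real.exp (f i 0) * u i)) /
      ∑ j, C j * Real.exp (f j 0) := by
    rw [Finset.sum_div]
    exact Finset.sum_congr rfl fun i _ => by rw [hp]; ring
  have e2 : ∑ i, p i * q i + ∑ i, p i * u i ^ 2 =
      (∑ i, C i * (Real.exp (f i 0) * (q i + u i ^ 2))) / ∑ j, C j * Real.exp (f j 0) := by
    rw [Finset.sum_div, ← Finset.sum_add_distrib]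
    exact Finset.sum_congr rfl fun i _ => by rw [hp]; ring
  convert h1 using 1
  rw [← e2, ← e1, var]
  ring

/-- These are the real parts of the derivatives of a holomorphic logarithm. The second one changes
sign under `a ↦ i a`, which is pluriharmonicity along lines. -/
lemma jet_log_norm {x : ℂ} (hx : x ≠ 0) (a : ℂ) :
    Jet (fun s : ℝ => Real.log ‖x + s * a‖) (a / x).re (-((a / x) ^ 2).re) := by
  have hN : Jet (fun s : ℝ => Complex.normSq (x + s * a))
      (2 * (x.re * a.re + x.im * a.im)) (2 * Complex.normSq a) := by
    refine ⟨fun s => 2 * (x.re * a.re + x.im * a.im) + 2 * Complex.normSq a * s,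
      Eventually.of_forall fun s => ?_, by simp, ?_⟩
    · have h1 : HasDerivAt (fun s : ℝ => (x.re + s * a.re) * (x.re + s * a.re) +
          (x.im + s * a.im) * (x.im + s * a.im))
          (2 * (x.re * a.re + x.im * a.im) + 2 * Complex.normSq a * s) s := by
        have r1 : HasDerivAt (fun s : ℝ => x.re + s * a.re) a.re s := by
          simpa using ((hasDerivAt_id s).mul_const a.re).const_add x.re
        have r2 : HasDerivAt (fun s : ℝ => x.im + s * a.im) a.im s := by
          simpa using ((hasDerivAt_id s).mul_const a.im).const_add x.im
        refine ((r1.mul r1).add (r2.mul r2)).congr_deriv ?_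
        simp only [Complex.normSq_apply]; ring
      refine h1.congr_of_eventuallyEq (Eventually.of_forall fun s => ?_)
      simp [Complex.normSq_apply]
    · simpa using ((hasDerivAt_id (0 : ℝ)).const_mul (2 * Complex.normSq a)).const_add
        (2 * (x.re * a.re + x.im * a.im))
  have hx' : Complex.normSq x ≠ 0 := (Complex.normSq_pos.2 hx).ne'
  have h2 := (hN.log (by simpa using hx')).const_mul (1 / 2)
  simp only [Complex.ofReal_zero, zero_mul, add_zero] at h2
  have h3 := h2.congr (g := fun s : ℝ => Real.log ‖x + s * a‖)
    (Eventually.of_forall fun s => by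
      simp only [Complex.normSq_eq_norm_sq, Real.log_pow]; push_cast; ring)
  convert h3 using 1
  · rw [Complex.div_re]; field_simp
  · rw [sq, Complex.mul_re, Complex.div_re, Complex.div_im]
    have := hx'
    rw [Complex.normSq_apply] at this
    simp only [Complex.normSq_apply]
    field_simp
    ring

/-- With `Jet.unique` this reads Hessians off one-variable computations. Positivity needs only their
values on the diagonal. -/
lemma jet_of_contDiffAt {E : Type*} [NormedAddCommGroup E] [NormedSpace ℝ E] {f : E → ℝ} {x : E}
    (hf : ContDiffAt ℝ 2 f x) (a : E) :
    Jet (fun s : ℝ => f (x + s • a)) (fderiv ℝ f x a) (fderiv ℝ (fderiv ℝ f) x a a) := by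
  have hline : ∀ s : ℝ, HasDerivAt (fun s : ℝ => x + s • a) a s := fun s => by
    simpa using ((hasDerivAt_id s).smul_const a).const_add x
  have hcont : Tendsto (fun s : ℝ => x + s • a) (𝓝 0) (𝓝 x) := by
    simpa using (hline 0).continuousAt.tendsto
  refine ⟨fun s => fderiv ℝ f (x + s • a) a, ?_, by simp, ?_⟩
  · have h1 : ∀ᶠ y in 𝓝 x, DifferentiableAt ℝ f y :=
      (hf.eventually (by simp)).mono fun y hy => hy.differentiableAt (by simp)
    filter_upwards [hcont.eventually h1] with s hs
    exact hs.hasFDerivAt.comp_hasDerivAt s (hline s)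
  · have h2 : HasFDerivAt (fderiv ℝ f) (fderiv ℝ (fderiv ℝ f) x) (x + (0 : ℝ) • a) := by
      have : ContDiffAt ℝ 1 (fderiv ℝ f) x := hf.fderiv_right (by norm_num)
      simpa using (this.differentiableAt (by simp)).hasFDerivAt
    have h3 := h2.comp_hasDerivAt (0 : ℝ) (hline 0)
    exact h3.clm_apply (hasDerivAt_const (0 : ℝ) a) |>.congr_deriv (by simp)

end Jets

/-! ### Positivity of the approximate metrics -/

section Positivity

variable {l : ℕ} {Δ : Finset (Fin l → ℤ)}

/-- `a_m`, as a function on the torus. -/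
def aFun (κ : ℝ) (c : Δ → ℂ) (m : Δ) (x : Fin l → ℂ) : ℝ := κ - Real.log (eta (mon c x) m)

/-- `h` for a family `𝒮` of cells. -/
def hGen (κ : ℝ) (𝒮 : Finset (Finset Δ)) (c : Δ → ℂ) (x : Fin l → ℂ) : ℝ :=
  κ ^ 2 * ∑ S ∈ 𝒮, bigA κ S (mon c x) ^ 2

/-- The symmetric form `i^* ω_FS + (i / 2π) ∂∂̄ log h`. -/
def gGen (κ : ℝ) (𝒮 : Finset (Finset Δ)) (c : Δ → ℂ) (x a b : Fin l → ℂ) : ℝ :=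
  fubiniStudy (mon c x) (fderiv ℂ (mon c) x a) (fderiv ℂ (mon c) x b)
    + ddbar (fun y => Real.log (hGen κ 𝒮 c y)) x a b

lemma gApprox_eq (w : Δ → ℝ) (κ r θ : ℝ) :
    gApprox w κ r θ = gGen κ (Ztop w) (fun m => tpow r θ (w m)) := rfl

lemma gZero_eq (κ : ℝ) (S : Finset Δ) : gZero κ S = gGen κ {S} (ind S) := by
  funext x a b
  simp only [gZero, gGen, hZero, hGen, embZero_eq_mon, Finset.sum_singleton]

lemma exists_mon_ne_zero {c : Δ → ℂ} {x : Fin l → ℂ} (hx : x ∈ torus l) {m : Δ} (hm : c m ≠ 0) :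
    ∃ m, mon c x m ≠ 0 := ⟨m, mul_ne_zero hm (monomial_ne_zero _ hx)⟩

lemma le_aFun (κ : ℝ) (c : Δ → ℂ) (m : Δ) (x : Fin l → ℂ) : κ ≤ aFun κ c m x := by
  have := log_eta_nonpos (mon c x) m
  unfold aFun; linarith

lemma contDiffAt_norm_sq_mon (c : Δ → ℂ) (m : Δ) {x : Fin l → ℂ} (hx : x ∈ torus l)
    {n : WithTop ℕ∞} : ContDiffAt ℝ n (fun x => ‖mon c x m‖ ^ 2) x :=
  ContDiffAt.norm_sq ℝ (contDiffAt_const.mul (contDiffAt_monomial (m : Fin l → ℤ) hx) :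
    ContDiffAt ℝ n (fun x : Fin l → ℂ => c m * monomial (m : Fin l → ℤ) x) x)

lemma contDiffAt_aFun (κ : ℝ) {c : Δ → ℂ} {m : Δ} (hm : c m ≠ 0) {x : Fin l → ℂ}
    (hx : x ∈ torus l) {n : WithTop ℕ∞} : ContDiffAt ℝ n (aFun κ c m) x := by
  have hz := exists_mon_ne_zero hx hm
  refine contDiffAt_const.sub (ContDiffAt.log (f := fun x => eta (mon c x) m) ?_
    (eta_pos (z := mon c x) (i := m) (mul_ne_zero hm (monomial_ne_zero _ hx))).ne')
  unfold eta
  exact (contDiffAt_norm_sq_mon c m hx).div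
    (ContDiffAt.sum fun i _ => contDiffAt_norm_sq_mon c i hx) (sum_sq_pos hz).ne'

lemma bigA_mon (κ : ℝ) (S : Finset Δ) (c : Δ → ℂ) (x : Fin l → ℂ) :
    bigA κ S (mon c x) = (∏ m ∈ S, aFun κ c m x)⁻¹ := rfl

lemma contDiffAt_bigA {κ : ℝ} (hκ : 0 < κ) {c : Δ → ℂ} {S : Finset Δ} (hS : ∀ m ∈ S, c m ≠ 0)
    {x : Fin l → ℂ} (hx : x ∈ torus l) {n : WithTop ℕ∞} :
    ContDiffAt ℝ n (fun x => bigA κ S (mon c x)) x := by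
  simp only [bigA_mon]
  refine (contDiffAt_prod fun m hm => contDiffAt_aFun κ (hS m hm) hx).inv ?_
  exact Finset.prod_ne_zero_iff.2 fun m _ => (hκ.trans_le (le_aFun κ c m x)).ne'

lemma bigA_sq_pos {κ : ℝ} (hκ : 0 < κ) (c : Δ → ℂ) (S : Finset Δ) (x : Fin l → ℂ) :
    0 < bigA κ S (mon c x) ^ 2 := by
  rw [bigA_mon]
  have : 0 < ∏ m ∈ S, aFun κ c m x :=
    Finset.prod_pos fun m _ => hκ.trans_le (le_aFun κ c m x)
  positivity

lemma hGen_pos {κ : ℝ} (hκ : 0 < κ) {𝒮 : Finset (Finset Δ)} (h𝒮 : 𝒮.Nonempty) (c : Δ → ℂ)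
    (x : Fin l → ℂ) : 0 < hGen κ 𝒮 c x :=
  mul_pos (by positivity) (Finset.sum_pos (fun S _ => bigA_sq_pos hκ c S x) h𝒮)

lemma contDiffAt_log_hGen {κ : ℝ} (hκ : 0 < κ) {𝒮 : Finset (Finset Δ)} {c : Δ → ℂ}
    (hc : ∀ S ∈ 𝒮, ∀ m ∈ S, c m ≠ 0) {x : Fin l → ℂ} (hx : x ∈ torus l) {n : WithTop ℕ∞} :
    ContDiffAt ℝ n (fun y => Real.log (hGen κ 𝒮 c y)) x := by
  rcases 𝒮.eq_empty_or_nonempty with rfl | hne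
  -- Without cells `hGen` is zero and `Real.log 0 = 0`, so the correction term is constant.
  · simp only [hGen, Finset.sum_empty, mul_zero, Real.log_zero]
    exact contDiffAt_const
  · refine ContDiffAt.log ?_ (hGen_pos hκ hne c x).ne'
    exact contDiffAt_const.mul (ContDiffAt.sum fun S hS => (contDiffAt_bigA hκ (hc S hS) hx).pow 2)

lemma eventually_line_mem_torus {x : Fin l → ℂ} (hx : x ∈ torus l) (a : Fin l → ℂ) :
    ∀ᶠ s : ℝ in 𝓝 0, x + s • a ∈ torus l := by
  have : ContinuousAt (fun s : ℝ => x + s • a) 0 := by fun_prop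
  exact this.eventually_mem (by simpa using torus_mem_nhds hx)

/-- The second derivative of `a_m` along a line, up to a term that is odd under `a ↦ i a`. -/
lemma fderiv_fderiv_aFun (κ : ℝ) {c : Δ → ℂ} {m : Δ} (hm : c m ≠ 0) {x : Fin l → ℂ}
    (hx : x ∈ torus l) (a : Fin l → ℂ) :
    fderiv ℝ (fderiv ℝ (aFun κ c m)) x a a =
      4 * var (eta (mon c x)) (fun m' => (logDer m' x a).re)
      + 2 * (∑ i, (m : Fin l → ℤ) i * ((a i / x i) ^ 2).re
        - ∑ m', eta (mon c x) m' * ∑ i, (m' : Fin l → ℤ) i * ((a i / x i) ^ 2).re) := by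
  have hz := exists_mon_ne_zero hx hm
  let ℓ : Δ → ℝ → ℝ := fun m s => ∑ i, (m : Fin l → ℤ) i * Real.log ‖x i + s * a i‖
  have hℓ : ∀ m : Δ, Jet (ℓ m) (logDer m x a).re
      (∑ i, (m : Fin l → ℤ) i * (-((a i / x i) ^ 2).re)) := by
    intro m
    have h1 := jet_sum Finset.univ fun i _ =>
      (jet_log_norm (hx i) (a i)).const_mul ((m : Fin l → ℤ) i : ℝ)
    convert h1 using 1
    rw [logDer, Complex.re_sum]
    exact Finset.sum_congr rfl fun i _ => by simp [Complex.mul_re]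
  have hnorm : ∀ s : ℝ, x + s • a ∈ torus l → ∀ m : Δ,
      ‖mon c (x + s • a) m‖ ^ 2 = ‖c m‖ ^ 2 * Real.exp (2 * ℓ m s) := by
    intro s hs m
    have h1 : Real.exp (ℓ m s) = ‖monomial (m : Fin l → ℤ) (x + s • a)‖ := by
      simp only [ℓ, Real.exp_sum, monomial, norm_prod]
      refine Finset.prod_congr rfl fun i _ => ?_
      rw [mul_comm, Real.exp_mul, norm_zpow, Real.exp_log]
      · simp
      · simpa using hs i
    rw [two_mul, Real.exp_add, h1, mon, norm_mul]
    ring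
  have hx0 : x + (0 : ℝ) • a ∈ torus l := by simpa using hx
  have hn0 : ∀ m : Δ, ‖mon c x m‖ ^ 2 = ‖c m‖ ^ 2 * Real.exp (2 * ℓ m 0) := fun m => by
    simpa using hnorm 0 hx0 m
  -- Along the line `log ∑ |c_m s_m|²` is a log-sum-exp whose weights are the `η_m`. Its second
  -- derivative is a variance plus averages of terms that are odd under `a ↦ i a`.
  have hZ := jet_log_sum_exp (C := fun m => ‖c m‖ ^ 2) (f := fun m s => 2 * ℓ m s)
    (p := eta (mon c x)) (fun m => (hℓ m).const_mul 2)
    (by simp only [← hn0]; exact (sum_sq_pos hz).ne') (fun m => by simp only [← hn0]; rfl)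
  have hA := ((jet_const (κ - Real.log (‖c m‖ ^ 2))).add ((hℓ m).const_mul (-2))).add hZ
  have hA' := hA.congr (g := fun s : ℝ => aFun κ c m (x + s • a)) <| by
    filter_upwards [eventually_line_mem_torus hx a] with s hs
    have hz' := exists_mon_ne_zero hs hm
    rw [aFun, eta, Real.log_div (by have := monomial_ne_zero m hs; simp [mon, hm, this])
      (sum_sq_pos hz').ne', hnorm s hs m, Real.log_mul (by positivity) (Real.exp_pos _).ne',
      Real.log_exp]
    simp only [hnorm s hs]
    ring
  have key := ((jet_of_contDiffAt (contDiffAt_aFun κ hm hx) a).unique hA').2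
  rw [key]
  have hv : var (eta (mon c x)) (fun m' => 2 * (logDer m' x a).re) =
      4 * var (eta (mon c x)) (fun m' => (logDer m' x a).re) := by
    simp only [var, mul_pow, mul_left_comm _ (2 : ℝ), ← Finset.mul_sum, mul_left_comm _ ((2 : ℝ)
        ^ 2)]
    ring
  rw [hv]
  simp only [mul_neg, Finset.sum_neg_distrib, mul_left_comm _ (2 : ℝ), ← Finset.mul_sum]
  ring

lemma logDer_I_smul (m : Fin l → ℤ) (x a : Fin l → ℂ) :
    (logDer m x (Complex.I • a)).re = -(logDer m x a).im := by
  rw [logDer_smul]; simp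

lemma var_neg {ι : Type*} [Fintype ι] (p x : ι → ℝ) : var p (fun i => -x i) = var p x := by
  simp [var]

lemma herm_dmon_re (c : Δ → ℂ) (x a : Fin l → ℂ) :
    (herm (mon c x) (dmon c x a) (dmon c x a)).re =
      var (eta (mon c x)) (fun m : Δ => (logDer (m : Fin l → ℤ) x a).re) +
        var (eta (mon c x)) (fun m : Δ => (logDer (m : Fin l → ℤ) x a).im) := by
  have h := herm_mul_self (mon c x) fun m : Δ => logDer (m : Fin l → ℤ) x a
  unfold dmon
  exact h

/-- The odd terms cancel between `a` and `i a`, and the two variances add up to the Hermitian form.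
With the normalizations `1 / (4π)` and `1 / π` this says that `(i/2π) ∂∂̄ a_m` is the Fubini–Study
form, whatever `m`. -/
lemma fderiv_fderiv_aFun_add (κ : ℝ) {c : Δ → ℂ} {m : Δ} (hm : c m ≠ 0) {x : Fin l → ℂ}
    (hx : x ∈ torus l) (a : Fin l → ℂ) :
    fderiv ℝ (fderiv ℝ (aFun κ c m)) x a a +
      fderiv ℝ (fderiv ℝ (aFun κ c m)) x (Complex.I • a) (Complex.I • a) =
      4 * (herm (mon c x) (dmon c x a) (dmon c x a)).re := by
  have h1 := herm_dmon_re c x a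
  rw [fderiv_fderiv_aFun κ hm hx, fderiv_fderiv_aFun κ hm hx, h1]
  have h2 : ∀ i, (((Complex.I • a) i / x i) ^ 2).re = -((a i / x i) ^ 2).re := by
    intro i
    rw [Pi.smul_apply, smul_eq_mul, mul_div_assoc, mul_pow, Complex.I_sq]
    simp
  simp only [h2, logDer_I_smul, var_neg, mul_neg, Finset.sum_neg_distrib]
  ring

/-- The weight of the cell `S` in `h`. -/
def cellWeight (κ : ℝ) (𝒮 : Finset (Finset Δ)) (c : Δ → ℂ) (x : Fin l → ℂ) (S : Finset Δ) : ℝ :=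
  bigA κ S (mon c x) ^ 2 / ∑ S' ∈ 𝒮, bigA κ S' (mon c x) ^ 2

/-- The difference of the two sides is the variance, under the cell weights, of the first
derivatives of `-2 ∑_{m ∈ S} log a_m`; it is dropped because it is non-negative. -/
lemma le_fderiv_fderiv_log_hGen {κ : ℝ} (hκ : 0 < κ) {𝒮 : Finset (Finset Δ)} {c : Δ → ℂ}
    (hc : ∀ S ∈ 𝒮, ∀ m ∈ S, c m ≠ 0) {x : Fin l → ℂ} (hx : x ∈ torus l) (a : Fin l → ℂ) :
    ∑ S ∈ 𝒮, cellWeight κ 𝒮 c x S * ∑ m ∈ S,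
        (2 * (fderiv ℝ (aFun κ c m) x a / aFun κ c m x) ^ 2
          - 2 * (fderiv ℝ (fderiv ℝ (aFun κ c m)) x a a / aFun κ c m x))
      ≤ fderiv ℝ (fderiv ℝ fun y => Real.log (hGen κ 𝒮 c y)) x a a := by
  rcases 𝒮.eq_empty_or_nonempty with rfl | hne
  · simp [hGen]
  have hpos : ∀ m y, 0 < aFun κ c m y := fun m y => hκ.trans_le (le_aFun κ c m y)
  have hexp : ∀ (S : Finset Δ) y, bigA κ S (mon c y) ^ 2 =
      1 * Real.exp (-2 * ∑ m ∈ S, Real.log (aFun κ c m y)) := by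
    intro S y
    have hP : 0 < ∏ m ∈ S, aFun κ c m y := Finset.prod_pos fun m _ => hpos m y
    rw [bigA_mon, ← Real.log_prod fun m _ => (hpos m y).ne', mul_comm (-2 : ℝ), Real.exp_mul,
      Real.exp_log hP, one_mul, Real.rpow_neg hP.le, inv_pow]
    norm_num
  have hb : ∀ S : 𝒮, Jet (fun s : ℝ => -2 * ∑ m ∈ (S : Finset Δ),
      Real.log (aFun κ c m (x + s • a))) _ _ := fun S =>
    (jet_sum (S : Finset Δ) fun m hm =>
      (jet_of_contDiffAt (contDiffAt_aFun κ (hc S S.2 m hm) hx) a).log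
        (hpos m _).ne').const_mul (-2)
  have hsum : ∀ y, ∑ S ∈ 𝒮, bigA κ S (mon c y) ^ 2 = ∑ S : 𝒮,
      1 * Real.exp (-2 * ∑ m ∈ (S : Finset Δ), Real.log (aFun κ c m y)) := by
    intro y
    simp only [hexp]
    exact (Finset.sum_coe_sort 𝒮 fun S => 1 * Real.exp (-2 * ∑ m ∈ S, Real.log (aFun κ c m y))).symm
  have hSpos : ∀ y, 0 < ∑ S ∈ 𝒮, bigA κ S (mon c y) ^ 2 := fun y =>
    Finset.sum_pos (fun S _ => bigA_sq_pos hκ c S y) hne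
  have hL := jet_log_sum_exp (C := fun _ : 𝒮 => 1) (p := fun S : 𝒮 => cellWeight κ 𝒮 c x S) hb
    (by have := (hSpos x).ne'; rw [hsum] at this; simpa using this)
    (fun S => by rw [cellWeight, hsum, hexp]; simp)
  have hL' := ((jet_const (Real.log (κ ^ 2))).add hL).congr
    (g := fun s : ℝ => Real.log (hGen κ 𝒮 c (x + s • a))) <| Eventually.of_forall fun s => by
      simp only
      rw [hGen, Real.log_mul (by positivity) (hSpos _).ne', hsum]
  rw [((jet_of_contDiffAt (contDiffAt_log_hGen hκ hc hx) a).unique hL').2, zero_add]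
  have hw1 : ∑ S : 𝒮, cellWeight κ 𝒮 c x S = 1 := by
    rw [Finset.sum_coe_sort 𝒮 (cellWeight κ 𝒮 c x)]
    simp only [cellWeight, ← Finset.sum_div]
    exact div_self (hSpos x).ne'
  have hv := var_nonneg (p := fun S : 𝒮 => cellWeight κ 𝒮 c x S) hw1
    (fun S => div_nonneg (sq_nonneg _) (hSpos x).le) (fun S : 𝒮 => -2 * ∑ m ∈ (S : Finset Δ),
      fderiv ℝ (aFun κ c m) x a / aFun κ c m x)
  have h0 : x + (0 : ℝ) • a = x := by simp
  simp only [h0]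
  refine le_trans (le_of_eq ?_) (le_add_of_nonneg_right hv)
  rw [← Finset.sum_coe_sort 𝒮]
  refine Finset.sum_congr rfl fun S _ => ?_
  congr 1
  rw [Finset.mul_sum]
  exact Finset.sum_congr rfl fun m _ => by ring

lemma sum_cellWeight {κ : ℝ} (hκ : 0 < κ) {𝒮 : Finset (Finset Δ)} (hne : 𝒮.Nonempty) (c : Δ → ℂ)
    (x : Fin l → ℂ) : ∑ S ∈ 𝒮, cellWeight κ 𝒮 c x S = 1 := by
  simp only [cellWeight, ← Finset.sum_div]
  exact div_self (Finset.sum_pos (fun S _ => bigA_sq_pos hκ c S x) hne).ne'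

lemma cellWeight_nonneg (κ : ℝ) (𝒮 : Finset (Finset Δ)) (c : Δ → ℂ) (x : Fin l → ℂ)
    (S : Finset Δ) : 0 ≤ cellWeight κ 𝒮 c x S :=
  div_nonneg (sq_nonneg _) (Finset.sum_nonneg fun _ _ => sq_nonneg _)

/-- The basic lower bound for the metric. -/
lemma le_gGen {κ : ℝ} (hκ : 4 * (l + 1) ≤ κ) {𝒮 : Finset (Finset Δ)} {c : Δ → ℂ}
    (hc : ∀ S ∈ 𝒮, ∀ m ∈ S, c m ≠ 0) (hcard : ∀ S ∈ 𝒮, S.card = l + 1) {x : Fin l → ℂ}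
    (hx : x ∈ torus l) (a : Fin l → ℂ) :
    (1 / (2 * Real.pi)) * ((herm (mon c x) (dmon c x a) (dmon c x a)).re +
      ∑ S ∈ 𝒮, cellWeight κ 𝒮 c x S * ∑ m ∈ S, (fderiv ℝ (aFun κ c m) x a / aFun κ c m x) ^ 2)
      ≤ gGen κ 𝒮 c x a a := by
  have hκ0 : 0 < κ := lt_of_lt_of_le (by positivity) hκ
  have hpi := Real.pi_pos
  set N := (herm (mon c x) (dmon c x a) (dmon c x a)).re with hN
  have hN0 : 0 ≤ N := by
    have h1 := herm_dmon_re c x a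
    rw [← hN] at h1
    by_cases hz : ∃ i, mon c x i ≠ 0
    · rw [h1]
      exact add_nonneg (var_nonneg (sum_eta hz) (eta_nonneg _) _)
        (var_nonneg (sum_eta hz) (eta_nonneg _) _)
    · push Not at hz
      have : mon c x = 0 := funext hz
      rw [h1, this]
      simp [var, eta]
  have b1 := le_fderiv_fderiv_log_hGen hκ0 hc hx a
  have b2 := le_fderiv_fderiv_log_hGen hκ0 hc hx (Complex.I • a)
  set W := ∑ S ∈ 𝒮, cellWeight κ 𝒮 c x S * ∑ m ∈ S,
    (fderiv ℝ (aFun κ c m) x a / aFun κ c m x) ^ 2 with hW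
  -- The loss `2 * N` is half of what Fubini–Study provides after the factor `1 / (4π)`. The squares
  -- in the direction `i a` are non-negative and are discarded.
  have key : 2 * W - 2 * N ≤ fderiv ℝ (fderiv ℝ fun y => Real.log (hGen κ 𝒮 c y)) x a a +
      fderiv ℝ (fderiv ℝ fun y => Real.log (hGen κ 𝒮 c y)) x (Complex.I • a) (Complex.I • a) := by
    refine le_trans ?_ (add_le_add b1 b2)
    rw [← Finset.sum_add_distrib]
    have : 2 * W - 2 * N ≤ ∑ S ∈ 𝒮, cellWeight κ 𝒮 c x S * (2 * ∑ m ∈ S,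
        (fderiv ℝ (aFun κ c m) x a / aFun κ c m x) ^ 2 - 2 * N) := by
      rcases 𝒮.eq_empty_or_nonempty with rfl | hne
      · simp [hW]; linarith
      · simp only [mul_sub, Finset.sum_sub_distrib, ← Finset.sum_mul, sum_cellWeight hκ0 hne,
          mul_left_comm _ (2 : ℝ), ← Finset.mul_sum]
        linarith
    refine this.trans (Finset.sum_le_sum fun S hS => ?_)
    rw [← mul_add]
    refine mul_le_mul_of_nonneg_left ?_ (cellWeight_nonneg κ 𝒮 c x S)
    rw [← Finset.sum_add_distrib, Finset.mul_sum]
    -- The loss is shared equally among the `l + 1` vertices. Each pays `2 * (4 * N / a_m)`, which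
    -- is at most its share as `a_m ≥ κ ≥ 4 * (l + 1)`.
    have e : (2 : ℝ) * N = ∑ m ∈ S, (2 * N) / (l + 1) := by
      rw [Finset.sum_const, hcard S hS, nsmul_eq_mul]
      push_cast
      field_simp
    rw [e, ← Finset.sum_sub_distrib]
    refine Finset.sum_le_sum fun m hm => ?_
    have e2 := fderiv_fderiv_aFun_add κ (hc S hS m hm) hx a
    rw [← hN] at e2
    have hA := hκ.trans (le_aFun κ c m x)
    have e3 : (fderiv ℝ (fderiv ℝ (aFun κ c m)) x a a / aFun κ c m x) +
        (fderiv ℝ (fderiv ℝ (aFun κ c m)) x (Complex.I • a) (Complex.I • a) / aFun κ c m x) ≤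
        N / (l + 1) := by
      rw [← add_div, e2]
      calc 4 * N / aFun κ c m x ≤ 4 * N / (4 * (l + 1)) := by gcongr
        _ = N / (l + 1) := by rw [mul_div_mul_left _ _ (by norm_num)]
    have e4 := sq_nonneg (fderiv ℝ (aFun κ c m) x (Complex.I • a) / aFun κ c m x)
    rw [mul_div_assoc]
    linarith
  rw [gGen, fderiv_mon c hx, fubiniStudy_eq, ddbar, ← hN]
  calc (1 / (2 * Real.pi)) * (N + W)
      = 1 / Real.pi * N + 1 / (4 * Real.pi) * (2 * W - 2 * N) := by field_simp; ring
    _ ≤ _ := by gcongr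

/-- Definiteness comes from the Fubini–Study half of `le_gGen`, so it holds in all directions of the
torus and not only in those tangent to the hypersurface. -/
theorem gGen_pos {κ : ℝ} (hκ : 4 * (l + 1) ≤ κ) {𝒮 : Finset (Finset Δ)} {c : Δ → ℂ}
    (hc : ∀ S ∈ 𝒮, ∀ m ∈ S, c m ≠ 0) (hcard : ∀ S ∈ 𝒮, S.card = l + 1) (hsep : SepSupport c)
    (hne : ∃ m, c m ≠ 0) {x : Fin l → ℂ} (hx : x ∈ torus l) {a : Fin l → ℂ} (ha : a ≠ 0) :
    0 < gGen κ 𝒮 c x a a := by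
  refine lt_of_lt_of_le (mul_pos (by have := Real.pi_pos; positivity) ?_) (le_gGen hκ hc hcard hx a)
  refine add_pos_of_pos_of_nonneg (herm_dmon_pos hsep hne hx ha) ?_
  exact Finset.sum_nonneg fun S _ => mul_nonneg (cellWeight_nonneg κ 𝒮 c x S)
    (Finset.sum_nonneg fun m _ => sq_nonneg _)

lemma tpow_ne_zero {r : ℝ} (hr : 0 < r) (θ a : ℝ) : tpow r θ a ≠ 0 :=
  mul_ne_zero (by exact_mod_cast (Real.rpow_pos_of_pos hr a).ne') (Complex.exp_ne_zero _)

theorem isPosDefOn_gApprox (hΔ : IsIntegralPolytope Δ) (w : Δ → ℝ) {κ : ℝ} (hκ : 4 * (l + 1) ≤ κ)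
    {r : ℝ} (hr : 0 < r) (θ : ℝ) : IsPosDefOn (hyp w r θ) (section_ w r θ) (gApprox w κ r θ) := by
  intro x hx v _ hv
  obtain ⟨m, -⟩ := nonempty_of_isIntegralPolytope hΔ
  rw [gApprox_eq]
  exact gGen_pos hκ (fun _ _ _ _ => tpow_ne_zero hr θ _) (fun S hS => card_of_mem_Ztop hS)
    (sepSupport_of_ne_zero hΔ fun _ => tpow_ne_zero hr θ _) ⟨m, tpow_ne_zero hr θ _⟩ hx.1 hv

lemma ind_of_mem {S : Finset Δ} {m : Δ} (hm : m ∈ S) : ind S m = 1 := by simp [ind, hm]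

lemma ind_ne_zero {S : Finset Δ} {m : Δ} (hm : m ∈ S) : ind S m ≠ 0 := by simp [ind, hm]

theorem isPosDefOn_gZero {w : Δ → ℝ} (hw : IsSimplicialWeight w) {κ : ℝ} (hκ : 4 * (l + 1) ≤ κ)
    {S : Finset Δ} (hS : S ∈ Ztop w) : IsPosDefOn (pants S) (sectionZero S) (gZero κ S) := by
  intro x hx v _ hv
  obtain ⟨m, hm⟩ := nonempty_of_mem_Ztop hS
  rw [gZero_eq]
  refine gGen_pos hκ ?_ ?_ (sepSupport_ind hw hS) ⟨m, ind_ne_zero hm⟩ hx.1 hv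
  · intro S' hS' m' hm'
    rw [Finset.mem_singleton] at hS'
    subst hS'
    exact ind_ne_zero hm'
  · intro S' hS'
    rw [Finset.mem_singleton] at hS'
    rw [hS', card_of_mem_Ztop hS]

end Positivity

/-! ### Smooth dependence of the metrics on parameters -/

section Smoothness

variable {l : ℕ} {Δ : Finset (Fin l → ℤ)} {Q : Type*} [NormedAddCommGroup Q] [NormedSpace ℝ Q]
  {n : WithTop ℕ∞} {q₀ : Q}

lemma contDiffAt_star {f : Q → ℂ} (hf : ContDiffAt ℝ n f q₀) :
    ContDiffAt ℝ n (fun q => star (f q)) q₀ :=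
  Complex.conjCLE.contDiff.contDiffAt.comp q₀ hf

lemma contDiffAt_coord {ι : Type*} [Fintype ι] {f : Q → ι → ℂ} (hf : ContDiffAt ℝ n f q₀) (i : ι) :
    ContDiffAt ℝ n (fun q => f q i) q₀ := contDiffAt_pi.1 hf i

lemma contDiffAt_mon {c : Q → Δ → ℂ} {x : Q → Fin l → ℂ} (hc : ContDiffAt ℝ n c q₀)
    (hx : ContDiffAt ℝ n x q₀) (hx0 : x q₀ ∈ torus l) :
    ContDiffAt ℝ n (fun q => mon (c q) (x q)) q₀ :=
  contDiffAt_pi.2 fun m => (contDiffAt_coord hc m).mul ((contDiffAt_monomial _ hx0).comp q₀ hx)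

lemma contDiffAt_logDer (m : Fin l → ℤ) {x a : Q → Fin l → ℂ} (hx : ContDiffAt ℝ n x q₀)
    (ha : ContDiffAt ℝ n a q₀) (hx0 : x q₀ ∈ torus l) :
    ContDiffAt ℝ n (fun q => logDer m (x q) (a q)) q₀ :=
  ContDiffAt.sum fun i _ => contDiffAt_const.mul
    ((contDiffAt_coord ha i).mul ((contDiffAt_coord hx i).inv (hx0 i)))

lemma contDiffAt_dmon {c : Q → Δ → ℂ} {x a : Q → Fin l → ℂ} (hc : ContDiffAt ℝ n c q₀)
    (hx : ContDiffAt ℝ n x q₀) (ha : ContDiffAt ℝ n a q₀) (hx0 : x q₀ ∈ torus l) :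
    ContDiffAt ℝ n (fun q => dmon (c q) (x q) (a q)) q₀ :=
  contDiffAt_pi.2 fun m => (contDiffAt_coord (contDiffAt_mon hc hx hx0) m).mul
    (contDiffAt_logDer _ hx ha hx0)

lemma contDiffAt_herm {ι : Type*} [Fintype ι] {z a b : Q → ι → ℂ} (hz : ContDiffAt ℝ n z q₀)
    (ha : ContDiffAt ℝ n a q₀) (hb : ContDiffAt ℝ n b q₀) (h0 : ∃ i, z q₀ i ≠ 0) :
    ContDiffAt ℝ n (fun q => herm (z q) (a q) (b q)) q₀ := by
  have hne : (∑ i, z q₀ i * star (z q₀ i)) ≠ 0 := by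
    rw [sum_mul_star]
    exact_mod_cast (sum_sq_pos h0).ne'
  have hs : ∀ {f g : Q → ι → ℂ}, ContDiffAt ℝ n f q₀ → ContDiffAt ℝ n g q₀ →
      ContDiffAt ℝ n (fun q => ∑ i, f q i * star (g q i)) q₀ := fun hf hg =>
    ContDiffAt.sum fun i _ => (contDiffAt_coord hf i).mul (contDiffAt_star (contDiffAt_coord hg i))
  have hi := (hs hz hz).inv hne
  have : (fun q => herm (z q) (a q) (b q)) = fun q =>
      (∑ i, a q i * star (b q i)) * (∑ i, z q i * star (z q i))⁻¹ -
      (∑ i, a q i * star (z q i)) * (∑ i, z q i * star (b q i)) *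
        ((∑ i, z q i * star (z q i))⁻¹) ^ 2 := by
    funext q
    simp only [herm, div_eq_mul_inv, inv_pow]
  rw [this]
  exact ((hs ha hb).mul hi).sub (((hs ha hz).mul (hs hz hb)).mul (hi.pow 2))

lemma contDiffAt_fubiniStudy {ι : Type*} [Fintype ι] {z a b : Q → ι → ℂ}
    (hz : ContDiffAt ℝ n z q₀) (ha : ContDiffAt ℝ n a q₀) (hb : ContDiffAt ℝ n b q₀)
    (h0 : ∃ i, z q₀ i ≠ 0) :
    ContDiffAt ℝ n (fun q => fubiniStudy (z q) (a q) (b q)) q₀ :=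
  contDiffAt_const.mul (Complex.reCLM.contDiff.contDiffAt.comp q₀ (contDiffAt_herm hz ha hb h0))

lemma contDiffAt_ddbar {f : Q → (Fin l → ℂ) → ℝ} {x a b : Q → Fin l → ℂ}
    (hf : ContDiffAt ℝ ∞ (Function.uncurry f) (q₀, x q₀)) (hx : ContDiffAt ℝ ∞ x q₀)
    (ha : ContDiffAt ℝ ∞ a q₀) (hb : ContDiffAt ℝ ∞ b q₀) :
    ContDiffAt ℝ ∞ (fun q => ddbar (f q) (x q) (a q) (b q)) q₀ := by
  have h1 : ContDiffAt ℝ ∞ (Function.uncurry fun q y => fderiv ℝ (f q) y) (q₀, x q₀) := by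
    have h2 : ContDiffAt ℝ ∞ (Function.uncurry fun (p : Q × (Fin l → ℂ)) y => f p.1 y)
        ((q₀, x q₀), x q₀) :=
      ContDiffAt.comp (g := Function.uncurry f)
        (f := fun p : (Q × (Fin l → ℂ)) × (Fin l → ℂ) => (p.1.1, p.2)) _ hf
        ((contDiff_fst.comp contDiff_fst).prodMk contDiff_snd).contDiffAt
    exact ContDiffAt.fderiv (f := fun (p : Q × (Fin l → ℂ)) y => f p.1 y)
      (g := fun p : Q × (Fin l → ℂ) => p.2) h2 contDiffAt_snd (by simp)
  have h3 : ContDiffAt ℝ ∞ (fun q => fderiv ℝ (fderiv ℝ (f q)) (x q)) q₀ :=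
    ContDiffAt.fderiv (f := fun q y => fderiv ℝ (f q) y) h1 hx (by simp)
  have hI : ∀ {a : Q → Fin l → ℂ}, ContDiffAt ℝ ∞ a q₀ →
      ContDiffAt ℝ ∞ (fun q => Complex.I • a q) q₀ := fun ha => ha.const_smul Complex.I
  exact contDiffAt_const.mul (((h3.clm_apply ha).clm_apply hb).add
    ((h3.clm_apply (hI ha)).clm_apply (hI hb)))

/-- The metric depends smoothly on the point and on the vectors. -/
lemma contDiffAt_gGen {κ : ℝ} (hκ : 0 < κ) {𝒮 : Finset (Finset Δ)} {c : Δ → ℂ}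
    (hc : ∀ S ∈ 𝒮, ∀ m ∈ S, c m ≠ 0) (hne : ∃ m, c m ≠ 0) {x : Fin l → ℂ} (hx : x ∈ torus l)
    (a b : Fin l → ℂ) :
    ContDiffAt ℝ ∞ (fun q : (Fin l → ℂ) × (Fin l → ℂ) × (Fin l → ℂ) =>
      gGen κ 𝒮 c q.1 q.2.1 q.2.2) (x, a, b) := by
  have e1 : ContDiffAt ℝ ∞ (fun q : (Fin l → ℂ) × (Fin l → ℂ) × (Fin l → ℂ) => q.1) (x, a, b) :=
    contDiffAt_fst
  have e2 : ContDiffAt ℝ ∞ (fun q : (Fin l → ℂ) × (Fin l → ℂ) × (Fin l → ℂ) => q.2.1) (x, a, b) :=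
    contDiffAt_fst.comp _ contDiffAt_snd
  have e3 : ContDiffAt ℝ ∞ (fun q : (Fin l → ℂ) × (Fin l → ℂ) × (Fin l → ℂ) => q.2.2) (x, a, b) :=
    contDiffAt_snd.comp _ contDiffAt_snd
  obtain ⟨m, hm⟩ := hne
  have h1 := (contDiffAt_fubiniStudy
    (contDiffAt_mon (contDiffAt_const (c := c)) e1 hx) (contDiffAt_dmon (contDiffAt_const (c :=
        c)) e1 e2 hx)
    (contDiffAt_dmon (contDiffAt_const (c := c)) e1 e3 hx) (exists_mon_ne_zero hx hm)).add
    (contDiffAt_ddbar (f := fun _ y => Real.log (hGen κ 𝒮 c y))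
      ((contDiffAt_log_hGen hκ hc hx).comp
        ((x, a, b), x) contDiffAt_snd) e1 e2 e3)
  refine h1.congr_of_eventuallyEq ?_
  have : ∀ᶠ q : (Fin l → ℂ) × (Fin l → ℂ) × (Fin l → ℂ) in 𝓝 (x, a, b), q.1 ∈ torus l :=
    continuousAt_fst.eventually_mem (torus_mem_nhds hx)
  filter_upwards [this] with q hq
  simp only [gGen, fderiv_mon c hq]

end Smoothness

/-! ### Completeness of the limit metric -/

section Completeness

variable {l : ℕ} {Δ : Finset (Fin l → ℤ)}

/-- The fundamental theorem of calculus along a path turns a bound on the differential of `φ` into a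
bound by length. It serves both for `log a_m` and for the inclusion in Euclidean space. -/
lemma enorm_sub_le_length {E F : Type*} [NormedAddCommGroup E] [NormedSpace ℝ E]
    [NormedAddCommGroup F] [NormedSpace ℝ F] [CompleteSpace F] {φ : E → F} {c : ℝ → E}
    (hc : ContDiffOn ℝ 1 c (Icc 0 1)) (hφ : ∀ s ∈ Icc (0 : ℝ) 1, ContDiffAt ℝ 1 φ (c s))
    {G : ℝ → ℝ} {M : ℝ} (hM : 0 ≤ M)
    {t : ℝ} (ht : t ∈ Icc (0 : ℝ) 1)
    (hb : ∀ s ∈ Ioo 0 t, ‖fderiv ℝ φ (c s) (deriv c s)‖ ≤ M * G s) :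
    ENNReal.ofReal ‖φ (c t) - φ (c 0)‖ ≤
      ENNReal.ofReal M * ∫⁻ s in Icc (0 : ℝ) 1, ENNReal.ofReal (G s) := by
  have hsub : Icc 0 t ⊆ Icc (0 : ℝ) 1 := Icc_subset_Icc le_rfl ht.2
  let f' : ℝ → F := fun s => fderiv ℝ φ (c s) (derivWithin c (Icc 0 1) s)
  have hcw := hc.continuousOn_derivWithin (uniqueDiffOn_Icc zero_lt_one) le_rfl
  have hf'c : ContinuousOn f' (Icc 0 1) := by
    refine ContinuousOn.clm_apply (fun s hs => ?_) hcw
    have h1 : ContinuousAt (fderiv ℝ φ) (c s) :=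
      ((hφ s hs).fderiv_right (m := 0) (by norm_num)).continuousAt
    exact h1.comp_continuousWithinAt (hc.continuousOn s hs)
  have hderiv : ∀ s ∈ Ioo 0 t, HasDerivAt (fun s => φ (c s)) (f' s) s := by
    intro s hs
    have hs' : s ∈ Ioo (0 : ℝ) 1 := ⟨hs.1, hs.2.trans_le ht.2⟩
    have h1 : DifferentiableWithinAt ℝ c (Icc 0 1) s :=
      hc.differentiableOn (by norm_num) s (Ioo_subset_Icc_self hs')
    have h2 := h1.hasDerivWithinAt.hasDerivAt (Icc_mem_nhds hs'.1 hs'.2)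
    exact (((hφ s (Ioo_subset_Icc_self hs')).differentiableAt
      (by norm_num)).hasFDerivAt).comp_hasDerivAt s h2
  have hcont : ContinuousOn (fun s => φ (c s)) (Icc 0 t) := fun s hs =>
    (hφ s (hsub hs)).continuousAt.comp_continuousWithinAt
      ((hc.continuousOn s (hsub hs)).mono hsub)
  have hf_int : IntervalIntegrable f' MeasureTheory.volume 0 t :=
    (hf'c.mono (by rw [uIcc_of_le ht.1]; exact hsub)).intervalIntegrable
  have hftc := intervalIntegral.integral_eq_sub_of_hasDerivAt_of_le ht.1 hcont hderiv hf_int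
  rw [← hftc, intervalIntegral.integral_of_le ht.1, ofReal_norm,
    ← MeasureTheory.lintegral_const_mul' _ _ ENNReal.ofReal_ne_top]
  refine (MeasureTheory.enorm_integral_le_lintegral_enorm _).trans ?_
  -- The endpoints are removed: there `deriv c` need not be the one-sided derivative of a path that
  -- is only `C¹` on the closed interval.
  rw [← MeasureTheory.Measure.restrict_congr_set
    (MeasureTheory.Ioo_ae_eq_Ioc (μ := MeasureTheory.volume) (a := (0 : ℝ)) (b := t))]
  refine (MeasureTheory.setLIntegral_mono' measurableSet_Ioo fun s hs => ?_).trans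
    (MeasureTheory.lintegral_mono_set (Ioo_subset_Icc_self.trans hsub))
  have hs' : s ∈ Ioo (0 : ℝ) 1 := ⟨hs.1, hs.2.trans_le ht.2⟩
  rw [← ENNReal.ofReal_mul hM, ← ofReal_norm]
  refine ENNReal.ofReal_le_ofReal ?_
  simp only [f']
  rw [derivWithin_of_mem_nhds (Icc_mem_nhds hs'.1 hs'.2)]
  exact hb s hs

lemma exists_path_of_riemDist_lt {X : Set (Fin l → ℂ)}
    {g : (Fin l → ℂ) → (Fin l → ℂ) → (Fin l → ℂ) → ℝ} {x y : Fin l → ℂ} {ε : ENNReal}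
    (h : riemDist X g x y < ε) : ∃ c : ℝ → Fin l → ℂ, ContDiffOn ℝ 1 c (Icc 0 1) ∧
      MapsTo c (Icc 0 1) X ∧ c 0 = x ∧ c 1 = y ∧
      ∫⁻ s in Icc (0 : ℝ) 1, ENNReal.ofReal (Real.sqrt (g (c s) (deriv c s) (deriv c s))) < ε := by
  simp only [riemDist, iInf_lt_iff] at h
  obtain ⟨c, h1, h2, h3, h4, h5⟩ := h
  exact ⟨c, h1, h2, h3, h4, h5⟩

lemma gGen_smul (κ : ℝ) (𝒮 : Finset (Finset Δ)) (c : Δ → ℂ) (x v : Fin l → ℂ) (t : ℝ) :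
    gGen κ 𝒮 c x (t • v) (t • v) = t ^ 2 * gGen κ 𝒮 c x v v := by
  have h1 : fderiv ℂ (mon c) x (t • v) = (t : ℂ) • fderiv ℂ (mon c) x v := by
    rw [← map_smul]; congr 1
  have h2 : Complex.I • (t • v) = t • (Complex.I • v) := smul_comm _ _ _
  rw [gGen, gGen, h1, fubiniStudy_eq, fubiniStudy_eq, herm_smul_left, herm_smul_right, ddbar, ddbar,
    h2]
  simp only [map_smul, _root_.smul_apply, smul_eq_mul, Complex.star_def,
    Complex.conj_ofReal, Complex.re_ofReal_mul]
  ring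

/-- A compact subset of the torus. -/
def box (l : ℕ) (R : ℝ) : Set (Fin l → ℂ) := {x | ∀ i, Real.exp (-R) ≤ ‖x i‖ ∧ ‖x i‖ ≤ Real.exp R}

lemma box_subset_torus (R : ℝ) : box l R ⊆ torus l := fun _ hx i =>
  norm_pos_iff.1 ((Real.exp_pos _).trans_le (hx i).1)

lemma isClosed_box (R : ℝ) : IsClosed (box l R) := by
  have : box l R = ⋂ i, {x | Real.exp (-R) ≤ ‖x i‖ ∧ ‖x i‖ ≤ Real.exp R} := by ext; simp [box]
  rw [this]
  refine isClosed_iInter fun i => ?_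
  have hc : Continuous fun x : Fin l → ℂ => ‖x i‖ := by fun_prop
  exact (isClosed_le continuous_const hc).inter (isClosed_le hc continuous_const)

lemma isCompact_box (R : ℝ) : IsCompact (box l R) := by
  refine Metric.isCompact_of_isClosed_isBounded (isClosed_box R) ?_
  refine (Metric.isBounded_closedBall (x := (0 : Fin l → ℂ)) (r := Real.exp R)).subset fun x hx
      => ?_
  rw [mem_closedBall_zero_iff, pi_norm_le_iff_of_nonneg (Real.exp_pos R).le]
  exact fun i => (hx i).2

lemma log_norm_monomial (m : Fin l → ℤ) {x : Fin l → ℂ} (hx : x ∈ torus l) :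
    Real.log ‖monomial m x‖ = ∑ i, (m i : ℝ) * Real.log ‖x i‖ := by
  rw [monomial, norm_prod, Real.log_prod fun i _ => norm_ne_zero_iff.2 (zpow_ne_zero _ (hx i))]
  exact Finset.sum_congr rfl fun i _ => by rw [norm_zpow, Real.log_zpow]

/-- The region where the `a_m`, `m ∈ S`, are bounded, is contained in a compact subset of the
torus. -/
lemma exists_box {w : Δ → ℝ} (hw : IsSimplicialWeight w) {S : Finset Δ} (hS : S ∈ Ztop w)
    (κ C : ℝ) : ∃ R, ∀ x ∈ torus l, (∀ m ∈ S, aFun κ (ind S) m x ≤ C) → x ∈ box l R := by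
  -- `L` records the differences `⟨m - m', ρ⟩` for vertices of `S`, with `ρ = log |x|`. It is
  -- injective, hence bounded below. Up to a factor `2` these are differences of values of `a`, each
  -- of which lies between `κ` and `C`.
  let L : (Fin l → ℝ) →ₗ[ℝ] (S × S → ℝ) := LinearMap.pi fun p =>
    ∑ i, (((p.1 : Δ) : Fin l → ℤ) i - ((p.2 : Δ) : Fin l → ℤ) i : ℝ) • LinearMap.proj i
  have hL : ∀ ρ p, L ρ p = ∑ i, (((p.1 : Δ) : Fin l → ℤ) i : ℝ) * ρ i -
      ∑ i, (((p.2 : Δ) : Fin l → ℤ) i : ℝ) * ρ i := by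
    intro ρ p
    simp [L, LinearMap.sum_apply, sub_mul]
  have hker : LinearMap.ker L = ⊥ := by
    rw [LinearMap.ker_eq_bot']
    intro ρ hρ
    obtain ⟨m₀, hm₀⟩ := nonempty_of_mem_Ztop hS
    refine separating_of_mem_Ztop hw hS ρ (∑ i, ((m₀ : Fin l → ℤ) i : ℝ) * ρ i) ?_
    rintro _ ⟨m, hm, rfl⟩
    have := congrFun hρ (⟨m, hm⟩, ⟨m₀, hm₀⟩)
    rw [hL] at this
    exact sub_eq_zero.1 this
  obtain ⟨K, -, hK⟩ := L.exists_antilipschitzWith hker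
  refine ⟨K * |C - κ|, fun x hx hA => ?_⟩
  let ρ : Fin l → ℝ := fun i => Real.log ‖x i‖
  have hbound : ∀ p, |L ρ p| ≤ |C - κ| := by
    intro p
    have hη : ∀ m ∈ S, Real.log (eta (mon (ind S) x) m) =
        2 * ∑ i, ((m : Fin l → ℤ) i : ℝ) * ρ i - Real.log (∑ m, ‖mon (ind S) x m‖ ^ 2) := by
      intro m hm
      rw [eta, Real.log_div (by have := monomial_ne_zero (m : Fin l → ℤ) hx
                                simp [mon, ind_of_mem hm, this])
        (sum_sq_pos (exists_mon_ne_zero hx (ind_ne_zero hm))).ne', mon, ind_of_mem hm, one_mul,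
        Real.log_pow, log_norm_monomial _ hx]
      push_cast; rfl
    have h1 := hA p.1 p.1.2
    have h2 := hA p.2 p.2.2
    have h3 := log_eta_nonpos (mon (ind S) x) p.1
    have h4 := log_eta_nonpos (mon (ind S) x) p.2
    simp only [aFun] at h1 h2
    rw [hη _ p.1.2] at h1 h3
    rw [hη _ p.2.2] at h2 h4
    rw [hL]
    refine le_trans ?_ (le_abs_self _)
    rw [abs_le]
    have : 0 ≤ C - κ := by linarith
    constructor <;> linarith
  have hρ : ‖ρ‖ ≤ K * |C - κ| := by
    have h1 := hK.le_mul_dist ρ 0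
    rw [map_zero, dist_zero_right, dist_zero_right] at h1
    refine h1.trans ?_
    gcongr
    exact (pi_norm_le_iff_of_nonneg (abs_nonneg _)).2 hbound
  intro i
  have h1 := (norm_le_pi_norm ρ i).trans hρ
  rw [Real.norm_eq_abs, abs_le] at h1
  have hpos : 0 < ‖x i‖ := norm_pos_iff.2 (hx i)
  rw [← Real.exp_log hpos, Real.exp_le_exp, Real.exp_le_exp]
  exact h1

lemma sum_cellWeight_singleton {κ : ℝ} (hκ : 0 < κ) (S : Finset Δ) (c : Δ → ℂ) (x : Fin l → ℂ) :
    cellWeight κ {S} c x S = 1 := by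
  simpa using sum_cellWeight hκ (Finset.singleton_nonempty S) c x

/-- The functions `log a_m` are Lipschitz for the limit metric. -/
lemma abs_fderiv_log_aFun_le {κ : ℝ} (hκ : 4 * (l + 1) ≤ κ) {S : Finset Δ} (hS : S.card = l + 1)
    {m : Δ} (hm : m ∈ S) {x : Fin l → ℂ} (hx : x ∈ torus l) (v : Fin l → ℂ) :
    ‖fderiv ℝ (fun y => Real.log (aFun κ (ind S) m y)) x v‖ ≤
      Real.sqrt (2 * Real.pi) * Real.sqrt (gZero κ S x v v) := by
  have hκ0 : 0 < κ := lt_of_lt_of_le (by positivity) hκ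
  have hpi := Real.pi_pos
  have hle := le_gGen hκ (𝒮 := {S}) (c := ind S)
    (fun S' hS' m' hm' => by
      rw [Finset.mem_singleton] at hS'; subst hS'; exact ind_ne_zero hm')
    (fun S' hS' => by rw [Finset.mem_singleton] at hS'; rw [hS', hS]) hx v
  rw [← gZero_eq, Finset.sum_singleton, sum_cellWeight_singleton hκ0, one_mul] at hle
  have hA : aFun κ (ind S) m x ≠ 0 := (hκ0.trans_le (le_aFun κ _ m x)).ne'
  have hd : DifferentiableAt ℝ (aFun κ (ind S) m) x :=
    (contDiffAt_aFun κ (ind_ne_zero hm) hx (n := 1)).differentiableAt (by norm_num)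
  have hl : fderiv ℝ (fun y => Real.log (aFun κ (ind S) m y)) x v =
      fderiv ℝ (aFun κ (ind S) m) x v / aFun κ (ind S) m x := by
    rw [(hd.hasFDerivAt.log hA).fderiv]
    simp [div_eq_inv_mul]
  rw [hl, ← Real.sqrt_mul (by positivity), Real.norm_eq_abs, ← Real.sqrt_sq_eq_abs]
  refine Real.sqrt_le_sqrt ?_
  have hN : 0 ≤ (herm (mon (ind S) x) (dmon (ind S) x v) (dmon (ind S) x v)).re := by
    have hz := exists_mon_ne_zero hx (ind_ne_zero hm)
    rw [herm_dmon_re]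
    exact add_nonneg (var_nonneg (sum_eta hz) (eta_nonneg _) _)
      (var_nonneg (sum_eta hz) (eta_nonneg _) _)
  have h1 : (fderiv ℝ (aFun κ (ind S) m) x v / aFun κ (ind S) m x) ^ 2 ≤
      ∑ m ∈ S, (fderiv ℝ (aFun κ (ind S) m) x v / aFun κ (ind S) m x) ^ 2 :=
    Finset.single_le_sum (f := fun m => (fderiv ℝ (aFun κ (ind S) m) x v / aFun κ (ind S) m x) ^ 2)
      (fun _ _ => sq_nonneg _) hm
  calc _ ≤ 2 * Real.pi * ((1 / (2 * Real.pi)) *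
        ((herm (mon (ind S) x) (dmon (ind S) x v) (dmon (ind S) x v)).re +
        ∑ m ∈ S, (fderiv ℝ (aFun κ (ind S) m) x v / aFun κ (ind S) m x) ^ 2)) := by
        rw [← mul_assoc, mul_one_div_cancel (by positivity), one_mul]; linarith
    _ ≤ _ := by gcongr

/-- On compact subsets of the torus the limit metric dominates a multiple of the Euclidean one. -/
lemma exists_lower_bound {w : Δ → ℝ} (hw : IsSimplicialWeight w) {κ : ℝ} (hκ : 4 * (l + 1) ≤ κ)
    {S : Finset Δ} (hS : S ∈ Ztop w) (R : ℝ) :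
    ∃ M : ℝ, 0 < M ∧ ∀ x ∈ box l R, ∀ v, ‖v‖ ≤ M * Real.sqrt (gZero κ S x v v) := by
  have hκ0 : 0 < κ := lt_of_lt_of_le (by positivity) hκ
  obtain ⟨m₀, hm₀⟩ := nonempty_of_mem_Ztop hS
  have hc : ∀ S' ∈ ({S} : Finset (Finset Δ)), ∀ m ∈ S', ind S m ≠ 0 := fun S' hS' m' hm' => by
    rw [Finset.mem_singleton] at hS'; subst hS'; exact ind_ne_zero hm'
  have hcard : ∀ S' ∈ ({S} : Finset (Finset Δ)), S'.card = l + 1 := fun S' hS' => by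
    rw [Finset.mem_singleton] at hS'; rw [hS', card_of_mem_Ztop hS]
  let G : (Fin l → ℂ) × (Fin l → ℂ) → ℝ := fun p => gGen κ {S} (ind S) p.1 p.2 p.2
  have hG : ContinuousOn G (box l R ×ˢ Metric.sphere 0 1) := by
    rintro ⟨x, v⟩ ⟨hx, -⟩
    have h1 := (contDiffAt_gGen hκ0 hc ⟨m₀, ind_ne_zero hm₀⟩ (box_subset_torus R hx) v
        v).continuousAt
    have h2 : ContinuousAt (fun p : (Fin l → ℂ) × (Fin l → ℂ) => (p.1, p.2, p.2)) (x, v) := by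
      fun_prop
    exact (ContinuousAt.comp (f := fun p : (Fin l → ℂ) × (Fin l → ℂ) => (p.1, p.2, p.2))
      (g := fun q : (Fin l → ℂ) × (Fin l → ℂ) × (Fin l → ℂ) =>
        gGen κ {S} (ind S) q.1 q.2.1 q.2.2) h1 h2).continuousWithinAt
  have hpos : ∀ x ∈ torus l, ∀ v ≠ 0, 0 < gGen κ {S} (ind S) x v v := fun x hx v hv =>
    gGen_pos hκ hc hcard (sepSupport_ind hw hS) ⟨m₀, ind_ne_zero hm₀⟩ hx hv
  obtain ⟨μ, hμ, hmin⟩ : ∃ μ : ℝ, 0 < μ ∧ ∀ x ∈ box l R, ∀ v ∈ Metric.sphere (0 : Fin l → ℂ) 1,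
      μ ≤ gGen κ {S} (ind S) x v v := by
    rcases (box l R ×ˢ Metric.sphere (0 : Fin l → ℂ) 1).eq_empty_or_nonempty with he | hne
    · refine ⟨1, one_pos, fun x hx v hv => ?_⟩
      have : (x, v) ∈ (∅ : Set ((Fin l → ℂ) × (Fin l → ℂ))) := he ▸ ⟨hx, hv⟩
      exact absurd this (notMem_empty _)
    · obtain ⟨p, hp, hpm⟩ := ((isCompact_box R).prod (isCompact_sphere 0 1)).exists_isMinOn hne hG
      refine ⟨G p, hpos p.1 (box_subset_torus R hp.1) p.2 ?_, fun x hx v hv => hpm (a := (x, v))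
          ⟨hx, hv⟩⟩
      -- A minimizer on the unit sphere cannot be `0`. The minimum is taken over all directions of
      -- the torus; homogeneity then extends the bound to every `v`.
      intro h
      have := hp.2
      rw [h] at this
      simp at this
  refine ⟨1 / Real.sqrt μ, by positivity, fun x hx v => ?_⟩
  rcases eq_or_ne v 0 with rfl | hv
  · simp; positivity
  have hv' : 0 < ‖v‖ := norm_pos_iff.2 hv
  have h1 := hmin x hx (‖v‖⁻¹ • v) (by simp [norm_smul, hv'.ne'])
  rw [gGen_smul, inv_pow, inv_mul_eq_div, le_div_iff₀ (by positivity)] at h1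
  rw [gZero_eq, one_div, inv_mul_eq_div, le_div_iff₀ (by positivity)]
  calc ‖v‖ * Real.sqrt μ = Real.sqrt (μ * ‖v‖ ^ 2) := by
        rw [Real.sqrt_mul hμ.le, Real.sqrt_sq hv'.le, mul_comm]
    _ ≤ _ := Real.sqrt_le_sqrt h1

lemma sectionZero_eq (S : Finset Δ) : sectionZero S = fun x => ∑ m, mon (ind S) x m := by
  funext x
  simp only [sectionZero, embZero_eq_mon]

/-- The generalized pairs of pants are smooth. -/
lemma exists_fderiv_sectionZero_eq_one {w : Δ → ℝ} (hw : IsSimplicialWeight w) {S : Finset Δ}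
    (hS : S ∈ Ztop w) {x : Fin l → ℂ} (hx : x ∈ pants S) :
    ∃ v, fderiv ℂ (sectionZero S) x v = 1 := by
  classical
  by_contra! hno
  have h0 : ∀ v, fderiv ℂ (sectionZero S) x v = 0 := by
    intro v
    by_contra h
    exact hno ((fderiv ℂ (sectionZero S) x v)⁻¹ • v) (by simp [h])
  have hcell : IsCell w S := by
    simp only [Ztop, Finset.mem_filter, Finset.mem_univ, true_and] at hS
    exact hS.2
  have hS0 : ∑ m ∈ S, monomial (m : Fin l → ℤ) x = 0 := by
    have := hx.2
    simp only [sectionZero, embZero] at this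
    rwa [Finset.sum_ite_mem, Finset.univ_inter] at this
  have hSi : ∀ i, ∑ m ∈ S, monomial (m : Fin l → ℤ) x * ((m : Fin l → ℤ) i : ℂ) = 0 := by
    intro i
    -- In the direction `x_i ∂_i` each monomial is multiplied by `m_i`. So a critical zero gives `∑
    -- s_m = 0` and `∑ m_i s_m = 0`, a complex affine relation among the vertices, which `haff`
    -- excludes.
    have := h0 (Pi.single i (x i))
    rw [sectionZero_eq, fderiv_sum_mon _ hx.1] at this
    rw [← this, ← Finset.sum_filter_add_sum_filter_not Finset.univ (fun m => m ∈ S)]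
    have h1 : ∑ m with m ∉ S, dmon (ind S) x (Pi.single i (x i)) m = 0 :=
      Finset.sum_eq_zero fun m hm => by
        rw [Finset.mem_filter] at hm
        simp [dmon, mon, ind, hm.2]
    rw [h1, add_zero, Finset.filter_mem_eq_inter, Finset.univ_inter]
    refine Finset.sum_congr rfl fun m hm => ?_
    rw [dmon, mon, ind_of_mem hm, one_mul, logDer, Finset.sum_eq_single i]
    · rw [Pi.single_eq_same, div_self (hx.1 i), mul_one]
    · intro j _ hj
      rw [Pi.single_eq_of_ne hj]; simp
    · simp
  have haff := affineIndependent_iff.1 (hw.simplicial S hcell)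
  have key : ∀ f : ℂ →ₗ[ℝ] ℝ, ∀ m ∈ S, f (monomial (m : Fin l → ℤ) x) = 0 := by
    intro f m hm
    refine haff Finset.univ (fun m : S => f (monomial ((m : Δ) : Fin l → ℤ) x)) ?_ ?_ ⟨m, hm⟩
      (Finset.mem_univ _)
    · rw [Finset.sum_coe_sort S fun m => f (monomial (m : Fin l → ℤ) x), ← map_sum, hS0, map_zero]
    · funext i
      rw [Finset.sum_apply, Finset.sum_coe_sort S fun m =>
        (f (monomial (m : Fin l → ℤ) x) • realPt (m : Fin l → ℤ)) i]
      have := congrArg f (hSi i)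
      rw [map_sum, map_zero] at this
      rw [Pi.zero_apply, ← this]
      refine Finset.sum_congr rfl fun m _ => ?_
      have e : monomial (m : Fin l → ℤ) x * ((m : Fin l → ℤ) i : ℂ) =
          ((m : Fin l → ℤ) i : ℝ) • monomial (m : Fin l → ℤ) x := by
        rw [Complex.real_smul, mul_comm]; simp
      rw [e, map_smul]
      simp [realPt, mul_comm]
  obtain ⟨m, hm⟩ := nonempty_of_mem_Ztop hS
  exact monomial_ne_zero (m : Fin l → ℤ) hx.1
    (Complex.ext (key Complex.reLm m hm) (key Complex.imLm m hm))

lemma contDiffAt_sectionZero (S : Finset Δ) {x : Fin l → ℂ} (hx : x ∈ torus l) {n : WithTop ℕ∞} :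
    ContDiffAt ℝ n (sectionZero S) x := by
  rw [sectionZero_eq]
  exact ContDiffAt.sum fun m _ => contDiffAt_const.mul (contDiffAt_monomial _ hx)

/-- The topology of the Riemannian distance is not finer than the Euclidean one. -/
lemma tendsto_riemDist {w : Δ → ℝ} (hw : IsSimplicialWeight w) {κ : ℝ} (hκ : 0 < κ)
    {S : Finset Δ} (hS : S ∈ Ztop w) {x : Fin l → ℂ} (hx : x ∈ pants S) :
    Tendsto (fun y => riemDist (pants S) (gZero κ S) y x) (𝓝[pants S] x) (𝓝 0) := by
  obtain ⟨v₀, hv₀⟩ := exists_fderiv_sectionZero_eq_one hw hS hx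
  obtain ⟨m₀, hm₀⟩ := nonempty_of_mem_Ztop hS
  set σ : (Fin l → ℂ) →L[ℝ] ℂ := (fderiv ℂ (sectionZero S) x).restrictScalars ℝ with hσ
  have hσv : σ v₀ = 1 := hv₀
  have hσ' : ∀ k : ℂ, σ (k • v₀) = k := fun k => by
    rw [hσ, ContinuousLinearMap.coe_restrictScalars', map_smul, hv₀, smul_eq_mul, mul_one]
  have hsd : HasFDerivAt (sectionZero S) σ x := by
    have h1 : DifferentiableAt ℂ (sectionZero S) x := by
      rw [sectionZero_eq]
      exact (HasFDerivAt.fun_sum (u := Finset.univ) fun (m : Δ) _ =>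
        (hasFDerivAt_pi'.1 (hasFDerivAt_mon (ind S) hx.1).differentiableAt.hasFDerivAt
          m)).differentiableAt
    exact h1.hasFDerivAt.restrictScalars ℝ
  -- Since `σ v₀ = 1`, the composite `σ ∘ Φ` is the section, and `Φ` has derivative the identity at
  -- `x`. So `Φ` straightens the pair of pants to the hyperplane `σ = 0`, and segments of the
  -- hyperplane pull back to paths in the pair of pants.
  let Φ : (Fin l → ℂ) → (Fin l → ℂ) := fun y => y + (sectionZero S y - σ y) • v₀
  have hΦσ : ∀ y, σ (Φ y) = sectionZero S y := fun y => by
    simp only [Φ, map_add, hσ']; ring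
  have hΦc : ContDiffAt ℝ ∞ Φ x :=
    contDiffAt_id.add (((contDiffAt_sectionZero S hx.1).sub σ.contDiff.contDiffAt).smul
      contDiffAt_const)
  have hΦd : HasFDerivAt Φ ((ContinuousLinearEquiv.refl ℝ (Fin l → ℂ) :
      (Fin l → ℂ) ≃L[ℝ] (Fin l → ℂ)) : (Fin l → ℂ) →L[ℝ] (Fin l → ℂ)) x := by
    have h1 : HasFDerivAt (fun y => (sectionZero S y - σ y) • v₀)
        ((σ - σ).smulRight v₀) x := (hsd.sub σ.hasFDerivAt).smul_const v₀
    refine ((hasFDerivAt_id x).add h1).congr_fderiv ?_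
    ext v; simp
  set e := hΦc.toOpenPartialHomeomorph Φ hΦd (by simp) with he
  have hxe : x ∈ e.source := hΦc.mem_toOpenPartialHomeomorph_source hΦd (by simp)
  have hex : ∀ y, e y = Φ y := fun y => rfl
  have hΦt : Φ x ∈ e.target := by rw [← hex]; exact e.map_source hxe
  have hsx : e.symm (Φ x) = x := by rw [← hex]; exact e.left_inv hxe
  have hsc : ContDiffAt ℝ ∞ e.symm (Φ x) := by
    have := hΦc.to_localInverse hΦd (by simp)
    exact this
  have hsc1 : ∀ᶠ q in 𝓝 (Φ x), ContDiffAt ℝ 1 e.symm q :=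
    (hsc.of_le (by exact_mod_cast le_top) : ContDiffAt ℝ 1 e.symm (Φ x)).eventually (by simp)
  have htor : ∀ᶠ q in 𝓝 (Φ x), e.symm q ∈ torus l :=
    hsc.continuousAt.eventually_mem (by rw [hsx]; exact torus_mem_nhds hx.1)
  have htar : ∀ᶠ q in 𝓝 (Φ x), q ∈ e.target := e.open_target.mem_nhds hΦt
  have hc : ∀ S' ∈ ({S} : Finset (Finset Δ)), ∀ m ∈ S', ind S m ≠ 0 := fun S' hS' m' hm' => by
    rw [Finset.mem_singleton] at hS'; subst hS'; exact ind_ne_zero hm'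
  rw [ENNReal.tendsto_nhds_zero]
  intro ε hε
  obtain ⟨ε', hε', hε'ε⟩ : ∃ ε' : ℝ, 0 < ε' ∧ ENNReal.ofReal ε' ≤ ε := by
    rcases eq_or_ne ε ⊤ with rfl | hne
    · exact ⟨1, one_pos, le_top⟩
    · exact ⟨ε.toReal, ENNReal.toReal_pos hε.ne' hne, by rw [ENNReal.ofReal_toReal hne]⟩
  -- By continuity the speed of the pulled back segment is small once its direction is close to `0`.
  have hg : ∀ᶠ p : (Fin l → ℂ) × (Fin l → ℂ) in 𝓝 (Φ x, 0),
      Real.sqrt (gZero κ S (e.symm p.1) (fderiv ℝ e.symm p.1 p.2) (fderiv ℝ e.symm p.1 p.2)) < ε'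
          := by
    have h1 : ContinuousAt (fun p : (Fin l → ℂ) × (Fin l → ℂ) =>
        (e.symm p.1, fderiv ℝ e.symm p.1 p.2, fderiv ℝ e.symm p.1 p.2)) (Φ x, 0) := by
      have a1 : ContinuousAt (fun p : (Fin l → ℂ) × (Fin l → ℂ) => e.symm p.1) (Φ x, 0) :=
        ContinuousAt.comp (f := Prod.fst) (g := e.symm) hsc.continuousAt continuousAt_fst
      have a2 : ContinuousAt (fun p : (Fin l → ℂ) × (Fin l → ℂ) => fderiv ℝ e.symm p.1) (Φ x, 0) :=
        ContinuousAt.comp (f := Prod.fst) (g := fderiv ℝ e.symm)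
          (hsc.fderiv_right (m := 0) (by simp)).continuousAt continuousAt_fst
      have a3 := a2.clm_apply continuousAt_snd
      exact a1.prodMk (a3.prodMk a3)
    have h2 : ContinuousAt (fun q : (Fin l → ℂ) × (Fin l → ℂ) × (Fin l → ℂ) =>
        gZero κ S q.1 q.2.1 q.2.2) (e.symm (Φ x), fderiv ℝ e.symm (Φ x) 0,
          fderiv ℝ e.symm (Φ x) 0) := by
      rw [hsx, gZero_eq]
      exact (contDiffAt_gGen hκ hc ⟨m₀, ind_ne_zero hm₀⟩ hx.1 _ _).continuousAt
    have h3 := (ContinuousAt.comp (f := fun p : (Fin l → ℂ) × (Fin l → ℂ) =>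
        (e.symm p.1, fderiv ℝ e.symm p.1 p.2, fderiv ℝ e.symm p.1 p.2)) (x := (Φ x, 0)) h2 h1).sqrt
    refine h3.eventually_lt_const ?_
    have : gZero κ S (e.symm (Φ x)) 0 0 = 0 := by
      rw [gZero_eq]
      have := gGen_smul κ {S} (ind S) (e.symm (Φ x)) 0 0
      simpa using this
    simp only [Function.comp, map_zero, this, Real.sqrt_zero]
    exact hε'
  obtain ⟨δ₁, hδ₁, hg'⟩ := Metric.eventually_nhds_iff_ball.1 hg
  obtain ⟨δ₂, hδ₂, hq⟩ := Metric.eventually_nhds_iff_ball.1 (hsc1.and (htor.and htar))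
  have hnear : ∀ᶠ y in 𝓝 x, Φ y ∈ Metric.ball (Φ x) (min δ₁ δ₂) ∧ y ∈ e.source :=
    (hΦc.continuousAt.eventually_mem (Metric.ball_mem_nhds _ (lt_min hδ₁ hδ₂))).and
      (e.open_source.mem_nhds hxe)
  filter_upwards [nhdsWithin_le_nhds hnear, self_mem_nhdsWithin] with y hy hyp
  let q : ℝ → (Fin l → ℂ) := fun τ => Φ y + τ • (Φ x - Φ y)
  have hqd : ∀ τ, HasDerivAt q (Φ x - Φ y) τ := fun τ => by
    have := ((hasDerivAt_id τ).smul_const (Φ x - Φ y)).const_add (Φ y)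
    rwa [one_smul] at this
  have hqb : ∀ τ ∈ Icc (0 : ℝ) 1, q τ ∈ Metric.ball (Φ x) (min δ₁ δ₂) := by
    intro τ hτ
    have h1 := (convex_ball (Φ x) (min δ₁ δ₂)).segment_subset hy.1
      (Metric.mem_ball_self (lt_min hδ₁ hδ₂))
    rw [segment_eq_image'] at h1
    exact h1 ⟨τ, hτ, rfl⟩
  have hqb2 : ∀ τ ∈ Icc (0 : ℝ) 1, q τ ∈ Metric.ball (Φ x) δ₂ := fun τ hτ =>
    Metric.ball_subset_ball (min_le_right _ _) (hqb τ hτ)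
  have hderiv : ∀ τ ∈ Icc (0 : ℝ) 1, HasDerivAt (fun τ => e.symm (q τ))
      (fderiv ℝ e.symm (q τ) (Φ x - Φ y)) τ := fun τ hτ =>
    (((hq _ (hqb2 τ hτ)).1.differentiableAt (by norm_num)).hasFDerivAt).comp_hasDerivAt τ (hqd τ)
  have hcd : ContDiffOn ℝ 1 (fun τ => e.symm (q τ)) (Icc 0 1) := by
    intro τ hτ
    have hq' : ContDiff ℝ 1 q := contDiff_const.add (contDiff_id.smul contDiff_const)
    exact (ContDiffAt.comp (f := q) τ (hq _ (hqb2 τ hτ)).1 hq'.contDiffAt).contDiffWithinAt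
  have hmaps : MapsTo (fun τ => e.symm (q τ)) (Icc 0 1) (pants S) := by
    intro τ hτ
    have h1 := (hq _ (hqb2 τ hτ)).2
    refine ⟨h1.1, ?_⟩
    rw [← hΦσ, ← hex, e.right_inv h1.2]
    simp only [q, map_add, map_smul, map_sub, hΦσ]
    rw [hyp.2, hx.2]; simp
  have h0 : (fun τ => e.symm (q τ)) 0 = y := by
    simp only [q, zero_smul, add_zero]
    rw [← hex]; exact e.left_inv hy.2
  have h1 : (fun τ => e.symm (q τ)) 1 = x := by
    simp only [q, one_smul, add_sub_cancel]
    exact hsx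
  refine le_trans (iInf_le_of_le _ (iInf_le_of_le hcd (iInf_le_of_le hmaps
    (iInf_le_of_le h0 (iInf_le_of_le h1 le_rfl))))) (le_trans ?_ hε'ε)
  calc ∫⁻ s in Icc (0 : ℝ) 1, ENNReal.ofReal (Real.sqrt (gZero κ S (e.symm (q s))
          (deriv (fun τ => e.symm (q τ)) s) (deriv (fun τ => e.symm (q τ)) s)))
      ≤ ∫⁻ _ in Icc (0 : ℝ) 1, ENNReal.ofReal ε' := by
        refine MeasureTheory.setLIntegral_mono' measurableSet_Icc fun s hs => ?_
        refine ENNReal.ofReal_le_ofReal ?_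
        rw [(hderiv s hs).deriv]
        refine (hg' (q s, Φ x - Φ y) ?_).le
        rw [Metric.mem_ball, Prod.dist_eq, max_lt_iff]
        refine ⟨Metric.ball_subset_ball (min_le_left _ _) (hqb s hs), ?_⟩
        rw [dist_zero_right, ← dist_eq_norm, dist_comm]
        exact (Metric.mem_ball.1 hy.1).trans_le (min_le_left _ _)
    _ = ENNReal.ofReal ε' := by simp

/-- Near infinity in the pair of pants some `a_m` with `m ∈ S` is large, and `log a_m` is Lipschitz,
so infinity is at infinite distance. -/
theorem isCompleteOn_gZero {w : Δ → ℝ} (hw : IsSimplicialWeight w) {κ : ℝ} (hκ : 4 * (l + 1) ≤ κ)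
    {S : Finset Δ} (hS : S ∈ Ztop w) : IsCompleteOn (pants S) (gZero κ S) := by
  intro u hu hC
  have hκ0 : 0 < κ := lt_of_lt_of_le (by positivity) hκ
  have hcard := card_of_mem_Ztop hS
  have hApos : ∀ m y, 0 < aFun κ (ind S) m y := fun m y => hκ0.trans_le (le_aFun κ _ m y)
  obtain ⟨n₀, hn₀⟩ := hC 1 one_pos
  set D := Real.sqrt (2 * Real.pi)
  have hD : 0 ≤ D := Real.sqrt_nonneg _
  have hlog : ∀ c : ℝ → Fin l → ℂ, ContDiffOn ℝ 1 c (Icc 0 1) → MapsTo c (Icc 0 1) (pants S) →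
      ∫⁻ s in Icc (0 : ℝ) 1, ENNReal.ofReal
        (Real.sqrt (gZero κ S (c s) (deriv c s) (deriv c s))) < 1 →
      ∀ t ∈ Icc (0 : ℝ) 1, ∀ m ∈ S,
        Real.log (aFun κ (ind S) m (c t)) ≤ Real.log (aFun κ (ind S) m (c 0)) + D := by
    intro c hc hm hlt t ht m hmS
    have h1 := enorm_sub_le_length (φ := fun y => Real.log (aFun κ (ind S) m y)) hc
      (fun s hs => (contDiffAt_aFun κ (ind_ne_zero hmS) (hm hs).1).log (hApos m _).ne')
      (G := fun s => Real.sqrt (gZero κ S (c s) (deriv c s) (deriv c s))) hD ht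
      (fun s hs => abs_fderiv_log_aFun_le hκ hcard hmS
        (hm (Ioo_subset_Icc_self ⟨hs.1, hs.2.trans_le ht.2⟩)).1 _)
    have h2 := h1.trans (mul_le_of_le_one_right' hlt.le)
    rw [ENNReal.ofReal_le_ofReal_iff hD] at h2
    have := (le_abs_self _).trans h2
    linarith
  set C₀ := ∑ m ∈ S, |Real.log (aFun κ (ind S) m (u n₀))|
  have hC₀ : ∀ m ∈ S, Real.log (aFun κ (ind S) m (u n₀)) ≤ C₀ := fun m hm =>
    (le_abs_self _).trans (Finset.single_le_sum
      (f := fun m => |Real.log (aFun κ (ind S) m (u n₀))|) (fun _ _ => abs_nonneg _) hm)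
  -- One `D` is spent going from `u n₀` to `u i`, the other along the path from `u i` to `u j`; both
  -- paths have length less than `1`.
  obtain ⟨R, hR⟩ := exists_box hw hS κ (Real.exp (C₀ + D + D))
  have hn : ∀ i ≥ n₀, ∀ m ∈ S, Real.log (aFun κ (ind S) m (u i)) ≤ C₀ + D := by
    intro i hi m hm
    obtain ⟨c, h1, h2, h3, h4, h5⟩ := exists_path_of_riemDist_lt (hn₀ n₀ le_rfl i hi)
    have := hlog c h1 h2 h5 1 (right_mem_Icc.2 zero_le_one) m hm
    rw [h3, h4] at this
    linarith [hC₀ m hm]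
  have hbox : ∀ x ∈ torus l, (∀ m ∈ S, Real.log (aFun κ (ind S) m x) ≤ C₀ + D + D) →
      x ∈ box l R := fun x hx h => hR x hx fun m hm => by
    rw [← Real.exp_log (hApos m x)]
    exact Real.exp_le_exp.2 (h m hm)
  obtain ⟨M, hM, hlow⟩ := exists_lower_bound hw hκ hS R
  have hcauchy : CauchySeq u := by
    rw [Metric.cauchySeq_iff]
    intro ε hε
    obtain ⟨n₁, hn₁⟩ := hC (ENNReal.ofReal (ε / M)) (ENNReal.ofReal_pos.2 (by positivity))
    refine ⟨max n₀ n₁, fun i hi j hj => ?_⟩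
    have hi0 := le_of_max_le_left hi
    have hlt := lt_min (hn₀ i hi0 j (le_of_max_le_left hj))
      (hn₁ i (le_of_max_le_right hi) j (le_of_max_le_right hj))
    obtain ⟨c, h1, h2, h3, h4, h5⟩ := exists_path_of_riemDist_lt hlt
    have h6 := lt_min_iff.1 h5
    have h7 : ∀ t ∈ Icc (0 : ℝ) 1, c t ∈ box l R := fun t ht =>
      hbox _ (h2 ht).1 fun m hm => by
        have := hlog c h1 h2 h6.1 t ht m hm
        rw [h3] at this
        linarith [hn i hi0 m hm]
    have h8 := enorm_sub_le_length (φ := fun y : Fin l → ℂ => y) h1 (fun s _ => contDiffAt_id)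
      (G := fun s => Real.sqrt (gZero κ S (c s) (deriv c s) (deriv c s))) hM.le
      (right_mem_Icc.2 zero_le_one) (fun s hs => by
        simpa using hlow (c s) (h7 s (Ioo_subset_Icc_self hs)) (deriv c s))
    have h9 : ENNReal.ofReal M * ∫⁻ s in Icc (0 : ℝ) 1, ENNReal.ofReal
        (Real.sqrt (gZero κ S (c s) (deriv c s) (deriv c s))) < ENNReal.ofReal ε := by
      have : ENNReal.ofReal ε = ENNReal.ofReal M * ENNReal.ofReal (ε / M) := by
        rw [← ENNReal.ofReal_mul hM.le, mul_div_cancel₀ _ hM.ne']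
      rw [this]
      exact (ENNReal.mul_lt_mul_iff_right (ENNReal.ofReal_pos.2 hM).ne' ENNReal.ofReal_ne_top).2
          h6.2
    have h10 := (ENNReal.ofReal_lt_ofReal_iff hε).1 (h8.trans_lt h9)
    rw [h3, h4, ← dist_eq_norm, dist_comm] at h10
    exact h10
  obtain ⟨x, hx⟩ := cauchySeq_tendsto_of_complete hcauchy
  have hxbox : x ∈ box l R := (isClosed_box R).mem_of_tendsto hx <| by
    filter_upwards [eventually_ge_atTop n₀] with i hi
    exact hbox _ (hu i).1 fun m hm => by linarith [hn i hi m hm]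
  have hxT := box_subset_torus R hxbox
  have hxp : x ∈ pants S := by
    refine ⟨hxT, ?_⟩
    have h1 := ((contDiffAt_sectionZero S hxT (n := 0)).continuousAt.tendsto).comp hx
    refine tendsto_nhds_unique h1 ?_
    have : sectionZero S ∘ u = fun _ => 0 := funext fun i => (hu i).2
    rw [this]
    exact tendsto_const_nhds
  refine ⟨x, hxp, (tendsto_riemDist hw hκ0 hS hxp).comp ?_⟩
  exact tendsto_nhdsWithin_iff.2 ⟨hx, Eventually.of_forall hu⟩

end Completeness

/-! ### The horizontal field -/

section Horizontal

variable {l : ℕ} {Δ : Finset (Fin l → ℤ)}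

/-- The bordered system whose solutions are the horizontal lifts. -/
def bordered (y : Fin l → ℂ) (c : Δ → ℂ) : (Fin l → ℂ) × ℂ →L[ℝ] (Fin l → ℂ) × ℂ :=
  LinearMap.toContinuousLinearMap
    { toFun := fun p => (fun j => herm (mon c y) (dmon c y p.1) (dmon c y (Pi.single j 1))
        - p.2 * star (∑ m, dmon c y (Pi.single j 1) m), ∑ m, dmon c y p.1 m)
      map_add' := fun p q => by
        refine Prod.ext (funext fun j => ?_) ?_
        · simp only [Prod.fst_add, Prod.snd_add, dmon_add, herm_add_left, Pi.add_apply]; ring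
        · simp only [Prod.fst_add, Prod.snd_add, dmon_add, Pi.add_apply, Finset.sum_add_distrib]
      map_smul' := fun t p => by
        have h : t • p.1 = (t : ℂ) • p.1 := rfl
        refine Prod.ext (funext fun j => ?_) ?_
        · simp only [Prod.smul_fst, Prod.smul_snd, h, dmon_smul, herm_smul_left, Pi.smul_apply,
            Complex.real_smul, RingHom.id_apply]; ring
        · simp only [Prod.smul_fst, Prod.smul_snd, h, dmon_smul, Pi.smul_apply, smul_eq_mul,
            ← Finset.mul_sum, Complex.real_smul, RingHom.id_apply] }

lemma bordered_apply (y : Fin l → ℂ) (c : Δ → ℂ) (p : (Fin l → ℂ) × ℂ) :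
    bordered y c p = (fun j => herm (mon c y) (dmon c y p.1) (dmon c y (Pi.single j 1))
        - p.2 * star (∑ m, dmon c y (Pi.single j 1) m), ∑ m, dmon c y p.1 m) := rfl

/-- The right hand side of the bordered system. -/
def borderedRhs (y : Fin l → ℂ) (c d : Δ → ℂ) : (Fin l → ℂ) × ℂ :=
  (fun j => -herm (mon c y) (mon d y) (dmon c y (Pi.single j 1)), -∑ m, mon d y m)

/-- The velocity of the horizontal lift, when the coefficients `c` move with velocity `d`. -/
def hfield (y : Fin l → ℂ) (c d : Δ → ℂ) : Fin l → ℂ :=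
  ((bordered y c).inverse (borderedRhs y c d)).1

lemma eq_sum_single_smul (v : Fin l → ℂ) : v = ∑ j, v j • (Pi.single j 1 : Fin l → ℂ) := by
  funext i
  simp [Finset.sum_apply, Pi.single_apply]

lemma dmon_eq_sum (c : Δ → ℂ) (y v : Fin l → ℂ) :
    dmon c y v = ∑ j, v j • dmon c y (Pi.single j 1) := by
  let L : (Fin l → ℂ) →ₗ[ℂ] (Δ → ℂ) :=
    { toFun := dmon c y, map_add' := dmon_add c y, map_smul' := fun k a => dmon_smul c y a k }
  change L v = ∑ j, v j • L (Pi.single j 1)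
  conv_lhs => rw [eq_sum_single_smul v, map_sum]
  simp only [map_smul]

lemma herm_dmon_eq_sum (z a : Δ → ℂ) (c : Δ → ℂ) (y v : Fin l → ℂ) :
    herm z a (dmon c y v) = ∑ j, star (v j) * herm z a (dmon c y (Pi.single j 1)) := by
  let L : (Δ → ℂ) →+ ℂ :=
    { toFun := herm z a, map_zero' := by simp [herm], map_add' := herm_add_right z a }
  rw [dmon_eq_sum]
  change L _ = _
  rw [map_sum]
  exact Finset.sum_congr rfl fun j _ => herm_smul_right _ _ _ _

lemma sum_dmon_eq_sum (c : Δ → ℂ) (y v : Fin l → ℂ) :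
    ∑ m, dmon c y v m = ∑ j, v j * ∑ m, dmon c y (Pi.single j 1) m := by
  rw [dmon_eq_sum]
  simp only [Finset.sum_apply, Pi.smul_apply, smul_eq_mul, Finset.mul_sum]
  exact Finset.sum_comm

/-- The system for the horizontal lift is uniquely solvable at `(y, c)`. -/
def Good (y : Fin l → ℂ) (c : Δ → ℂ) : Prop :=
  y ∈ torus l ∧ (∃ m, c m ≠ 0) ∧ (bordered y c).IsInvertible

/-- For a solution `(ξ, λ)` of the homogeneous system, pairing the first rows with `ξ` and using the
last row gives zero Fubini–Study norm, so `ξ = 0`. The multiplier then dies because the differential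
of the section is not zero. In finite dimension injectivity is enough. -/
lemma Good.of_sepSupport {y : Fin l → ℂ} {c : Δ → ℂ} (hy : y ∈ torus l) (hne : ∃ m, c m ≠ 0)
    (hsep : SepSupport c) (hs : ∃ v, ∑ m, dmon c y v m ≠ 0) : Good y c := by
  refine ⟨hy, hne, ?_⟩
  have hinj : Function.Injective (bordered y c) := by
    rw [injective_iff_map_eq_zero]
    rintro ⟨ξ, lam⟩ h
    rw [bordered_apply] at h
    have h1 : ∀ j, herm (mon c y) (dmon c y ξ) (dmon c y (Pi.single j 1)) =
        lam * star (∑ m, dmon c y (Pi.single j 1) m) := fun j =>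
      sub_eq_zero.1 (congrFun (Prod.ext_iff.1 h).1 j)
    have h2 : ∑ m, dmon c y ξ m = 0 := (Prod.ext_iff.1 h).2
    have h3 : herm (mon c y) (dmon c y ξ) (dmon c y ξ) = 0 := by
      rw [herm_dmon_eq_sum]
      have : ∀ j, star (ξ j) * herm (mon c y) (dmon c y ξ) (dmon c y (Pi.single j 1)) =
          lam * star (ξ j * ∑ m, dmon c y (Pi.single j 1) m) := fun j => by
        rw [h1, star_mul']; ring
      simp only [this, ← Finset.mul_sum, ← star_sum]
      rw [← sum_dmon_eq_sum, h2]; simp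
    have h4 : ξ = 0 := by
      by_contra hξ
      have := herm_dmon_pos hsep hne hy hξ
      rw [h3] at this
      simp at this
    subst h4
    obtain ⟨v, hv⟩ := hs
    have h5 : ∃ j, ∑ m, dmon c y (Pi.single j 1) m ≠ 0 := by
      by_contra! hno
      apply hv
      rw [sum_dmon_eq_sum]
      simp only [hno, mul_zero, Finset.sum_const_zero]
    obtain ⟨j, hj⟩ := h5
    have h6 := h1 j
    have h7 : herm (mon c y) (dmon c y 0) (dmon c y (Pi.single j 1)) = 0 := by
      have := dmon_smul c y 0 0
      simp only [zero_smul] at this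
      rw [this]; simp [herm]
    rw [h7] at h6
    have h8 : lam = 0 := by
      rcases mul_eq_zero.1 h6.symm with h | h
      · exact h
      · exact absurd (star_eq_zero.1 h) hj
    rw [h8]; rfl
  let e := (LinearEquiv.ofInjectiveEndo (bordered y c).toLinearMap hinj).toContinuousLinearEquiv
  exact ⟨e, by ext p <;> rfl⟩

lemma Good.exists_fderiv_ne_zero {y : Fin l → ℂ} {c : Δ → ℂ} (h : Good y c) :
    ∃ v, ∑ m, dmon c y v m ≠ 0 := by
  obtain ⟨e, he⟩ := h.2.2
  refine ⟨(e.symm (0, 1)).1, ?_⟩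
  have h1 : bordered y c (e.symm (0, 1)) = (0, 1) := by
    rw [← he]; exact e.apply_symm_apply _
  have h2 := (Prod.ext_iff.1 h1).2
  rw [bordered_apply] at h2
  simp only at h2
  rw [h2]; exact one_ne_zero

/-- The horizontal lift is characterized by tangency to the family and orthogonality to the
fibres. -/
lemma Good.eq_hfield_iff {y : Fin l → ℂ} {c : Δ → ℂ} (h : Good y c) (d : Δ → ℂ) (ξ : Fin l → ℂ) :
    ξ = hfield y c d ↔ (∑ m, (mon d y + dmon c y ξ) m = 0 ∧
      ∀ v, ∑ m, dmon c y v m = 0 →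
        fubiniStudy (mon c y) (mon d y + dmon c y ξ) (dmon c y v) = 0) := by
  obtain ⟨e, he⟩ := h.2.2
  have hinv : (bordered y c).inverse = e.symm := by
    rw [← he]; exact ContinuousLinearMap.inverse_equiv e
  have key : ξ = hfield y c d ↔ ∃ lam, bordered y c (ξ, lam) = borderedRhs y c d := by
    rw [hfield, hinv]
    constructor
    · rintro rfl
      exact ⟨(e.symm (borderedRhs y c d)).2, by rw [← he]; exact e.apply_symm_apply _⟩
    · rintro ⟨lam, hl⟩
      rw [← he] at hl
      have hl' : e (ξ, lam) = borderedRhs y c d := hl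
      have : e.symm (borderedRhs y c d) = (ξ, lam) := by rw [← hl']; exact e.symm_apply_apply _
      exact (congrArg Prod.fst this).symm
  rw [key]
  constructor
  · rintro ⟨lam, hl⟩
    rw [bordered_apply, borderedRhs] at hl
    have h1 : ∀ j, herm (mon c y) (mon d y + dmon c y ξ) (dmon c y (Pi.single j 1)) =
        lam * star (∑ m, dmon c y (Pi.single j 1) m) := fun j => by
      have := congrFun (Prod.ext_iff.1 hl).1 j
      simp only at this
      rw [herm_add_left]
      linear_combination this
    have h2 := (Prod.ext_iff.1 hl).2
    simp only at h2
    refine ⟨by simp only [Pi.add_apply, Finset.sum_add_distrib, h2]; ring, fun v hv => ?_⟩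
    rw [fubiniStudy_eq_zero_iff, herm_dmon_eq_sum]
    have : ∀ j, star (v j) * herm (mon c y) (mon d y + dmon c y ξ) (dmon c y (Pi.single j 1)) =
        lam * star (v j * ∑ m, dmon c y (Pi.single j 1) m) := fun j => by
      rw [h1, star_mul']; ring
    simp only [this, ← Finset.mul_sum, ← star_sum]
    rw [← sum_dmon_eq_sum, hv]; simp
  · rintro ⟨h1, h2⟩
    obtain ⟨v₁, hv₁⟩ := h.exists_fderiv_ne_zero
    set a := mon d y + dmon c y ξ with ha
    -- The tangent space of the fibre is complex, so testing with `v` and `i v` upgrades the real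
    -- orthogonality to the Hermitian one.
    have h3 : ∀ v, ∑ m, dmon c y v m = 0 → herm (mon c y) a (dmon c y v) = 0 := by
      intro v hv
      have r1 := (fubiniStudy_eq_zero_iff _ _ _).1 (h2 v hv)
      have hIv : ∑ m, dmon c y (Complex.I • v) m = 0 := by
        rw [dmon_smul]
        simp only [Pi.smul_apply, smul_eq_mul, ← Finset.mul_sum, hv, mul_zero]
      have r2 := (fubiniStudy_eq_zero_iff _ _ _).1 (h2 _ hIv)
      rw [dmon_smul, herm_smul_right] at r2
      simp at r2
      exact Complex.ext r1 r2
    set v₀ := (∑ m, dmon c y v₁ m)⁻¹ • v₁ with hv₀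
    have hv₀1 : ∑ m, dmon c y v₀ m = 1 := by
      rw [hv₀, dmon_smul]
      simp only [Pi.smul_apply, smul_eq_mul, ← Finset.mul_sum]
      exact inv_mul_cancel₀ hv₁
    have h4 : ∀ v, herm (mon c y) a (dmon c y v) =
        star (∑ m, dmon c y v m) * herm (mon c y) a (dmon c y v₀) := by
      intro v
      set k := ∑ m, dmon c y v m with hk
      have hd : dmon c y v = dmon c y (v + (-k) • v₀) + k • dmon c y v₀ := by
        rw [dmon_add, dmon_smul]; simp
      have hz : ∑ m, dmon c y (v + (-k) • v₀) m = 0 := by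
        rw [dmon_add, dmon_smul]
        simp only [Pi.add_apply, Pi.smul_apply, smul_eq_mul, Finset.sum_add_distrib,
          ← Finset.mul_sum, hv₀1, ← hk]
        ring
      rw [hd, herm_add_right, h3 _ hz, zero_add, herm_smul_right]
    -- The multiplier is the value on the normalized transverse vector `v₀`: an antilinear form
    -- vanishing on the fibre direction is a multiple of the conjugate of the differential.
    refine ⟨herm (mon c y) a (dmon c y v₀), ?_⟩
    rw [bordered_apply, borderedRhs]
    refine Prod.ext (funext fun j => ?_) ?_
    · have := h4 (Pi.single j 1)
      rw [ha, herm_add_left] at this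
      rw [ha]
      linear_combination this
    · rw [ha] at h1
      simp only [Pi.add_apply, Finset.sum_add_distrib] at h1
      linear_combination h1

lemma contDiffOn_bordered {n : WithTop ℕ∞} :
    ContDiffOn ℝ n (fun p : (Fin l → ℂ) × (Δ → ℂ) => bordered p.1 p.2)
      {p | p.1 ∈ torus l ∧ ∃ m, p.2 m ≠ 0} := by
  rw [contDiffOn_clm_apply]
  rintro ⟨ξ, lam⟩ p ⟨hp, m, hm⟩
  refine ContDiffAt.contDiffWithinAt ?_
  have e1 : ContDiffAt ℝ n (fun p : (Fin l → ℂ) × (Δ → ℂ) => p.1) p := contDiffAt_fst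
  have e2 : ContDiffAt ℝ n (fun p : (Fin l → ℂ) × (Δ → ℂ) => p.2) p := contDiffAt_snd
  have hd : ∀ a : Fin l → ℂ, ContDiffAt ℝ n (fun p : (Fin l → ℂ) × (Δ → ℂ) => dmon p.2 p.1 a) p :=
    fun a => contDiffAt_dmon e2 e1 contDiffAt_const hp
  have hs : ∀ a : Fin l → ℂ, ContDiffAt ℝ n
      (fun p : (Fin l → ℂ) × (Δ → ℂ) => ∑ m, dmon p.2 p.1 a m) p :=
    fun a => ContDiffAt.sum fun m _ => contDiffAt_coord (hd a) m
  simp only [bordered_apply]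
  refine ContDiffAt.prodMk (contDiffAt_pi.2 fun j => ?_) (hs ξ)
  exact (contDiffAt_herm (contDiffAt_mon e2 e1 hp) (hd ξ) (hd _) (exists_mon_ne_zero hp hm)).sub
    (contDiffAt_const.mul (contDiffAt_star (hs _)))

lemma isOpen_regular : IsOpen {p : (Fin l → ℂ) × (Δ → ℂ) | p.1 ∈ torus l ∧ ∃ m, p.2 m ≠ 0} := by
  have h1 : IsOpen {p : (Fin l → ℂ) × (Δ → ℂ) | p.1 ∈ torus l} :=
    isOpen_torus.preimage continuous_fst
  have h2 : IsOpen {p : (Fin l → ℂ) × (Δ → ℂ) | ∃ m, p.2 m ≠ 0} := by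
    have : {p : (Fin l → ℂ) × (Δ → ℂ) | ∃ m, p.2 m ≠ 0} = ⋃ m, {p | p.2 m ≠ 0} := by
      ext; simp
    rw [this]
    exact isOpen_iUnion fun m => isOpen_ne_fun
      ((continuous_apply m).comp continuous_snd) continuous_const
  exact h1.inter h2

lemma Good.contDiffAt_bordered {n : WithTop ℕ∞} {y : Fin l → ℂ} {c : Δ → ℂ} (h : Good y c) :
    ContDiffAt ℝ n (fun p : (Fin l → ℂ) × (Δ → ℂ) => bordered p.1 p.2) (y, c) :=
  contDiffOn_bordered.contDiffAt (isOpen_regular.mem_nhds ⟨h.1, h.2.1⟩)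

lemma Good.eventually {y : Fin l → ℂ} {c : Δ → ℂ} (h : Good y c) :
    ∀ᶠ p in 𝓝 (y, c), Good p.1 p.2 := by
  obtain ⟨e, he⟩ := h.2.2
  have h1 : ∀ᶠ p : (Fin l → ℂ) × (Δ → ℂ) in 𝓝 (y, c), (bordered p.1 p.2).IsInvertible := by
    refine (h.contDiffAt_bordered (n := 0)).continuousAt.eventually ?_
    simp only
    rw [← he]
    exact ContinuousLinearEquiv.nhds e
  filter_upwards [h1, isOpen_regular.mem_nhds (show (y, c) ∈ _ from ⟨h.1, h.2.1⟩)] with p hp hp'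
  exact ⟨hp'.1, hp'.2, hp⟩

lemma Good.contDiffAt_hfield {n : WithTop ℕ∞} {y : Fin l → ℂ} {c : Δ → ℂ} (h : Good y c)
    (d : Δ → ℂ) : ContDiffAt ℝ n
      (fun p : (Fin l → ℂ) × (Δ → ℂ) × (Δ → ℂ) => hfield p.1 p.2.1 p.2.2) (y, c, d) := by
  have e1 : ContDiffAt ℝ n (fun p : (Fin l → ℂ) × (Δ → ℂ) × (Δ → ℂ) => p.1) (y, c, d) :=
    contDiffAt_fst
  have e2 : ContDiffAt ℝ n (fun p : (Fin l → ℂ) × (Δ → ℂ) × (Δ → ℂ) => p.2.1) (y, c, d) :=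
    contDiffAt_fst.comp _ contDiffAt_snd
  have e3 : ContDiffAt ℝ n (fun p : (Fin l → ℂ) × (Δ → ℂ) × (Δ → ℂ) => p.2.2) (y, c, d) :=
    contDiffAt_snd.comp _ contDiffAt_snd
  have hb : ContDiffAt ℝ n (fun p : (Fin l → ℂ) × (Δ → ℂ) × (Δ → ℂ) => bordered p.1 p.2.1)
      (y, c, d) :=
    ContDiffAt.comp (g := fun p : (Fin l → ℂ) × (Δ → ℂ) => bordered p.1 p.2)
      (f := fun p : (Fin l → ℂ) × (Δ → ℂ) × (Δ → ℂ) => (p.1, p.2.1)) (y, c, d)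
      h.contDiffAt_bordered (e1.prodMk e2)
  have hi : ContDiffAt ℝ n
      (fun p : (Fin l → ℂ) × (Δ → ℂ) × (Δ → ℂ) => (bordered p.1 p.2.1).inverse) (y, c, d) :=
    ContDiffAt.comp (g := ContinuousLinearMap.inverse)
      (f := fun p : (Fin l → ℂ) × (Δ → ℂ) × (Δ → ℂ) => bordered p.1 p.2.1) (y, c, d)
      h.2.2.contDiffAt_map_inverse hb
  obtain ⟨m, hm⟩ := h.2.1
  have hr : ContDiffAt ℝ n
      (fun p : (Fin l → ℂ) × (Δ → ℂ) × (Δ → ℂ) => borderedRhs p.1 p.2.1 p.2.2) (y, c, d) := by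
    refine ContDiffAt.prodMk (contDiffAt_pi.2 fun j => ?_) ?_
    · exact (contDiffAt_herm (contDiffAt_mon e2 e1 h.1) (contDiffAt_mon e3 e1 h.1)
        (contDiffAt_dmon e2 e1 contDiffAt_const h.1) (exists_mon_ne_zero h.1 hm)).neg
    · exact (ContDiffAt.sum fun m _ => contDiffAt_coord (contDiffAt_mon e3 e1 h.1) m).neg
  exact contDiffAt_fst.comp _ (hi.clm_apply hr)

/-- Homogeneity in `d` makes the flow equation invariant under changes of the time variable, and
makes the field vanish when the coefficients do not move. -/
lemma hfield_smul (y : Fin l → ℂ) (c d : Δ → ℂ) (t : ℝ) :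
    hfield y c (t • d) = t • hfield y c d := by
  have h1 : mon (t • d) y = (t : ℂ) • mon d y := by
    funext m; simp [mon, mul_assoc]
  have : borderedRhs y c (t • d) = t • borderedRhs y c d := by
    refine Prod.ext (funext fun j => ?_) ?_
    · simp only [borderedRhs, h1, herm_smul_left, Prod.smul_mk, Pi.smul_apply, Complex.real_smul]
      ring
    · simp only [borderedRhs, h1, Pi.smul_apply, smul_eq_mul, ← Finset.mul_sum, Prod.smul_mk,
        Complex.real_smul]
      ring
  rw [hfield, this, map_smul]; rfl

lemma hfield_zero (y : Fin l → ℂ) (c : Δ → ℂ) : hfield y c 0 = 0 := by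
  simpa using hfield_smul y c 0 0

lemma good_ind {w : Δ → ℝ} (hw : IsSimplicialWeight w) {S : Finset Δ} (hS : S ∈ Ztop w)
    {x : Fin l → ℂ} (hx : x ∈ pants S) : Good x (ind S) := by
  obtain ⟨m, hm⟩ := nonempty_of_mem_Ztop hS
  obtain ⟨v, hv⟩ := exists_fderiv_sectionZero_eq_one hw hS hx
  refine Good.of_sepSupport hx.1 ⟨m, ind_ne_zero hm⟩ (sepSupport_ind hw hS) ⟨v, ?_⟩
  rw [sectionZero_eq, fderiv_sum_mon _ hx.1] at hv
  rw [hv]; exact one_ne_zero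

end Horizontal

/-! ### The toric gauge -/

section Gauge

variable {l : ℕ} {Δ : Finset (Fin l → ℤ)}

lemma tpow_zero (r θ : ℝ) : tpow r θ 0 = 1 := by simp [tpow]

lemma tpow_add {r : ℝ} (hr : 0 < r) (θ a b : ℝ) :
    tpow r θ (a + b) = tpow r θ a * tpow r θ b := by
  simp only [tpow, Real.rpow_add hr, mul_add, Complex.ofReal_mul, Complex.ofReal_add,
      Complex.exp_add]
  ring

lemma tpow_neg_mul {r : ℝ} (hr : 0 < r) (θ a : ℝ) : tpow r θ (-a) * tpow r θ a = 1 := by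
  rw [← tpow_add hr, neg_add_cancel, tpow_zero]

lemma norm_tpow {r : ℝ} (hr : 0 ≤ r) (θ a : ℝ) : ‖tpow r θ a‖ = r ^ a := by
  rw [tpow, norm_mul, mul_comm Complex.I, Complex.norm_exp_ofReal_mul_I, mul_one, Complex.norm_real,
    Real.norm_of_nonneg (Real.rpow_nonneg hr a)]

lemma tpow_zpow {r : ℝ} (hr : 0 < r) (θ a : ℝ) (n : ℤ) : tpow r θ a ^ n = tpow r θ (n * a) := by
  rw [tpow, tpow, mul_zpow, ← Complex.exp_int_mul, mul_comm (n : ℝ) a, Real.rpow_mul hr.le,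
    Real.rpow_intCast]
  push_cast
  ring_nf

lemma tpow_sum {r : ℝ} (hr : 0 < r) (θ : ℝ) {ι : Type*} (T : Finset ι) (f : ι → ℝ) :
    tpow r θ (∑ i ∈ T, f i) = ∏ i ∈ T, tpow r θ (f i) := by
  classical
  induction T using Finset.induction_on with
  | empty => simp [tpow_zero]
  | insert i T hi ih => rw [Finset.sum_insert hi, Finset.prod_insert hi, tpow_add hr, ih]

lemma hasDerivAt_tpow {r : ℝ} (hr : 0 < r) (θ a : ℝ) :
    HasDerivAt (fun r => tpow r θ a) (((a / r : ℝ) : ℂ) * tpow r θ a) r := by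
  have h1 := ((Real.hasDerivAt_rpow_const (p := a) (Or.inl hr.ne')).ofReal_comp).mul_const
    (Complex.exp (Complex.I * (θ * a : ℝ)))
  refine h1.congr_deriv ?_
  rw [Real.rpow_sub_one hr.ne', tpow]
  push_cast
  ring

/-- Translation of the torus by `t^u`. -/
def gauge (u : Fin l → ℝ) (r θ : ℝ) (x : Fin l → ℂ) : Fin l → ℂ := fun i => tpow r θ (u i) * x i

lemma gauge_mem_torus (u : Fin l → ℝ) {r : ℝ} (hr : 0 < r) (θ : ℝ) {x : Fin l → ℂ} :
    gauge u r θ x ∈ torus l ↔ x ∈ torus l :=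
  forall_congr' fun i => by simp [gauge, tpow_ne_zero hr]

lemma gauge_gauge_neg (u : Fin l → ℝ) {r : ℝ} (hr : 0 < r) (θ : ℝ) (x : Fin l → ℂ) :
    gauge u r θ (gauge (-u) r θ x) = x := by
  funext i
  simp only [gauge, Pi.neg_apply]
  rw [← mul_assoc, mul_comm (tpow r θ (u i)), tpow_neg_mul hr, one_mul]

lemma gauge_neg_gauge (u : Fin l → ℝ) {r : ℝ} (hr : 0 < r) (θ : ℝ) (x : Fin l → ℂ) :
    gauge (-u) r θ (gauge u r θ x) = x := by
  funext i
  simp only [gauge, Pi.neg_apply]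
  rw [← mul_assoc, tpow_neg_mul hr, one_mul]

lemma logDer_gauge (m : Fin l → ℤ) (u : Fin l → ℝ) {r : ℝ} (hr : 0 < r) (θ : ℝ)
    (x v : Fin l → ℂ) : logDer m (gauge u r θ x) (gauge u r θ v) = logDer m x v := by
  simp only [logDer, gauge]
  exact Finset.sum_congr rfl fun i _ => by rw [mul_div_mul_left _ _ (tpow_ne_zero hr θ _)]

/-- The coefficients `t^{ν_m}`. -/
def coef (ν : Δ → ℝ) (r θ : ℝ) : Δ → ℂ := fun m => tpow r θ (ν m)

/-- The derivative of `coef` in `r`. -/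
def coefDeriv (ν : Δ → ℝ) (r θ : ℝ) : Δ → ℂ := fun m => ((ν m / r : ℝ) : ℂ) * tpow r θ (ν m)

/-- The excess of `w` over the affine function `⟨u, m⟩ + k`. -/
def excess (w : Δ → ℝ) (u : Fin l → ℝ) (k : ℝ) : Δ → ℝ := fun m => w m - affineFn u k m

/-- The linear part of the affine function is absorbed by the translation of the torus, and its
constant by a common factor that is invisible in projective space. -/
lemma emb_eq_gauge (w : Δ → ℝ) (u : Fin l → ℝ) (k : ℝ) {r : ℝ} (hr : 0 < r) (θ : ℝ)
    (x : Fin l → ℂ) :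
    emb w r θ x = tpow r θ k • mon (coef (excess w u k) r θ) (gauge u r θ x) := by
  funext m
  have h1 : w m = (excess w u k m + ∑ i, ((m : Fin l → ℤ) i : ℝ) * u i) + k := by
    simp only [excess, affineFn, mul_comm (u _)]; ring
  have h2 : monomial (m : Fin l → ℤ) (gauge u r θ x) =
      tpow r θ (∑ i, ((m : Fin l → ℤ) i : ℝ) * u i) * monomial m x := by
    rw [tpow_sum hr]
    simp only [monomial, gauge, mul_zpow, Finset.prod_mul_distrib, tpow_zpow hr]
  simp only [emb, Pi.smul_apply, smul_eq_mul, mon, coef]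
  rw [h2, h1, tpow_add hr, tpow_add hr]
  ring

lemma fderiv_emb_gauge (w : Δ → ℝ) (u : Fin l → ℝ) (k : ℝ) {r : ℝ} (hr : 0 < r) (θ : ℝ)
    {x : Fin l → ℂ} (hx : x ∈ torus l) (v : Fin l → ℂ) :
    fderiv ℂ (emb w r θ) x v =
      tpow r θ k • dmon (coef (excess w u k) r θ) (gauge u r θ x) (gauge u r θ v) := by
  rw [emb_eq_mon, fderiv_mon _ hx]
  funext m
  have := congrFun (emb_eq_gauge w u k hr θ x) m
  rw [emb_eq_mon] at this
  simp only [dmon, Pi.smul_apply, smul_eq_mul] at this ⊢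
  rw [this, logDer_gauge _ _ hr]
  ring

lemma section_eq_gauge (w : Δ → ℝ) (u : Fin l → ℝ) (k : ℝ) {r : ℝ} (hr : 0 < r) (θ : ℝ)
    (x : Fin l → ℂ) :
    section_ w r θ x = tpow r θ k * ∑ m, mon (coef (excess w u k) r θ) (gauge u r θ x) m := by
  simp only [section_, emb_eq_gauge w u k hr, Pi.smul_apply, smul_eq_mul, Finset.mul_sum]

lemma fderiv_section_gauge (w : Δ → ℝ) (u : Fin l → ℝ) (k : ℝ) {r : ℝ} (hr : 0 < r) (θ : ℝ)
    {x : Fin l → ℂ} (hx : x ∈ torus l) (v : Fin l → ℂ) :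
    fderiv ℂ (section_ w r θ) x v =
      tpow r θ k * ∑ m, dmon (coef (excess w u k) r θ) (gauge u r θ x) (gauge u r θ v) m := by
  have h1 : fderiv ℂ (section_ w r θ) x v = ∑ m, fderiv ℂ (emb w r θ) x v m := by
    rw [emb_eq_mon, fderiv_mon _ hx]
    exact fderiv_sum_mon _ hx v
  rw [h1, fderiv_emb_gauge w u k hr θ hx]
  simp only [Pi.smul_apply, smul_eq_mul, Finset.mul_sum]

lemma hasDerivAt_mon_coef (ν : Δ → ℝ) {r : ℝ} (hr : 0 < r) (θ : ℝ) {y : ℝ → Fin l → ℂ}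
    {y' : Fin l → ℂ} (hy : HasDerivAt y y' r) (hyT : y r ∈ torus l) :
    HasDerivAt (fun r => mon (coef ν r θ) (y r))
      (mon (coefDeriv ν r θ) (y r) + dmon (coef ν r θ) (y r) y') r := by
  rw [hasDerivAt_pi]
  intro m
  have h1 : HasDerivAt (fun r => monomial (m : Fin l → ℤ) (y r))
      (monomial (m : Fin l → ℤ) (y r) * logDer m (y r) y') r := by
    have := ((hasFDerivAt_monomial (m : Fin l → ℤ) hyT).differentiableAt.hasFDerivAt
      |>.restrictScalars ℝ).comp_hasDerivAt r hy
    refine this.congr_deriv ?_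
    rw [ContinuousLinearMap.coe_restrictScalars', fderiv_monomial _ hyT]
  refine ((hasDerivAt_tpow hr θ (ν m)).mul h1).congr_deriv ?_
  simp only [Pi.add_apply, mon, dmon, coef, coefDeriv]
  ring

/-- The term `k' • z` is what differentiating the common factor `t^k` contributes; it is radial and
does not count. -/
lemma fubiniStudy_gauge {ι : Type*} [Fintype ι] {z : ι → ℂ} (hz : ∃ i, z i ≠ 0) {k : ℂ}
    (hk : k ≠ 0) (k' : ℂ) (a b : ι → ℂ) :
    fubiniStudy (k • z) (k' • z + k • a) (k • b) = fubiniStudy z a b := by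
  have h : k' • z + k • a = k • ((k' / k) • z + a) := by
    rw [smul_add, smul_smul, mul_div_cancel₀ _ hk]
  rw [h, fubiniStudy_eq, fubiniStudy_eq, herm_smul_smul hk, herm_add_left, herm_smul_left,
    herm_self_left hz, mul_zero, zero_add]

/-- The flow line conditions in the toric gauge. -/
structure IsGaugeFlow (ν : Δ → ℝ) (θ ρ : ℝ) (y : ℝ → Fin l → ℂ) : Prop where
  mem : ∀ r ∈ Ioo 0 ρ, y r ∈ torus l
  zero : ∀ r ∈ Ioo 0 ρ, ∑ m, mon (coef ν r θ) (y r) m = 0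
  diff : ∀ r ∈ Ioo 0 ρ, DifferentiableAt ℝ y r
  horizontal : ∀ r ∈ Ioo 0 ρ, ∀ v, ∑ m, dmon (coef ν r θ) (y r) v m = 0 →
    fubiniStudy (mon (coef ν r θ) (y r))
      (mon (coefDeriv ν r θ) (y r) + dmon (coef ν r θ) (y r) (deriv y r))
      (dmon (coef ν r θ) (y r) v) = 0

lemma differentiableAt_gauge (u : Fin l → ℝ) {r : ℝ} (hr : 0 < r) (θ : ℝ) {γ : ℝ → Fin l → ℂ}
    (hγ : DifferentiableAt ℝ γ r) : DifferentiableAt ℝ (fun r => gauge u r θ (γ r)) r :=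
  differentiableAt_pi.2 fun i =>
    (hasDerivAt_tpow hr θ (u i)).differentiableAt.mul (differentiableAt_pi.1 hγ i)

lemma horizontal_gauge_iff {w : Δ → ℝ} (u : Fin l → ℝ) (k : ℝ) (m₀ : Δ) {r : ℝ} (hr : 0 < r)
    (θ : ℝ) {γ : ℝ → Fin l → ℂ} (hγ : DifferentiableAt ℝ γ r) (hT : γ r ∈ torus l)
    (v : Fin l → ℂ) :
    fubiniStudy (emb w r θ (γ r)) (deriv (fun r' => emb w r' θ (γ r')) r)
      (fderiv ℂ (emb w r θ) (γ r) v) =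
    fubiniStudy (mon (coef (excess w u k) r θ) (gauge u r θ (γ r)))
      (mon (coefDeriv (excess w u k) r θ) (gauge u r θ (γ r)) +
        dmon (coef (excess w u k) r θ) (gauge u r θ (γ r))
          (deriv (fun r => gauge u r θ (γ r)) r))
      (dmon (coef (excess w u k) r θ) (gauge u r θ (γ r)) (gauge u r θ v)) := by
  have hT' := (gauge_mem_torus u hr θ).2 hT
  have hd := hasDerivAt_mon_coef (excess w u k) hr θ
    (differentiableAt_gauge u hr θ hγ).hasDerivAt hT'
  have hd2 := (hasDerivAt_tpow hr θ k).smul hd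
  have hd3 : deriv (fun r' => emb w r' θ (γ r')) r = _ := (hd2.congr_of_eventuallyEq (by
    filter_upwards [lt_mem_nhds hr] with r' hr'
    exact emb_eq_gauge w u k hr' θ (γ r'))).deriv
  rw [hd3, fderiv_emb_gauge w u k hr θ hT, emb_eq_gauge w u k hr]
  rw [add_comm (_ • (_ + _))]
  exact fubiniStudy_gauge (exists_mon_ne_zero hT' (m := m₀) (tpow_ne_zero hr θ _))
    (tpow_ne_zero hr θ k) _ _ _

lemma Supports.unique {w : Δ → ℝ} {S : Finset Δ} (hne : S.Nonempty)
    (hsep : Separating ((fun m : Δ => (m : Fin l → ℤ)) '' (S : Set Δ)))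
    {u u' : Fin l → ℝ} {k k' : ℝ} (h : Supports w S u k) (h' : Supports w S u' k') :
    u = u' ∧ k = k' := by
  have h1 : ∀ m ∈ S, affineFn u k m = affineFn u' k' m := fun m hm =>
    ((h.2 m).1 hm).trans ((h'.2 m).1 hm).symm
  have h2 : (fun i => u i - u' i) = 0 := by
    refine hsep _ (k' - k) ?_
    rintro _ ⟨m, hm, rfl⟩
    have := h1 m hm
    simp only [affineFn] at this
    simp only [mul_sub, Finset.sum_sub_distrib, mul_comm _ (u _), mul_comm _ (u' _)]
    linarith
  have h3 : u = u' := funext fun i => sub_eq_zero.1 (congrFun h2 i)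
  subst h3
  obtain ⟨m, hm⟩ := hne
  have := h1 m hm
  simp only [affineFn] at this
  exact ⟨rfl, by linarith⟩

/-- Every flow line condition transforms under the translation by `t^u`. The supporting function is
unique since `S` is separating, so the gauge in the starting condition is the one fixed here. -/
lemma isFlowLine_iff {w : Δ → ℝ} {S : Finset Δ} (hne : S.Nonempty)
    (hsep : Separating ((fun m : Δ => (m : Fin l → ℤ)) '' (S : Set Δ)))
    {u : Fin l → ℝ} {k : ℝ} (hu : Supports w S u k) {θ ρ : ℝ} {x : Fin l → ℂ}
    {γ : ℝ → Fin l → ℂ} :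
    IsFlowLine w S θ ρ x γ ↔ (∀ r ∈ Ioo 0 ρ, DifferentiableAt ℝ γ r) ∧
      IsGaugeFlow (excess w u k) θ ρ (fun r => gauge u r θ (γ r)) ∧
      Tendsto (fun r => gauge u r θ (γ r)) (𝓝[>] 0) (𝓝 x) := by
  obtain ⟨m₀, hm₀⟩ := id hne
  constructor
  · intro h
    refine ⟨h.diff, ⟨fun r hr => (gauge_mem_torus u hr.1 θ).2 (h.mem r hr).1, fun r hr => ?_,
      fun r hr => differentiableAt_gauge u hr.1 θ (h.diff r hr), fun r hr v hv => ?_⟩, ?_⟩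
    · have := (h.mem r hr).2
      rw [section_eq_gauge w u k hr.1] at this
      exact (mul_eq_zero.1 this).resolve_left (tpow_ne_zero hr.1 θ k)
    · have h1 := horizontal_gauge_iff (w := w) u k m₀ hr.1 θ (h.diff r hr) (h.mem r hr).1
        (gauge (-u) r θ v)
      rw [gauge_gauge_neg u hr.1] at h1
      rw [← h1]
      refine h.horizontal r hr _ ?_
      rw [fderiv_section_gauge w u k hr.1 θ (h.mem r hr).1, gauge_gauge_neg u hr.1, hv, mul_zero]
    · obtain ⟨u', k', hu', ht⟩ := h.start
      obtain ⟨rfl, rfl⟩ := hu'.unique hne hsep hu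
      exact ht
  · rintro ⟨hd, h, ht⟩
    have hT : ∀ r ∈ Ioo 0 ρ, γ r ∈ torus l := fun r hr =>
      (gauge_mem_torus u hr.1 θ).1 (h.mem r hr)
    refine ⟨fun r hr => ⟨hT r hr, ?_⟩, hd, fun r hr v hv => ?_, ⟨u, k, hu, ht⟩⟩
    · rw [section_eq_gauge w u k hr.1, h.zero r hr, mul_zero]
    · rw [horizontal_gauge_iff (w := w) u k m₀ hr.1 θ (hd r hr) (hT r hr)]
      refine h.horizontal r hr _ ?_
      rw [fderiv_section_gauge w u k hr.1 θ (hT r hr)] at hv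
      exact (mul_eq_zero.1 hv).resolve_left (tpow_ne_zero hr.1 θ k)

/-- Differentiating the equation of the moving hypersurface gives the tangency condition, which
together with orthogonality determines the velocity. -/
lemma IsGaugeFlow.hasDerivAt {ν : Δ → ℝ} {θ ρ : ℝ} {y : ℝ → Fin l → ℂ}
    (h : IsGaugeFlow ν θ ρ y) {r : ℝ} (hr : r ∈ Ioo 0 ρ) (hg : Good (y r) (coef ν r θ)) :
    HasDerivAt y (hfield (y r) (coef ν r θ) (coefDeriv ν r θ)) r := by
  have hd := (h.diff r hr).hasDerivAt
  have h1 : deriv y r = hfield (y r) (coef ν r θ) (coefDeriv ν r θ) := by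
    refine (hg.eq_hfield_iff _ _).2 ⟨?_, fun v hv => h.horizontal r hr v hv⟩
    have h2 := HasDerivAt.fun_sum (u := Finset.univ) fun (m : Δ) _ =>
      hasDerivAt_pi.1 (hasDerivAt_mon_coef ν hr.1 θ hd (h.mem r hr)) m
    have h3 : HasDerivAt (fun r => ∑ m, mon (coef ν r θ) (y r) m) 0 r := by
      refine (hasDerivAt_const r (0 : ℂ)).congr_of_eventuallyEq ?_
      filter_upwards [Ioo_mem_nhds hr.1 hr.2] with r' hr'
      exact h.zero r' hr'
    exact h2.unique h3
  rwa [h1] at hd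

lemma tendsto_coef {ν : Δ → ℝ} {S : Finset Δ} (hν0 : ∀ m ∈ S, ν m = 0) (hν : ∀ m ∉ S, 0 < ν m)
    (θ : ℝ) : Tendsto (fun r => coef ν r θ) (𝓝[>] 0) (𝓝 (ind S)) := by
  rw [tendsto_pi_nhds]
  intro m
  by_cases hm : m ∈ S
  · simp only [coef, hν0 m hm, tpow_zero, ind_of_mem hm]
    exact tendsto_const_nhds
  · simp only [coef, ind, hm, if_false]
    rw [tendsto_zero_iff_norm_tendsto_zero]
    have h1 : Tendsto (fun r : ℝ => r ^ ν m) (𝓝[>] 0) (𝓝 0) := by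
      have := (Real.continuousAt_rpow_const 0 (ν m) (Or.inr (hν m hm).le)).tendsto
      rw [Real.zero_rpow (hν m hm).ne'] at this
      exact this.mono_left nhdsWithin_le_nhds
    refine h1.congr' ?_
    filter_upwards [self_mem_nhdsWithin] with r hr
    rw [norm_tpow (le_of_lt hr)]

/-- The field preserves the value of the section along a trajectory. That value tends to the value
of the limit section at `x`, which is `0`, so the trajectory lies on the hypersurfaces. -/
lemma isGaugeFlow_of_hasDerivAt {ν : Δ → ℝ} {S : Finset Δ} (hν0 : ∀ m ∈ S, ν m = 0)
    (hν : ∀ m ∉ S, 0 < ν m) {θ ρ : ℝ} {y : ℝ → Fin l → ℂ} {x : Fin l → ℂ} (hx : x ∈ pants S)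
    (hg : ∀ r ∈ Ioo 0 ρ, Good (y r) (coef ν r θ))
    (hd : ∀ r ∈ Ioo 0 ρ, HasDerivAt y (hfield (y r) (coef ν r θ) (coefDeriv ν r θ)) r)
    (ht : Tendsto y (𝓝[>] 0) (𝓝 x)) : IsGaugeFlow ν θ ρ y := by
  have hz : ∀ r ∈ Ioo 0 ρ, HasDerivAt (fun r => ∑ m, mon (coef ν r θ) (y r) m) 0 r := by
    intro r hr
    have h1 := ((hg r hr).eq_hfield_iff (coefDeriv ν r θ) _).1 rfl
    have h2 := HasDerivAt.fun_sum (u := Finset.univ) fun (m : Δ) _ =>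
      hasDerivAt_pi.1 (hasDerivAt_mon_coef ν hr.1 θ (hd r hr) (hg r hr).1) m
    rwa [h1.1] at h2
  refine ⟨fun r hr => (hg r hr).1, fun r hr => ?_, fun r hr => (hd r hr).differentiableAt,
    fun r hr v hv => ?_⟩
  · have hconst : ∀ r' ∈ Ioo 0 ρ, ∑ m, mon (coef ν r' θ) (y r') m =
        ∑ m, mon (coef ν r θ) (y r) m := by
      intro r' hr'
      exact (isOpen_Ioo.is_const_of_deriv_eq_zero isPreconnected_Ioo
        (fun s hs => (hz s hs).differentiableAt.differentiableWithinAt)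
        (fun s hs => (hz s hs).deriv) hr' hr)
    have hlim : Tendsto (fun r => ∑ m, mon (coef ν r θ) (y r) m) (𝓝[>] 0)
        (𝓝 (∑ m, mon (ind S) x m)) := by
      refine tendsto_finsetSum _ fun m _ => ?_
      have h1 := (tendsto_pi_nhds.1 (tendsto_coef hν0 hν θ)) m
      exact h1.mul (((contDiffAt_monomial (m : Fin l → ℤ) hx.1 (k :=
          0)).continuousAt.tendsto).comp ht)
    have h0 : ∑ m, mon (ind S) x m = 0 := by
      have := hx.2
      rwa [sectionZero_eq] at this
    rw [h0] at hlim
    refine tendsto_nhds_unique (hlim.congr' ?_) tendsto_const_nhds |>.symm ▸ rfl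
    filter_upwards [Ioo_mem_nhdsGT (hr.1.trans hr.2)] with r' hr'
    exact hconst r' hr'
  · have h1 := ((hg r hr).eq_hfield_iff (coefDeriv ν r θ) _).1 rfl
    rw [(hd r hr).deriv]
    exact h1.2 v hv

end Gauge

/-! ### Local solutions of the flow equation -/

section LocalSolution

/-- The composition operator was treated for globally smooth maps, whereas the horizontal field is
smooth only near the points of interest. -/
lemma exists_cutoff {V W : Type*} [NormedAddCommGroup V] [NormedSpace ℝ V] [FiniteDimensional ℝ V]
    [NormedAddCommGroup W] [NormedSpace ℝ W] {f : V → W} {v₀ : V}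
    (hf : ∀ᶠ v in 𝓝 v₀, ContDiffAt ℝ ∞ f v) :
    ∃ χ : V → ℝ, ContDiff ℝ ∞ (fun v => χ v • f v) ∧ ∀ᶠ v in 𝓝 v₀, χ v = 1 := by
  obtain ⟨R, hR, hball⟩ := Metric.eventually_nhds_iff_ball.1 hf
  let χ : ContDiffBump v₀ := ⟨R / 4, R / 2, by positivity, by linarith⟩
  refine ⟨χ, contDiff_iff_contDiffAt.2 fun v => ?_, ?_⟩
  · by_cases hv : v ∈ Metric.ball v₀ R
    · exact χ.contDiff.contDiffAt.smul (hball v hv)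
    · have h1 : v ∉ tsupport χ := by
        rw [χ.tsupport_eq]
        intro h
        refine hv (Metric.closedBall_subset_ball ?_ h)
        change R / 2 < R
        linarith
      have h2 : (fun v => χ v • f v) =ᶠ[𝓝 v] fun _ => 0 := by
        filter_upwards [(isClosed_tsupport χ).isOpen_compl.mem_nhds h1] with v' hv'
        rw [image_eq_zero_of_notMem_tsupport hv', zero_smul]
      exact contDiffAt_const.congr_of_eventuallyEq h2
  · filter_upwards [Metric.closedBall_mem_nhds v₀ χ.rIn_pos] with v hv
    exact χ.one_of_mem_closedBall hv

variable {l : ℕ} {Δ : Finset (Fin l → ℤ)}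

/-- Paths of coefficients, together with their velocities. -/
abbrev CoefPath (Δ : Finset (Fin l → ℤ)) := C(unitInterval, (Δ → ℂ) × (Δ → ℂ))

/-- `hfield` as a function of the point and the pair of parameters. -/
def hfieldPair (p : (Fin l → ℂ) × (Δ → ℂ) × (Δ → ℂ)) : Fin l → ℂ := hfield p.1 p.2.1 p.2.2

/-- The constant path of coefficients at `t = 0`. -/
def basePath (S : Finset Δ) : CoefPath Δ := constCLM (ind S, (0 : Δ → ℂ))

/-- The solutions of the flow equation that start near `x₀`, for paths of coefficients near the
constant path. -/
structure LocalSolution (S : Finset Δ) (x₀ : Fin l → ℂ) where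
  Y : (Fin l → ℂ) × CoefPath Δ → C(unitInterval, Fin l → ℂ)
  ε : ℝ
  δ : ℝ
  ε_pos : 0 < ε
  δ_pos : 0 < δ
  δ_le : δ ≤ ε
  good : ∀ y ∈ Metric.ball x₀ ε, ∀ b ∈ Metric.ball (ind S, (0 : Δ → ℂ)) ε, Good y b.1
  smooth : ∀ x ∈ Metric.ball x₀ δ, ∀ b ∈ Metric.ball (basePath S) δ, ContDiffAt ℝ ∞ Y (x, b)
  near : ∀ x ∈ Metric.ball x₀ δ, ∀ b ∈ Metric.ball (basePath S) δ,
    dist (Y (x, b)) (constCLM x₀) < ε / 2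
  fderiv_near : ∀ x ∈ Metric.ball x₀ δ, ∀ b ∈ Metric.ball (basePath S) δ,
    ‖fderiv ℝ (fun x => Y (x, b) 1) x - ContinuousLinearMap.id ℝ _‖ ≤ 1 / 2
  solves : ∀ x ∈ Metric.ball x₀ δ, ∀ b ∈ Metric.ball (basePath S) δ,
    SolvesIntegral hfieldPair x b (Y (x, b))
  unique : ∀ x ∈ Metric.ball x₀ δ, ∀ b ∈ Metric.ball (basePath S) δ,
    ∀ y ∈ Metric.ball (constCLM x₀ : C(unitInterval, Fin l → ℂ)) ε,
      SolvesIntegral hfieldPair x b y → Y (x, b) = y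

/-- Evaluation of paths at `1`. -/
def evalOne : C(unitInterval, Fin l → ℂ) →L[ℝ] (Fin l → ℂ) := ContinuousMap.evalCLM ℝ 1

/-- The cut-off field vanishes at `(ind S, 0)` because its velocity component is `0`, so
`exists_smooth_solution` applies. Solutions that stay near `x₀` do not see the cut-off. -/
theorem exists_localSolution {S : Finset Δ} {x₀ : Fin l → ℂ} (hg : Good x₀ (ind S)) :
    Nonempty (LocalSolution S x₀) := by
  have hgood : ∀ᶠ p : (Fin l → ℂ) × (Δ → ℂ) × (Δ → ℂ) in 𝓝 (x₀, ind S, 0), Good p.1 p.2.1 := by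
    have : ContinuousAt (fun p : (Fin l → ℂ) × (Δ → ℂ) × (Δ → ℂ) => (p.1, p.2.1))
        (x₀, ind S, 0) := by fun_prop
    exact this.eventually hg.eventually
  obtain ⟨χ, hχ, hχ1⟩ := exists_cutoff (f := hfieldPair (l := l) (Δ := Δ))
    (hgood.mono fun p hp => hp.contDiffAt_hfield p.2.2)
  set f : (Fin l → ℂ) × (Δ → ℂ) × (Δ → ℂ) → (Fin l → ℂ) := fun v => χ v • hfieldPair v with hf
  obtain ⟨Y, hY0, hYs, hYu⟩ := exists_smooth_solution f hχ (ind S, (0 : Δ → ℂ))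
    (fun y => by simp [hf, hfieldPair, hfield_zero]) x₀
  obtain ⟨ε₁, hε₁, h₁⟩ := Metric.eventually_nhds_iff_ball.1 (hgood.and hχ1)
  obtain ⟨ε₂, hε₂, h₂⟩ := Metric.eventually_nhds_iff_ball.1 hYu
  -- On the scale `ε` the cut-off is `1`, the system is solvable and solutions are unique. The
  -- solutions themselves stay within `ε / 2`; this gap drives the later continuation argument.
  set ε := min ε₁ ε₂ with hε
  have hε0 : 0 < ε := lt_min hε₁ hε₂
  have hYs0 := hYs.self_of_nhds
  have hnear : ∀ᶠ u in 𝓝 (x₀, basePath S), dist (Y u) (constCLM x₀) < ε / 2 := by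
    have := hYs0.continuousAt.eventually_mem
      (Metric.ball_mem_nhds (Y (x₀, constCLM (ind S, (0 : Δ → ℂ)))) (half_pos hε0))
    rw [hY0] at this
    exact this
  have hsolveq : ∀ (x : Fin l → ℂ) (b : CoefPath Δ) (y : C(unitInterval, Fin l → ℂ)),
      b ∈ Metric.ball (basePath S) ε → y ∈ Metric.ball (constCLM x₀) ε →
      (SolvesIntegral f x b y ↔ SolvesIntegral hfieldPair x b y) := by
    intro x b y hb hy
    refine forall_congr' fun σ => ?_
    have : ∀ τ : ℝ, f (IccExtend zero_le_one y τ, IccExtend zero_le_one b τ) =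
        hfieldPair (IccExtend zero_le_one y τ, IccExtend zero_le_one b τ) := by
      intro τ
      simp only [IccExtend, Function.comp, hf]
      rw [(h₁ _ ?_).2, one_smul]
      have e1 := (ContinuousMap.dist_lt_iff hε0).1 (Metric.mem_ball.1 hy)
        (projIcc 0 1 zero_le_one τ)
      have e2 := (ContinuousMap.dist_lt_iff hε0).1 (Metric.mem_ball.1 hb)
        (projIcc 0 1 zero_le_one τ)
      rw [Metric.mem_ball, Prod.dist_eq, max_lt_iff]
      exact ⟨e1.trans_le (min_le_left _ _), e2.trans_le (min_le_left _ _)⟩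
    simp only [this]
  have hfd : ∀ᶠ u in 𝓝 (x₀, basePath S),
      ‖fderiv ℝ (fun x => Y (x, u.2) 1) u.1 - ContinuousLinearMap.id ℝ _‖ < 1 / 2 := by
    have hc : ContDiffAt ℝ 0 (fun u : (Fin l → ℂ) × CoefPath Δ =>
        fderiv ℝ (fun x => Y (x, u.2) 1) u.1) (x₀, basePath S) := by
      refine ContDiffAt.fderiv (f := fun (u : (Fin l → ℂ) × CoefPath Δ) x => Y (x, u.2) 1)
        (g := fun u => u.1) (n := ∞) ?_ contDiffAt_fst (by simp)
      have h3 : ContDiffAt ℝ ∞ (fun u => evalOne (Y u)) (x₀, basePath S) :=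
        evalOne.contDiff.contDiffAt.comp _ hYs0
      exact ContDiffAt.comp (g := fun u => evalOne (Y u))
        (f := fun p : ((Fin l → ℂ) × CoefPath Δ) × (Fin l → ℂ) => (p.2, p.1.2))
        ((x₀, basePath S), x₀) h3
        (contDiffAt_snd.prodMk (contDiffAt_snd.comp _ contDiffAt_fst))
    have hc' := (hc.continuousAt.sub
      (continuousAt_const (y := ContinuousLinearMap.id ℝ (Fin l → ℂ)))).norm
    refine hc'.eventually_lt_const ?_
    -- Along the constant path of coefficients nothing moves, so the time-one map is the identity
    -- and nearby maps have derivative close to the identity.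
    have hid : (fun x => Y (x, basePath S) 1) =ᶠ[𝓝 x₀] fun x => x := by
      have hcont : ContinuousAt (fun x : Fin l → ℂ => ((x, basePath S), (constCLM x :
          C(unitInterval, Fin l → ℂ)))) x₀ :=
        (continuousAt_id.prodMk continuousAt_const).prodMk
          (constCLM (E := Fin l → ℂ)).continuous.continuousAt
      filter_upwards [hcont.eventually hYu] with x hx
      have : Y (x, basePath S) = constCLM x := by
        refine hx.1 fun σ => ?_
        have h0 : ∀ τ : ℝ, f (IccExtend zero_le_one (constCLM x : C(unitInterval, Fin l → ℂ)) τ,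
            IccExtend zero_le_one (basePath S) τ) = 0 := fun τ => by
          simp [hf, hfieldPair, IccExtend, basePath, hfield_zero]
        simp only [h0]
        simp
      rw [this]; rfl
    simp only [Pi.sub_apply]
    rw [hid.fderiv_eq, fderiv_fun_id, sub_self, norm_zero]
    norm_num
  obtain ⟨δ', hδ', h₃⟩ := Metric.eventually_nhds_iff_ball.1 (hYs.and (hnear.and hfd))
  set δ := min δ' ε
  have hmem : ∀ {x : Fin l → ℂ} {b : CoefPath Δ}, x ∈ Metric.ball x₀ δ →
      b ∈ Metric.ball (basePath S) δ → (x, b) ∈ Metric.ball (x₀, basePath S) δ' := by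
    intro x b hx hb
    rw [Metric.mem_ball, Prod.dist_eq, max_lt_iff]
    exact ⟨(Metric.mem_ball.1 hx).trans_le (min_le_left _ _),
      (Metric.mem_ball.1 hb).trans_le (min_le_left _ _)⟩
  have hiff : ∀ x ∈ Metric.ball x₀ δ, ∀ b ∈ Metric.ball (basePath S) δ,
      ∀ y ∈ Metric.ball (constCLM x₀ : C(unitInterval, Fin l → ℂ)) ε,
      (SolvesIntegral hfieldPair x b y ↔ Y (x, b) = y) := by
    intro x hx b hb y hy
    have hb' := Metric.ball_subset_ball (min_le_right δ' ε) hb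
    rw [← hsolveq x b y hb' hy]
    refine h₂ ((x, b), y) ?_
    rw [Metric.mem_ball, Prod.dist_eq, Prod.dist_eq, max_lt_iff, max_lt_iff]
    exact ⟨⟨((Metric.mem_ball.1 hx).trans_le (min_le_right _ _)).trans_le (min_le_right _ _),
      (Metric.mem_ball.1 hb').trans_le (min_le_right _ _)⟩,
      (Metric.mem_ball.1 hy).trans_le (min_le_right _ _)⟩
  exact ⟨{
    Y := Y
    ε := ε
    δ := δ
    ε_pos := hε0
    δ_pos := lt_min hδ' hε0
    δ_le := min_le_right _ _
    good := fun y hy b hb => (h₁ (y, b) (by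
      rw [Metric.mem_ball, Prod.dist_eq, max_lt_iff]
      exact ⟨(Metric.mem_ball.1 hy).trans_le (min_le_left _ _),
        (Metric.mem_ball.1 hb).trans_le (min_le_left _ _)⟩)).1
    smooth := fun x hx b hb => (h₃ _ (hmem hx hb)).1
    near := fun x hx b hb => (h₃ _ (hmem hx hb)).2.1
    fderiv_near := fun x hx b hb => ((h₃ _ (hmem hx hb)).2.2).le
    solves := fun x hx b hb => (hiff x hx b hb _ (Metric.mem_ball.2
      ((h₃ _ (hmem hx hb)).2.1.trans (half_lt_self hε0)))).2 rfl
    unique := fun x hx b hb y hy => (hiff x hx b hb y hy).1 }⟩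

end LocalSolution

/-! ### The flow lines as solutions of an integral equation -/

section Paths

variable {l : ℕ} {Δ : Finset (Fin l → ℤ)}

/-- The exponents `ν` vanish exactly on `S`, and `N` is large compared to their inverses. -/
structure Exponents (S : Finset Δ) (ν : Δ → ℝ) (N : ℕ) : Prop where
  zero : ∀ m ∈ S, ν m = 0
  pos : ∀ m ∉ S, 0 < ν m
  two_le : ∀ m ∉ S, 2 ≤ N * ν m
  N_pos : 0 < N

variable {S : Finset Δ} {ν : Δ → ℝ} {N : ℕ}

lemma Exponents.nonneg (h : Exponents S ν N) (m : Δ) : 0 ≤ ν m := by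
  by_cases hm : m ∈ S
  · rw [h.zero m hm]
  · exact (h.pos m hm).le

lemma exists_exponents {w : Δ → ℝ} {u : Fin l → ℝ} {k : ℝ} (hu : Supports w S u k) :
    ∃ N, Exponents S (excess w u k) N := by
  have hpos : ∀ m ∉ S, 0 < excess w u k m := fun m hm =>
    sub_pos.2 (lt_of_le_of_ne (hu.1 m) fun h => hm ((hu.2 m).2 h))
  have h1 : ∀ m : Δ, ∃ n : ℕ, m ∉ S → 2 ≤ n * excess w u k m := by
    intro m
    by_cases hm : m ∈ S
    · exact ⟨0, fun h => absurd hm h⟩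
    · obtain ⟨n, hn⟩ := exists_nat_ge (2 / excess w u k m)
      exact ⟨n, fun _ => (div_le_iff₀ (hpos m hm)).1 hn⟩
  choose n hn using h1
  -- The sum dominates each `n m`; the extra `1` keeps `N` positive when `S` is all of `Δ`.
  refine ⟨∑ m, n m + 1, fun m hm => sub_eq_zero.2 ((hu.2 m).1 hm).symm, hpos, fun m hm => ?_,
    Nat.succ_pos _⟩
  refine (hn m hm).trans (mul_le_mul_of_nonneg_right ?_ (hpos m hm).le)
  exact_mod_cast (Finset.single_le_sum (f := n) (fun _ _ => Nat.zero_le _)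
    (Finset.mem_univ m)).trans (Nat.le_succ _)

/-- The path `σ ↦ t^ν`, `t = R σ^N e^{iθ}`, together with its velocity. -/
def coefPath (h : Exponents S ν N) (R θ : ℝ) : CoefPath Δ where
  toFun σ := (fun m => (((σ : ℝ) ^ (N * ν m) : ℝ) : ℂ) * tpow R θ (ν m),
    fun m => ((N * ν m * (σ : ℝ) ^ (N * ν m - 1) : ℝ) : ℂ) * tpow R θ (ν m))
  continuous_toFun := by
    refine Continuous.prodMk (continuous_pi fun m => ?_) (continuous_pi fun m => ?_)
    · have h1 : 0 ≤ N * ν m := mul_nonneg (Nat.cast_nonneg N) (h.nonneg m)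
      exact (Complex.continuous_ofReal.comp
        ((Real.continuous_rpow_const h1).comp continuous_subtype_val)).mul continuous_const
    · by_cases hm : m ∈ S
      · simp only [h.zero m hm, mul_zero, zero_mul, Complex.ofReal_zero]
        exact continuous_const
      -- This is where `N * ν m ≥ 2` matters: the velocity has no singularity at `σ = 0`.
      · have h1 : 0 ≤ N * ν m - 1 := by linarith [h.two_le m hm]
        exact (Complex.continuous_ofReal.comp (continuous_const.mul
          ((Real.continuous_rpow_const h1).comp continuous_subtype_val))).mul continuous_const

lemma coefPath_fst (h : Exponents S ν N) (R θ : ℝ) (σ : unitInterval) :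
    (coefPath h R θ σ).1 = fun m => (((σ : ℝ) ^ (N * ν m) : ℝ) : ℂ) * tpow R θ (ν m) := rfl

lemma coefPath_snd (h : Exponents S ν N) (R θ : ℝ) (σ : unitInterval) :
    (coefPath h R θ σ).2 =
      fun m => ((N * ν m * (σ : ℝ) ^ (N * ν m - 1) : ℝ) : ℂ) * tpow R θ (ν m) := rfl

lemma coefPath_one (h : Exponents S ν N) (R θ : ℝ) : (coefPath h R θ 1).1 = coef ν R θ := by
  rw [coefPath_fst]
  funext m
  simp [coef]

lemma tpow_mul_pow {R : ℝ} (hR : 0 < R) {σ : ℝ} (hσ : 0 < σ) (N : ℕ) (θ a : ℝ) :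
    tpow (R * σ ^ N) θ a = ((σ ^ (N * a) : ℝ) : ℂ) * tpow R θ a := by
  rw [tpow, tpow, Real.mul_rpow hR.le (by positivity), ← Real.rpow_natCast σ N,
    ← Real.rpow_mul hσ.le]
  push_cast
  ring

lemma coefPath_fst_eq_coef (h : Exponents S ν N) {R : ℝ} (hR : 0 < R) (θ : ℝ) {σ : unitInterval}
    (hσ : 0 < (σ : ℝ)) : (coefPath h R θ σ).1 = coef ν (R * (σ : ℝ) ^ N) θ := by
  rw [coefPath_fst]
  funext m
  rw [coef, tpow_mul_pow hR hσ]

lemma coefPath_snd_eq_coefDeriv (h : Exponents S ν N) {R : ℝ} (hR : 0 < R) (θ : ℝ)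
    {σ : unitInterval} (hσ : 0 < (σ : ℝ)) :
    coefDeriv ν (R * (σ : ℝ) ^ N) θ =
      ((σ : ℝ) / (N * (R * (σ : ℝ) ^ N))) • (coefPath h R θ σ).2 := by
  rw [coefPath_snd]
  funext m
  have hN : (N : ℝ) ≠ 0 := by exact_mod_cast h.N_pos.ne'
  rw [coefDeriv, tpow_mul_pow hR hσ, Pi.smul_apply, Complex.real_smul, ← mul_assoc, ← mul_assoc,
    ← Complex.ofReal_mul, ← Complex.ofReal_mul]
  congr 2
  rw [Real.rpow_sub_one hσ.ne']
  field_simp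

/-- The path for the end point `R s^N` is the initial piece of the path for `R`, run at speed `s`.
Hence one solution on `[0, 1]` contains the flow at all earlier times. -/
lemma coefPath_scale (h : Exponents S ν N) {R : ℝ} (hR : 0 < R) (θ : ℝ) {s : unitInterval}
    (hs : 0 < (s : ℝ)) (σ : unitInterval) :
    coefPath h (R * (s : ℝ) ^ N) θ σ =
      ((coefPath h R θ (s * σ)).1, (s : ℝ) • (coefPath h R θ (s * σ)).2) := by
  have hc : ((s * σ : unitInterval) : ℝ) = s * σ := rfl
  refine Prod.ext (funext fun m => ?_) (funext fun m => ?_)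
  · simp only [coefPath_fst, tpow_mul_pow hR hs, hc,
      Real.mul_rpow hs.le σ.2.1]
    push_cast
    ring
  · simp only [coefPath_snd, tpow_mul_pow hR hs, hc,
      Real.mul_rpow hs.le σ.2.1, Pi.smul_apply, Complex.real_smul, Real.rpow_sub_one hs.ne']
    rw [← mul_assoc, ← mul_assoc, ← Complex.ofReal_mul, ← Complex.ofReal_mul]
    congr 2
    field_simp

/-- The paths of coefficients tend to the constant path, uniformly in `θ`. -/
lemma tendsto_coefPath (h : Exponents S ν N) :
    Tendsto (fun τ : ℝ × ℝ => coefPath h τ.1 τ.2) ((𝓝[>] (0 : ℝ)) ×ˢ (⊤ : Filter ℝ))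
      (𝓝 (basePath S)) := by
  classical
  rw [tendsto_iff_dist_tendsto_zero]
  -- The bound sees only the modulus of `t`, whence the uniformity in `θ`; the factor `1 + N * ν m`
  -- covers both the coefficients and their velocities.
  let B : ℝ → ℝ := fun r => ∑ m ∈ Sᶜ, (1 + N * ν m) * r ^ ν m
  have hB : Tendsto (fun τ : ℝ × ℝ => B τ.1) ((𝓝[>] (0 : ℝ)) ×ˢ (⊤ : Filter ℝ)) (𝓝 0) := by
    have h1 : Tendsto B (𝓝[>] 0) (𝓝 0) := by
      have : Tendsto B (𝓝[>] 0) (𝓝 (∑ m ∈ Sᶜ, (1 + N * ν m) * 0)) := by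
        refine tendsto_finsetSum _ fun m hm => ?_
        have hm' := h.pos m (Finset.mem_compl.1 hm)
        have h2 := (Real.continuousAt_rpow_const 0 (ν m) (Or.inr hm'.le)).tendsto
        rw [Real.zero_rpow hm'.ne'] at h2
        exact (h2.mono_left nhdsWithin_le_nhds).const_mul _
      simpa using this
    exact h1.comp tendsto_fst
  refine squeeze_zero' (Eventually.of_forall fun _ => dist_nonneg) ?_ hB
  have hpos : ∀ᶠ τ : ℝ × ℝ in (𝓝[>] (0 : ℝ)) ×ˢ (⊤ : Filter ℝ), 0 < τ.1 :=
    tendsto_fst.eventually self_mem_nhdsWithin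
  filter_upwards [hpos] with τ hτ
  have hB0 : ∀ m ∈ Sᶜ, 0 ≤ (1 + N * ν m) * τ.1 ^ ν m := fun m _ => by
    have := h.nonneg m
    positivity
  have hBm : ∀ m ∉ S, (1 + N * ν m) * τ.1 ^ ν m ≤ B τ.1 := fun m hm =>
    Finset.single_le_sum (f := fun m => (1 + N * ν m) * τ.1 ^ ν m) hB0 (Finset.mem_compl.2 hm)
  have hBnn : 0 ≤ B τ.1 := Finset.sum_nonneg hB0
  rw [ContinuousMap.dist_le hBnn]
  intro σ
  have hbase : basePath S σ = (ind S, 0) := rfl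
  rw [hbase, Prod.dist_eq, max_le_iff]
  constructor
  · refine (dist_pi_le_iff hBnn).2 fun m => ?_
    simp only [coefPath_fst]
    by_cases hm : m ∈ S
    · simp [h.zero m hm, tpow_zero, ind_of_mem hm, hBnn]
    · have h0 : ind S m = 0 := by simp [ind, hm]
      rw [h0, dist_zero_right, norm_mul, norm_tpow hτ.le, Complex.norm_real,
        Real.norm_of_nonneg (Real.rpow_nonneg σ.2.1 _)]
      refine le_trans ?_ (hBm m hm)
      have h1 : (σ : ℝ) ^ (N * ν m) ≤ 1 :=
        Real.rpow_le_one σ.2.1 σ.2.2 (mul_nonneg (Nat.cast_nonneg N) (h.nonneg m))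
      have h2 : 0 ≤ N * ν m := mul_nonneg (Nat.cast_nonneg N) (h.nonneg m)
      gcongr
      linarith
  · refine (dist_pi_le_iff hBnn).2 fun m => ?_
    simp only [coefPath_snd, Pi.zero_apply, dist_zero_right]
    by_cases hm : m ∈ S
    · simp [h.zero m hm, hBnn]
    · have h2 : 0 ≤ N * ν m := mul_nonneg (Nat.cast_nonneg N) (h.nonneg m)
      have h3 : 0 ≤ N * ν m - 1 := by linarith [h.two_le m hm]
      have h1 : (σ : ℝ) ^ (N * ν m - 1) ≤ 1 := Real.rpow_le_one σ.2.1 σ.2.2 h3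
      rw [norm_mul, norm_tpow hτ.le, Complex.norm_real,
        Real.norm_of_nonneg (mul_nonneg h2 (Real.rpow_nonneg σ.2.1 _))]
      refine le_trans ?_ (hBm m hm)
      gcongr
      nlinarith [Real.rpow_nonneg σ.2.1 (N * ν m - 1)]

lemma tendsto_coefPath_right (h : Exponents S ν N) (θ : ℝ) :
    Tendsto (fun r : ℝ => coefPath h r θ) (𝓝[>] (0 : ℝ)) (𝓝 (basePath S)) :=
  Tendsto.comp (f := fun r : ℝ => (r, θ)) (g := fun τ : ℝ × ℝ => coefPath h τ.1 τ.2)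
    (tendsto_coefPath h) (Tendsto.prodMk tendsto_id tendsto_top)

/-! ### The flow read off from local solutions, and its uniqueness -/

namespace LocalSolution

variable {x₀ : Fin l → ℂ} (L : LocalSolution S x₀) (h : Exponents S ν N)

/-- The radius `ρ` is small enough for the paths of coefficients to stay in the domain of the local
solution. -/
def Small (ρ : ℝ) : Prop := ∀ r ∈ Ioo 0 ρ, ∀ θ, coefPath h r θ ∈ Metric.ball (basePath S) L.δ

lemma exists_small : ∃ ρ, 0 < ρ ∧ L.Small h ρ := by
  have h1 := (tendsto_coefPath h).eventually (Metric.ball_mem_nhds _ L.δ_pos)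
  rw [eventually_prod_iff] at h1
  obtain ⟨p, hp, q, hq, hpq⟩ := h1
  obtain ⟨ρ, hρ, hρ'⟩ := mem_nhdsGT_iff_exists_Ioo_subset.1 hp
  rw [eventually_top] at hq
  exact ⟨ρ, hρ, fun r hr θ => hpq (hρ' hr) (hq θ)⟩

/-- The flow in the toric gauge. -/
def flow (r θ : ℝ) (x : Fin l → ℂ) : Fin l → ℂ := L.Y (x, coefPath h r θ) 1

variable {L h}

lemma mem_ball_apply {x : Fin l → ℂ} (hx : x ∈ Metric.ball x₀ L.δ) {b : CoefPath Δ}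
    (hb : b ∈ Metric.ball (basePath S) L.δ) (σ : unitInterval) :
    dist (L.Y (x, b) σ) x₀ < L.ε / 2 :=
  (ContinuousMap.dist_lt_iff (half_pos L.ε_pos)).1 (L.near x hx b hb) σ

lemma coefPath_mem_ball {b : CoefPath Δ} (hb : b ∈ Metric.ball (basePath S) L.δ)
    (σ : unitInterval) : b σ ∈ Metric.ball (ind S, (0 : Δ → ℂ)) L.ε :=
  ((ContinuousMap.dist_lt_iff L.δ_pos).1 (Metric.mem_ball.1 hb) σ).trans_le L.δ_le

/-- Rescaling of the solutions. -/
lemma Y_scale {x : Fin l → ℂ} (hx : x ∈ Metric.ball x₀ L.δ) {R θ : ℝ} (hR : 0 < R)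
    (hb : coefPath h R θ ∈ Metric.ball (basePath S) L.δ) {s : unitInterval} (hs : 0 < (s : ℝ))
    (hb' : coefPath h (R * (s : ℝ) ^ N) θ ∈ Metric.ball (basePath S) L.δ) :
    L.Y (x, coefPath h (R * (s : ℝ) ^ N) θ) =
      (L.Y (x, coefPath h R θ)).comp ⟨fun σ => s * σ, by fun_prop⟩ := by
  set y := L.Y (x, coefPath h R θ) with hy
  refine L.unique x hx _ hb' _ ?_ fun σ => ?_
  · refine Metric.mem_ball.2 (lt_of_le_of_lt ?_ (half_lt_self L.ε_pos))
    refine (ContinuousMap.dist_le (half_pos L.ε_pos).le).2 fun σ => ?_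
    exact (mem_ball_apply hx hb _).le
  · have h1 := L.solves x hx _ hb (s * σ)
    rw [← hy] at h1
    simp only [ContinuousMap.comp_apply, ContinuousMap.coe_mk]
    rw [h1]
    congr 1
    have h2 : ((s * σ : unitInterval) : ℝ) = s * σ := rfl
    have h3 := intervalIntegral.smul_integral_comp_mul_left
      (a := 0) (b := (σ : ℝ)) (fun τ => hfieldPair (IccExtend zero_le_one y τ,
      IccExtend zero_le_one (coefPath h R θ) τ)) (s : ℝ)
    rw [mul_zero] at h3
    rw [h2, ← h3, ← intervalIntegral.integral_smul]
    refine intervalIntegral.integral_congr fun τ hτ => ?_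
    rw [uIcc_of_le σ.2.1] at hτ
    have hτ1 : τ ∈ Icc (0 : ℝ) 1 := ⟨hτ.1, hτ.2.trans σ.2.2⟩
    have hτ2 : (s : ℝ) * τ ∈ Icc (0 : ℝ) 1 := (s * ⟨τ, hτ1⟩ : unitInterval).2
    rw [IccExtend_of_mem _ _ hτ1, IccExtend_of_mem _ _ hτ1, IccExtend_of_mem _ _ hτ2,
      IccExtend_of_mem _ _ hτ2, coefPath_scale h hR θ hs]
    have e : (⟨(s : ℝ) * τ, hτ2⟩ : unitInterval) = s * ⟨τ, hτ1⟩ := rfl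
    rw [e]
    simp only [hfieldPair, ContinuousMap.comp_apply, ContinuousMap.coe_mk, hfield_smul]

lemma hasDerivAt_Y {x : Fin l → ℂ} (hx : x ∈ Metric.ball x₀ L.δ) {b : CoefPath Δ}
    (hb : b ∈ Metric.ball (basePath S) L.δ) {σ : ℝ} (hσ : σ ∈ Ioo (0 : ℝ) 1) :
    HasDerivAt (IccExtend zero_le_one (L.Y (x, b)))
      (hfieldPair (L.Y (x, b) ⟨σ, Ioo_subset_Icc_self hσ⟩, b ⟨σ, Ioo_subset_Icc_self hσ⟩)) σ := by
  set y := L.Y (x, b) with hy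
  let F : ℝ → (Fin l → ℂ) := fun τ => hfieldPair (IccExtend zero_le_one y τ, IccExtend
      zero_le_one b τ)
  have hF : Continuous F := by
    rw [continuous_iff_continuousAt]
    intro τ
    have hgood : Good (IccExtend zero_le_one y τ) (IccExtend zero_le_one b τ).1 :=
      L.good _ (Metric.mem_ball.2 ((mem_ball_apply hx hb _).trans (half_lt_self L.ε_pos))) _
        (coefPath_mem_ball hb _)
    have h1 := (hgood.contDiffAt_hfield (n := 0) (IccExtend zero_le_one b τ).2).continuousAt
    have h2 : ContinuousAt (fun τ : ℝ => (IccExtend zero_le_one y τ, IccExtend zero_le_one b τ))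
        τ :=
      (y.continuous.Icc_extend' (h := zero_le_one)).continuousAt.prodMk
        (b.continuous.Icc_extend' (h := zero_le_one)).continuousAt
    exact ContinuousAt.comp (g := hfieldPair)
      (f := fun τ : ℝ => (IccExtend zero_le_one y τ, IccExtend zero_le_one b τ)) h1 h2
  have h1 : HasDerivAt (fun τ => x + ∫ τ' in (0 : ℝ)..τ, F τ') (F σ) σ :=
    (intervalIntegral.integral_hasDerivAt_right (hF.intervalIntegrable _ _)
      (hF.stronglyMeasurableAtFilter _ _) hF.continuousAt).const_add x
  have h2 : F σ = hfieldPair (y ⟨σ, Ioo_subset_Icc_self hσ⟩, b ⟨σ, Ioo_subset_Icc_self hσ⟩) := by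
    simp only [F]
    rw [IccExtend_of_mem _ _ (Ioo_subset_Icc_self hσ), IccExtend_of_mem _ _ (Ioo_subset_Icc_self
        hσ)]
  rw [h2] at h1
  refine h1.congr_of_eventuallyEq ?_
  filter_upwards [Ioo_mem_nhds hσ.1 hσ.2] with τ hτ
  rw [IccExtend_of_mem _ _ (Ioo_subset_Icc_self hτ)]
  exact L.solves x hx b hb ⟨τ, Ioo_subset_Icc_self hτ⟩

lemma flow_good {ρ : ℝ} (hρ : L.Small h ρ) {x : Fin l → ℂ} (hx : x ∈ Metric.ball x₀ L.δ) {r θ : ℝ}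
    (hr : r ∈ Ioo 0 ρ) : Good (L.flow h r θ x) (coef ν r θ) := by
  have := L.good _ (Metric.mem_ball.2 ((mem_ball_apply hx (hρ r hr θ) 1).trans
    (half_lt_self L.ε_pos))) _ (coefPath_mem_ball (hρ r hr θ) 1)
  rwa [coefPath_one] at this

/-- The flow satisfies the flow equation. -/
lemma hasDerivAt_flow {ρ : ℝ} (hρ : L.Small h ρ) {x : Fin l → ℂ} (hx : x ∈ Metric.ball x₀ L.δ)
    {r θ : ℝ} (hr : r ∈ Ioo 0 ρ) :
    HasDerivAt (fun r => L.flow h r θ x)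
      (hfield (L.flow h r θ x) (coef ν r θ) (coefDeriv ν r θ)) r := by
  -- With `R > r` the time `r` corresponds to an interior parameter `s r < 1` of the solution for
  -- `R`, where two-sided differentiation is possible.
  obtain ⟨R, hrR, hRρ⟩ := exists_between hr.2
  have hR0 : 0 < R := hr.1.trans hrR
  have hN0 : (N : ℝ) ≠ 0 := by exact_mod_cast h.N_pos.ne'
  have hNp : (0 : ℝ) < (N : ℝ)⁻¹ := by have := h.N_pos; positivity
  let s : ℝ → ℝ := fun r' => (r' / R) ^ ((N : ℝ)⁻¹)
  have hs : ∀ r' ∈ Ioo 0 R, s r' ∈ Ioo (0 : ℝ) 1 ∧ R * s r' ^ N = r' := by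
    intro r' hr'
    have h0 : 0 < r' / R := div_pos hr'.1 hR0
    refine ⟨⟨Real.rpow_pos_of_pos h0 _, Real.rpow_lt_one h0.le ((div_lt_one hR0).2 hr'.2) hNp⟩, ?_⟩
    simp only [s]
    rw [Real.rpow_inv_natCast_pow h0.le h.N_pos.ne']
    field_simp
  have hflow : ∀ r' ∈ Ioo 0 R, L.flow h r' θ x =
      IccExtend zero_le_one (L.Y (x, coefPath h R θ)) (s r') := by
    intro r' hr'
    obtain ⟨h1, h2⟩ := hs r' hr'
    have h3 := Y_scale hx hR0 (hρ R ⟨hR0, hRρ⟩ θ) (s := ⟨s r', Ioo_subset_Icc_self h1⟩) h1.1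
      (by simp only; rw [h2]; exact hρ r' ⟨hr'.1, hr'.2.trans hRρ⟩ θ)
    simp only at h3
    rw [h2] at h3
    rw [flow, h3, IccExtend_of_mem _ _ (Ioo_subset_Icc_self h1)]
    simp
  obtain ⟨hs1, hs2⟩ := hs r ⟨hr.1, hrR⟩
  have hsd : HasDerivAt s (s r / (N * r)) r := by
    have h1 : HasDerivAt (fun r' : ℝ => r' / R) (1 / R) r := (hasDerivAt_id r).div_const R
    have h2 := h1.rpow_const (p := (N : ℝ)⁻¹) (Or.inl (div_pos hr.1 hR0).ne')
    refine h2.congr_deriv ?_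
    simp only [s]
    rw [Real.rpow_sub_one (div_pos hr.1 hR0).ne']
    have := hr.1.ne'
    field_simp
  have hd := (hasDerivAt_Y hx (hρ R ⟨hR0, hRρ⟩ θ) hs1).scomp r hsd
  have he : L.flow h r θ x = L.Y (x, coefPath h R θ) ⟨s r, Ioo_subset_Icc_self hs1⟩ := by
    rw [hflow r ⟨hr.1, hrR⟩, IccExtend_of_mem _ _ (Ioo_subset_Icc_self hs1)]
  have e1 := coefPath_fst_eq_coef h hR0 θ (σ := ⟨s r, Ioo_subset_Icc_self hs1⟩) hs1.1
  have e2 := coefPath_snd_eq_coefDeriv h hR0 θ (σ := ⟨s r, Ioo_subset_Icc_self hs1⟩) hs1.1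
  simp only at e1 e2
  rw [hs2] at e1 e2
  rw [e2, hfield_smul, ← e1, he]
  refine HasDerivAt.congr_of_eventuallyEq hd ?_
  filter_upwards [Ioo_mem_nhds hr.1 hrR] with r' hr'
  exact hflow r' hr'

lemma Y_basePath {x : Fin l → ℂ} (hx : x ∈ Metric.ball x₀ L.δ) :
    L.Y (x, basePath S) = constCLM x := by
  refine L.unique x hx _ (Metric.mem_ball_self L.δ_pos) _ ?_ fun σ => ?_
  · refine Metric.mem_ball.2 (lt_of_le_of_lt ?_ ((Metric.mem_ball.1 hx).trans_le L.δ_le))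
    exact (ContinuousMap.dist_le dist_nonneg).2 fun σ => le_rfl
  · have h0 : ∀ τ : ℝ, hfieldPair (IccExtend zero_le_one (constCLM x : C(unitInterval, Fin l →
        ℂ)) τ,
        IccExtend zero_le_one (basePath S) τ) = 0 := fun τ => by
      simp [hfieldPair, IccExtend, basePath, hfield_zero]
    simp only [h0]
    simp

lemma tendsto_flow {x : Fin l → ℂ} (hx : x ∈ Metric.ball x₀ L.δ) (θ : ℝ) :
    Tendsto (fun r => L.flow h r θ x) (𝓝[>] 0) (𝓝 x) := by
  have h1 := (L.smooth x hx _ (Metric.mem_ball_self L.δ_pos)).continuousAt.tendsto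
  rw [Y_basePath hx] at h1
  have h2 : Tendsto (fun r => (x, coefPath h r θ)) (𝓝[>] 0) (𝓝 (x, basePath S)) :=
    tendsto_const_nhds.prodMk_nhds (tendsto_coefPath_right h θ)
  have h3 := ((evalOne (l := l)).continuous.tendsto (constCLM x)).comp (h1.comp h2)
  exact h3

lemma isGaugeFlow_flow {ρ : ℝ} (hρ : L.Small h ρ) {x : Fin l → ℂ} (hx : x ∈ Metric.ball x₀ L.δ)
    (hxp : x ∈ pants S) (θ : ℝ) : IsGaugeFlow ν θ ρ (fun r => L.flow h r θ x) :=
  isGaugeFlow_of_hasDerivAt h.zero h.pos hxp (fun _ hr => flow_good hρ hx hr)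
    (fun _ hr => hasDerivAt_flow hρ hx hr) (tendsto_flow hx θ)

/-- A trajectory that stays near `x₀` up to time `R` is given by the local solution. -/
lemma eq_flow_of_forall_mem_ball {ρ : ℝ} (hρ : L.Small h ρ) {x : Fin l → ℂ}
    (hx : x ∈ Metric.ball x₀ L.δ) {θ : ℝ} {y : ℝ → Fin l → ℂ} (hy : IsGaugeFlow ν θ ρ y)
    (ht : Tendsto y (𝓝[>] 0) (𝓝 x)) {R : ℝ} (hR : R ∈ Ioo 0 ρ) {η : ℝ} (hη : η < L.ε)
    (hball : ∀ r ∈ Ioc 0 R, dist (y r) x₀ ≤ η) (hxη : dist x x₀ ≤ η) :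
    y R = L.flow h R θ x := by
  classical
  have hN0 : N ≠ 0 := h.N_pos.ne'
  -- The trajectory in the variable `σ`, with its limit inserted at `σ = 0`. It solves the regular
  -- integral equation, so local uniqueness applies.
  let z : ℝ → Fin l → ℂ := fun σ => if σ = 0 then x else y (R * σ ^ N)
  have hz0 : z 0 = x := if_pos rfl
  have hzp : ∀ σ, σ ≠ 0 → z σ = y (R * σ ^ N) := fun σ hσ => if_neg hσ
  have hmem : ∀ σ ∈ Ioc (0 : ℝ) 1, R * σ ^ N ∈ Ioc 0 R := fun σ hσ =>
    ⟨mul_pos hR.1 (pow_pos hσ.1 N), mul_le_of_le_one_right hR.1.le (pow_le_one₀ hσ.1.le hσ.2)⟩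
  have hmem' : ∀ σ ∈ Ioc (0 : ℝ) 1, R * σ ^ N ∈ Ioo 0 ρ := fun σ hσ =>
    ⟨(hmem σ hσ).1, (hmem σ hσ).2.trans_lt hR.2⟩
  have hzd : ∀ σ (hσ : σ ∈ Ioc (0 : ℝ) 1), HasDerivAt z
      (hfieldPair (z σ, coefPath h R θ ⟨σ, Ioc_subset_Icc_self hσ⟩)) σ := by
    intro σ hσ
    set r := R * σ ^ N with hr
    have hb := coefPath_mem_ball (L := L) (hρ R hR θ) ⟨σ, Ioc_subset_Icc_self hσ⟩
    have e1 := coefPath_fst_eq_coef h hR.1 θ (σ := ⟨σ, Ioc_subset_Icc_self hσ⟩) hσ.1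
    have e2 := coefPath_snd_eq_coefDeriv h hR.1 θ (σ := ⟨σ, Ioc_subset_Icc_self hσ⟩) hσ.1
    simp only at e1 e2
    rw [← hr] at e1 e2
    have hg : Good (y r) (coef ν r θ) := by
      rw [← e1]
      exact L.good _ (Metric.mem_ball.2 ((hball r (hmem σ hσ)).trans_lt hη)) _ hb
    have hd := hy.hasDerivAt (hmem' σ hσ) hg
    have hsd : HasDerivAt (fun σ : ℝ => R * σ ^ N) (N * r / σ) σ := by
      refine ((hasDerivAt_pow N σ).const_mul R).congr_deriv ?_
      rw [hr]
      have hσ0 := hσ.1.ne'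
      obtain ⟨n, rfl⟩ := Nat.exists_eq_succ_of_ne_zero hN0
      simp only [Nat.succ_eq_add_one, Nat.add_sub_cancel, pow_succ]
      field_simp
    have hd2 := hd.scomp σ hsd
    rw [← hfield_smul, e2, smul_smul, ← e1] at hd2
    have hone : (N * r / σ) * (σ / (N * r)) = 1 := by
      have h1 : (N : ℝ) ≠ 0 := by exact_mod_cast hN0
      have h2 := hσ.1.ne'
      have h3 : r ≠ 0 := (hmem σ hσ).1.ne'
      field_simp
    rw [hone, one_smul] at hd2
    rw [hzp σ hσ.1.ne']
    refine HasDerivAt.congr_of_eventuallyEq hd2 ?_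
    filter_upwards [lt_mem_nhds hσ.1] with σ' hσ'
    exact hzp σ' hσ'.ne'
  have hzc : ContinuousOn z (Icc 0 1) := by
    intro σ hσ
    rcases hσ.1.eq_or_lt with h0 | h0
    · subst h0
      have h1 : Tendsto (fun σ : ℝ => R * σ ^ N) (𝓝[>] 0) (𝓝[>] 0) := by
        refine tendsto_nhdsWithin_iff.2 ⟨?_, ?_⟩
        · have : Continuous fun σ : ℝ => R * σ ^ N := by fun_prop
          have h2 := this.tendsto 0
          simp only [zero_pow hN0, mul_zero] at h2
          exact h2.mono_left nhdsWithin_le_nhds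
        · filter_upwards [self_mem_nhdsWithin] with σ hσ
          exact mul_pos hR.1 (pow_pos hσ N)
      have h2 : Tendsto z (𝓝[>] 0) (𝓝 x) := by
        refine (ht.comp h1).congr' ?_
        filter_upwards [self_mem_nhdsWithin] with σ hσ
        exact (hzp σ (ne_of_gt hσ)).symm
      have h3 : ContinuousWithinAt z (Ici 0) 0 := by
        rw [← continuousWithinAt_Ioi_iff_Ici, ContinuousWithinAt, hz0]
        exact h2
      exact h3.mono Icc_subset_Ici_self
    · exact (hzd σ ⟨h0, hσ.2⟩).continuousAt.continuousWithinAt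
  let zc : C(unitInterval, Fin l → ℂ) := ⟨fun σ => z σ, continuousOn_iff_continuous_domRestrict.1
      hzc⟩
  have hzx : ∀ σ ∈ Icc (0 : ℝ) 1, dist (z σ) x₀ ≤ η := by
    intro σ hσ
    rcases hσ.1.eq_or_lt with h0 | h0
    · rw [← h0, hz0]; exact hxη
    · rw [hzp σ h0.ne']
      exact hball _ (hmem σ ⟨h0, hσ.2⟩)
  have hη0 : 0 ≤ η := dist_nonneg.trans hxη
  have hzball : zc ∈ Metric.ball (constCLM x₀ : C(unitInterval, Fin l → ℂ)) L.ε :=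
    Metric.mem_ball.2 (lt_of_le_of_lt ((ContinuousMap.dist_le hη0).2 fun σ => hzx σ σ.2) hη)
  have hbR := hρ R hR θ
  have hsol : SolvesIntegral hfieldPair x (coefPath h R θ) zc := by
    intro σ
    let F : ℝ → (Fin l → ℂ) := fun τ => hfieldPair (IccExtend zero_le_one zc τ,
      IccExtend zero_le_one (coefPath h R θ) τ)
    have hF : Continuous F := by
      rw [continuous_iff_continuousAt]
      intro τ
      have hgood : Good (IccExtend zero_le_one zc τ) (IccExtend zero_le_one (coefPath h R θ) τ).1 :=
        L.good _ (Metric.mem_ball.2 ((hzx _ (projIcc 0 1 zero_le_one τ).2).trans_lt hη)) _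
          (coefPath_mem_ball hbR _)
      have h1 := (hgood.contDiffAt_hfield (n := 0)
        (IccExtend zero_le_one (coefPath h R θ) τ).2).continuousAt
      have h2 : ContinuousAt (fun τ : ℝ => (IccExtend zero_le_one zc τ,
          IccExtend zero_le_one (coefPath h R θ) τ)) τ :=
        (zc.continuous.Icc_extend' (h := zero_le_one)).continuousAt.prodMk
          ((coefPath h R θ).continuous.Icc_extend' (h := zero_le_one)).continuousAt
      exact ContinuousAt.comp (g := hfieldPair) (f := fun τ : ℝ => (IccExtend zero_le_one zc τ,
        IccExtend zero_le_one (coefPath h R θ) τ)) h1 h2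
    have hftc := intervalIntegral.integral_eq_sub_of_hasDerivAt_of_le σ.2.1
      (hzc.mono (Icc_subset_Icc le_rfl σ.2.2)) (f' := F) (fun τ hτ => by
        have hτ1 : τ ∈ Ioc (0 : ℝ) 1 := ⟨hτ.1, hτ.2.le.trans σ.2.2⟩
        have := hzd τ hτ1
        simp only [F]
        rw [IccExtend_of_mem _ _ (Ioc_subset_Icc_self hτ1),
          IccExtend_of_mem _ _ (Ioc_subset_Icc_self hτ1)]
        exact this) (hF.intervalIntegrable _ _)
    change z σ = x + ∫ τ in (0 : ℝ)..σ, F τ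
    rw [hftc, hz0]
    simp
  have := L.unique x hx _ hbR zc hzball hsol
  rw [flow, this]
  change y R = z ((1 : unitInterval) : ℝ)
  rw [hzp _ (by simp)]
  simp

/-- Uniqueness of trajectories. -/
lemma eq_flow {ρ : ℝ} (hρ : L.Small h ρ) {x : Fin l → ℂ}
    (hx : x ∈ Metric.ball x₀ (L.δ / 2)) {θ : ℝ} {y : ℝ → Fin l → ℂ} (hy : IsGaugeFlow ν θ ρ y)
    (ht : Tendsto y (𝓝[>] 0) (𝓝 x)) {R : ℝ} (hR : R ∈ Ioo 0 ρ) :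
    y R = L.flow h R θ x := by
  have hε := L.ε_pos
  have hx' : x ∈ Metric.ball x₀ L.δ :=
    Metric.ball_subset_ball (half_le_self L.δ_pos.le) hx
  have hxε : dist x x₀ < L.ε / 2 := (Metric.mem_ball.1 hx).trans_le (by linarith [L.δ_le])
  -- Any value strictly between `ε / 2`, where the local solution lives, and `ε`, where uniqueness
  -- holds, would do.
  set η := 3 * L.ε / 4
  have hηε : η < L.ε := by simp only [η]; linarith
  have hεη : L.ε / 2 < η := by simp only [η]; linarith
  refine eq_flow_of_forall_mem_ball hρ hx' hy ht hR hηε ?_ (hxε.le.trans hεη.le)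
  by_contra! hcon
  -- Continuation: before the infimum of the times at distance at least `η` the trajectory coincides
  -- with the local solution and is within `ε / 2`. By continuity it is still closer than `η` just
  -- after the infimum, a contradiction.
  let T : Set ℝ := {r | r ∈ Ioc 0 R ∧ η ≤ dist (y r) x₀}
  have hTne : T.Nonempty := by
    obtain ⟨r, hr, hr'⟩ := hcon
    exact ⟨r, hr, hr'.le⟩
  have hTbdd : BddBelow T := ⟨0, fun r hr => hr.1.1.le⟩
  obtain ⟨r₁, hr₁, hr₁'⟩ : ∃ r₁ > 0, ∀ r ∈ Ioo 0 r₁, dist (y r) x₀ < L.ε / 2 := by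
    have h1 : ∀ᶠ r in 𝓝[>] (0 : ℝ), dist (y r) x₀ < L.ε / 2 :=
      (ht.dist tendsto_const_nhds).eventually_lt_const hxε
    obtain ⟨r₁, h2, h3⟩ := mem_nhdsGT_iff_exists_Ioo_subset.1 h1
    exact ⟨r₁, h2, fun r hr => h3 hr⟩
  set r₀ := sInf T with hr₀
  have hr₁₀ : r₁ ≤ r₀ := le_csInf hTne fun r hr => by
    by_contra! hlt
    have := hr₁' r ⟨hr.1.1, hlt⟩
    linarith [hr.2]
  have hr₀0 : 0 < r₀ := hr₁.trans_le hr₁₀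
  have hr₀R : r₀ ≤ R := by
    obtain ⟨r, hr⟩ := hTne
    exact (csInf_le hTbdd hr).trans hr.1.2
  have hr₀ρ : r₀ ∈ Ioo 0 ρ := ⟨hr₀0, hr₀R.trans_lt hR.2⟩
  have hbelow : ∀ r ∈ Ioo 0 r₀, dist (y r) x₀ < L.ε / 2 := by
    intro r hr
    have hrρ : r ∈ Ioo 0 ρ := ⟨hr.1, hr.2.trans hr₀ρ.2⟩
    have h1 : ∀ r' ∈ Ioc 0 r, dist (y r') x₀ ≤ η := by
      intro r' hr'
      by_contra! hlt
      have : r' ∈ T := ⟨⟨hr'.1, (hr'.2.trans hr.2.le).trans hr₀R⟩, hlt.le⟩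
      exact absurd (csInf_le hTbdd this) (not_le.2 (hr'.2.trans_lt hr.2))
    have h2 := eq_flow_of_forall_mem_ball hρ hx' hy ht hrρ hηε h1 (hxε.le.trans hεη.le)
    rw [h2]
    exact mem_ball_apply hx' (hρ r hrρ θ) 1
  have hcont : ContinuousAt (fun r => dist (y r) x₀) r₀ :=
    ((hy.diff r₀ hr₀ρ).continuousAt).dist continuousAt_const
  have hle : dist (y r₀) x₀ ≤ L.ε / 2 := by
    refine le_of_tendsto (hcont.tendsto.mono_left (nhdsWithin_le_nhds (s := Iio r₀))) ?_
    filter_upwards [Ioo_mem_nhdsLT hr₀0] with r hr using (hbelow r hr).le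
  have hnear : ∀ᶠ r in 𝓝 r₀, dist (y r) x₀ < η :=
    hcont.eventually_lt_const (hle.trans_lt hεη)
  obtain ⟨ε', hε', hnear'⟩ := Metric.eventually_nhds_iff_ball.1 hnear
  obtain ⟨r, hrT, hrlt⟩ := exists_lt_of_csInf_lt hTne (show sInf T < r₀ + ε' by linarith)
  have hge : r₀ ≤ r := csInf_le hTbdd hrT
  have := hnear' r (by rw [Metric.mem_ball, Real.dist_eq, abs_of_nonneg (by linarith)]; linarith)
  linarith [hrT.2]

end LocalSolution

end Paths

/-! ### Smooth families and changes of gauge -/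

section

/-! ### Convergence of all derivatives from joint smoothness in point and parameter -/

section Parameters

variable {Q P F : Type*} [NormedAddCommGroup Q] [NormedSpace ℝ Q] [NormedAddCommGroup P]
  [NormedSpace ℝ P] [NormedAddCommGroup F] [NormedSpace ℝ F]

/-- Partial derivatives of all orders depend smoothly on parameters. -/
lemma contDiffAt_iteratedFDeriv_left {𝒢 : Q × P → F} {q₀ : Q} {p₀ : P}
    (h : ContDiffAt ℝ ∞ 𝒢 (q₀, p₀)) (j : ℕ) :
    ContDiffAt ℝ ∞ (fun z : Q × P => iteratedFDeriv ℝ j (fun q => 𝒢 (q, z.2)) z.1) (q₀, p₀) := by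
  induction j with
  | zero =>
    exact (continuousMultilinearCurryFin0 ℝ Q F).symm.contDiff.contDiffAt.comp (q₀, p₀) h
  | succ j ih =>
    have h1 : ContDiffAt ℝ ∞ (Function.uncurry fun (z : Q × P) (q : Q) =>
        iteratedFDeriv ℝ j (fun q => 𝒢 (q, z.2)) q) ((q₀, p₀), q₀) :=
      ContDiffAt.comp (g := fun z : Q × P => iteratedFDeriv ℝ j (fun q => 𝒢 (q, z.2)) z.1)
        (f := fun y : (Q × P) × Q => (y.2, y.1.2)) _ ih
        (contDiffAt_snd.prodMk (contDiffAt_snd.comp _ contDiffAt_fst))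
    have h2 : ContDiffAt ℝ ∞ (fun z : Q × P =>
        fderiv ℝ (iteratedFDeriv ℝ j (fun q => 𝒢 (q, z.2))) z.1) (q₀, p₀) :=
      ContDiffAt.fderiv (f := fun (z : Q × P) (q : Q) =>
        iteratedFDeriv ℝ j (fun q => 𝒢 (q, z.2)) q) (g := Prod.fst) h1 contDiffAt_fst le_rfl
    exact (continuousMultilinearCurryLeftEquiv ℝ (fun _ : Fin (j + 1) => Q)
        F).symm.contDiff.contDiffAt.comp
      (q₀, p₀) h2

/-- A family that is locally the restriction of a smooth function of the point and of a convergent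
parameter converges with all derivatives, uniformly on compact sets. -/
lemma tendstoUniformlyOn_iteratedFDeriv {T : Type*} {𝓕 : Filter T} {p : T → P} {p₀ : P}
    (hp : Tendsto p 𝓕 (𝓝 p₀)) {f : T → Q → F} {f₀ : Q → F} {K : Set Q} (hK : IsCompact K)
    (h : ∀ q₀ ∈ K, ∃ 𝒢 : Q × P → F, ContDiffAt ℝ ∞ 𝒢 (q₀, p₀) ∧
      (∀ᶠ q in 𝓝 q₀, f₀ q = 𝒢 (q, p₀)) ∧ ∀ᶠ z in 𝓕 ×ˢ 𝓝 q₀, f z.1 z.2 = 𝒢 (z.2, p z.1)) (j : ℕ) :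
    TendstoUniformlyOn (fun τ q => iteratedFDeriv ℝ j (f τ) q) (iteratedFDeriv ℝ j f₀) 𝓕 K := by
  rw [← tendstoLocallyUniformlyOn_iff_tendstoUniformlyOn_of_compact hK,
    Metric.tendstoLocallyUniformlyOn_iff]
  intro ε hε q₀ hq₀
  obtain ⟨𝒢, hG, h0, h1⟩ := h q₀ hq₀
  have hc := (contDiffAt_iteratedFDeriv_left hG j).continuousAt
  have hball := hc.eventually (Metric.ball_mem_nhds _ (half_pos hε))
  rw [nhds_prod_eq, eventually_prod_iff] at hball
  obtain ⟨A, hA, B, hB, hAB⟩ := hball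
  rw [eventually_prod_iff] at h1
  obtain ⟨C, hC, D, hD, hCD⟩ := h1
  -- Derivatives depend on germs, so the identifications with `𝒢` are required near each point `q`
  -- and not just at `q`.
  refine ⟨{q | A q ∧ (∀ᶠ q' in 𝓝 q, f₀ q' = 𝒢 (q', p₀)) ∧ ∀ᶠ q' in 𝓝 q, D q'},
    mem_nhdsWithin_of_mem_nhds (hA.and (h0.eventually_nhds.and hD.eventually_nhds)), ?_⟩
  filter_upwards [hC, hp.eventually hB] with τ hτ hτ' q hq
  obtain ⟨hq1, hq2, hq3⟩ := hq
  have e0 : f₀ =ᶠ[𝓝 q] fun q' => 𝒢 (q', p₀) := hq2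
  have e1 : f τ =ᶠ[𝓝 q] fun q' => 𝒢 (q', p τ) := by
    filter_upwards [hq3] with q' hq' using hCD hτ hq'
  rw [(e0.iteratedFDeriv ℝ j).eq_of_nhds, (e1.iteratedFDeriv ℝ j).eq_of_nhds]
  have d1 := hAB hq1 hB.self_of_nhds
  have d2 := hAB hq1 hτ'
  simp only at d1 d2
  calc _ ≤ _ := dist_triangle_right _ _ _
    _ < ε / 2 + ε / 2 := add_lt_add d1 d2
    _ = ε := add_halves ε

end Parameters

variable {l : ℕ} {Δ : Finset (Fin l → ℤ)}

/-! ### Behaviour of the metrics under toric translations -/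

section Gauge

lemma ddbar_congr {f g : (Fin l → ℂ) → ℝ} {x : Fin l → ℂ} (h : f =ᶠ[𝓝 x] g) (a b : Fin l → ℂ) :
    ddbar f x a b = ddbar g x a b := by
  rw [ddbar, ddbar, (h.fderiv).fderiv_eq]

/-- The Hessian pulls back under a linear map without correction term, and complex linearity lets
`T` commute with multiplication by `i`. -/
lemma ddbar_comp {f : (Fin l → ℂ) → ℝ} (T : (Fin l → ℂ) →L[ℂ] (Fin l → ℂ)) {y : Fin l → ℂ}
    (hf : ContDiffAt ℝ 2 f (T y)) (a b : Fin l → ℂ) :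
    ddbar f (T y) (T a) (T b) = ddbar (fun y => f (T y)) y a b := by
  let T' : (Fin l → ℂ) →L[ℝ] (Fin l → ℂ) := T.restrictScalars ℝ
  have hT : ∀ v, T' v = T v := fun v => rfl
  have h1 : fderiv ℝ (fun y => f (T y)) =ᶠ[𝓝 y] fun y => (fderiv ℝ f (T' y)).comp T' := by
    have h2 : ∀ᶠ z in 𝓝 (T y), DifferentiableAt ℝ f z :=
      (hf.eventually (by simp)).mono fun z hz => hz.differentiableAt (by norm_num)
    filter_upwards [T'.continuous.continuousAt.eventually h2] with z hz
    exact (HasFDerivAt.comp z hz.hasFDerivAt T'.hasFDerivAt).fderiv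
  have h3 : DifferentiableAt ℝ (fderiv ℝ f) (T' y) :=
    (hf.fderiv_right (m := 1) (by norm_num)).differentiableAt (by norm_num)
  have h4 : HasFDerivAt (fun y => (fderiv ℝ f (T' y)).comp T')
      (((ContinuousLinearMap.compL ℝ (Fin l → ℂ) (Fin l → ℂ) ℝ).flip T').comp
        ((fderiv ℝ (fderiv ℝ f) (T' y)).comp T')) y :=
    ((ContinuousLinearMap.compL ℝ (Fin l → ℂ) (Fin l → ℂ) ℝ).flip T').hasFDerivAt.comp y
      (HasFDerivAt.comp y h3.hasFDerivAt T'.hasFDerivAt)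
  have h5 : ∀ a b, fderiv ℝ (fderiv ℝ fun y => f (T y)) y a b =
      fderiv ℝ (fderiv ℝ f) (T y) (T a) (T b) := fun a b => by
    rw [h1.fderiv_eq, h4.fderiv]
    rfl
  rw [ddbar, ddbar, h5, h5, T.map_smul, T.map_smul]

lemma eta_smul {ι : Type*} [Fintype ι] {k : ℂ} (hk : k ≠ 0) (z : ι → ℂ) (m : ι) :
    eta (k • z) m = eta z m := by
  have : ‖k‖ ^ 2 ≠ 0 := pow_ne_zero _ (norm_ne_zero_iff.2 hk)
  simp only [eta, Pi.smul_apply, smul_eq_mul, norm_mul, mul_pow, ← Finset.mul_sum]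
  rw [mul_div_mul_left _ _ this]

lemma bigA_smul {ι : Type*} [Fintype ι] (κ : ℝ) (S : Finset ι) {k : ℂ} (hk : k ≠ 0) (z : ι → ℂ) :
    bigA κ S (k • z) = bigA κ S z := by
  simp only [bigA, eta_smul hk]

/-- The toric translation by `t ^ u` as a linear map. -/
def gaugeCLM (u : Fin l → ℝ) (r θ : ℝ) : (Fin l → ℂ) →L[ℂ] (Fin l → ℂ) :=
  ContinuousLinearMap.pi fun i => tpow r θ (u i) • ContinuousLinearMap.proj i

lemma gaugeCLM_apply (u : Fin l → ℝ) (r θ : ℝ) (x : Fin l → ℂ) :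
    gaugeCLM u r θ x = gauge u r θ x := rfl

/-- The approximate metrics in the toric gauge. -/
lemma gApprox_gauge (w : Δ → ℝ) {κ : ℝ} (hκ : 0 < κ) (u : Fin l → ℝ) (k : ℝ) {r : ℝ} (hr : 0 < r)
    (θ : ℝ) {y : Fin l → ℂ} (hy : y ∈ torus l) (a b : Fin l → ℂ) :
    gApprox w κ r θ (gauge (-u) r θ y) (gauge (-u) r θ a) (gauge (-u) r θ b) =
      gGen κ (Ztop w) (coef (excess w u k) r θ) y a b := by
  have hy' : gauge (-u) r θ y ∈ torus l := (gauge_mem_torus _ hr θ).2 hy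
  have hk := tpow_ne_zero hr θ k
  rw [gApprox, gGen]
  congr 1
  · rw [fderiv_emb_gauge w u k hr θ hy', fderiv_emb_gauge w u k hr θ hy', emb_eq_gauge w u k hr θ]
    simp only [gauge_gauge_neg u hr θ]
    rw [fubiniStudy_eq, fubiniStudy_eq, herm_smul_smul hk, fderiv_mon _ hy, fderiv_mon _ hy]
  · rw [← gaugeCLM_apply, ← gaugeCLM_apply, ← gaugeCLM_apply, ddbar_comp]
    · congr 1
      funext z
      congr 1
      simp only [h, hGen, gaugeCLM_apply]
      rw [emb_eq_gauge w u k hr θ, gauge_gauge_neg u hr θ]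
      simp only [bigA_smul κ _ hk]
    · exact contDiffAt_log_hGen (c := fun m => tpow r θ (w m)) hκ
        (fun S _ m _ => tpow_ne_zero hr θ _) hy'

end Gauge

end

/-! ### Extension of the metrics to `t = 0` -/

section

variable {l : ℕ} {Δ : Finset (Fin l → ℤ)}

/-- The part of `a_m` that stays bounded as `t → 0`. -/
def baseA (κ : ℝ) (c : Δ → ℂ) (m : Δ) (y : Fin l → ℂ) : ℝ :=
  κ - Real.log (‖monomial (m : Fin l → ℤ) y‖ ^ 2) + Real.log (∑ i, ‖mon c y i‖ ^ 2)

open Classical in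
/-- An expression for `a_m⁻¹` that is smooth in `ε = -1 / log |t|` up to `ε = 0`. -/
def invA (κ : ℝ) (S : Finset Δ) (ν : Δ → ℝ) (c : Δ → ℂ) (ε : ℝ) (m : Δ) (y : Fin l → ℂ) : ℝ :=
  if m ∈ S then (baseA κ c m y)⁻¹ else ε / (ε * baseA κ c m y + 2 * ν m)

/-- An expression for `h_t` that is smooth in the coefficients and in `ε = -1 / log |t|` up to
`t = 0`. -/
def hExt (κ : ℝ) (𝒮 : Finset (Finset Δ)) (S : Finset Δ) (ν : Δ → ℝ) (c : Δ → ℂ) (ε : ℝ)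
    (y : Fin l → ℂ) : ℝ :=
  κ ^ 2 * ∑ S' ∈ 𝒮, (∏ m ∈ S', invA κ S ν c ε m y) ^ 2

lemma aFun_eq_baseA (κ : ℝ) {c : Δ → ℂ} {m : Δ} (hm : c m ≠ 0) {y : Fin l → ℂ}
    (hy : y ∈ torus l) : aFun κ c m y = baseA κ c m y - 2 * Real.log ‖c m‖ := by
  have h1 : ‖c m‖ ≠ 0 := norm_ne_zero_iff.2 hm
  have h2 : ‖monomial (m : Fin l → ℤ) y‖ ≠ 0 := norm_ne_zero_iff.2 (monomial_ne_zero _ hy)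
  have h3 : ‖mon c y m‖ ^ 2 = ‖c m‖ ^ 2 * ‖monomial (m : Fin l → ℤ) y‖ ^ 2 := by
    rw [mon, norm_mul, mul_pow]
  rw [aFun, baseA, eta, Real.log_div _ (sum_sq_pos (exists_mon_ne_zero hy hm)).ne', h3,
    Real.log_mul (pow_ne_zero _ h1) (pow_ne_zero _ h2), Real.log_pow]
  · push_cast; ring
  · rw [h3]; exact mul_ne_zero (pow_ne_zero _ h1) (pow_ne_zero _ h2)

/-- Here `a_m` is `baseA` minus `2 ν_m log r`; numerator and denominator are multiplied by `ε = -1 /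
log r`. The restriction `r < 1` keeps `log r` away from zero. -/
lemma invA_coef {κ : ℝ} {S : Finset Δ} {ν : Δ → ℝ} (hν : ∀ m ∈ S, ν m = 0) {r : ℝ}
    (hr : r ∈ Ioo (0 : ℝ) 1) (θ : ℝ) (m : Δ) {y : Fin l → ℂ} (hy : y ∈ torus l) :
    invA κ S ν (coef ν r θ) (-(Real.log r)⁻¹) m y = (aFun κ (coef ν r θ) m y)⁻¹ := by
  have hl : Real.log r ≠ 0 := (Real.log_neg hr.1 hr.2).ne
  have h1 : Real.log ‖coef ν r θ m‖ = ν m * Real.log r := by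
    rw [coef, norm_tpow hr.1.le, Real.log_rpow hr.1]
  rw [aFun_eq_baseA κ (tpow_ne_zero hr.1 θ (ν m)) hy, h1, invA]
  split_ifs with hm
  · rw [hν m hm]; simp
  · have h2 : -(Real.log r)⁻¹ * baseA κ (coef ν r θ) m y + 2 * ν m =
        -(Real.log r)⁻¹ * (baseA κ (coef ν r θ) m y - 2 * (ν m * Real.log r)) := by
      field_simp
      ring
    rw [h2, div_mul_eq_div_div, div_self (neg_ne_zero.2 (inv_ne_zero hl)), one_div]

lemma hExt_coef {κ : ℝ} (𝒮 : Finset (Finset Δ)) {S : Finset Δ} {ν : Δ → ℝ}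
    (hν : ∀ m ∈ S, ν m = 0) {r : ℝ} (hr : r ∈ Ioo (0 : ℝ) 1) (θ : ℝ) {y : Fin l → ℂ}
    (hy : y ∈ torus l) :
    hExt κ 𝒮 S ν (coef ν r θ) (-(Real.log r)⁻¹) y = hGen κ 𝒮 (coef ν r θ) y := by
  simp only [hExt, hGen, bigA_mon, invA_coef hν hr θ _ hy, Finset.prod_inv_distrib]

lemma invA_ind {κ : ℝ} {S : Finset Δ} (ν : Δ → ℝ) (m : Δ) {y : Fin l → ℂ} (hy : y ∈ torus l) :
    (m ∈ S → invA κ S ν (ind S) 0 m y = (aFun κ (ind S) m y)⁻¹) ∧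
      (m ∉ S → invA κ S ν (ind S) 0 m y = 0) := by
  refine ⟨fun hm => ?_, fun hm => by simp [invA, hm]⟩
  rw [aFun_eq_baseA κ (ind_ne_zero hm) hy, invA, if_pos hm, ind_of_mem hm]
  simp

/-- All top cells have the same cardinality, so a cell other than `S` has a vertex outside `S`. The
factor `a_m⁻¹` of that vertex is `0` at `ε = 0`, and only the term of `S` survives. -/
lemma hExt_ind {w : Δ → ℝ} {κ : ℝ} {S : Finset Δ} (hS : S ∈ Ztop w) (ν : Δ → ℝ)
    {y : Fin l → ℂ} (hy : y ∈ torus l) :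
    hExt κ (Ztop w) S ν (ind S) 0 y = hGen κ {S} (ind S) y := by
  rw [hExt, hGen, Finset.sum_singleton, Finset.sum_eq_single S]
  · rw [bigA_mon, ← Finset.prod_inv_distrib,
      Finset.prod_congr rfl fun m hm => (invA_ind ν m hy).1 hm]
  · intro S' hS' hne
    have hex : ∃ m ∈ S', m ∉ S := by
      by_contra! hsub
      exact hne (Finset.eq_of_subset_of_card_le hsub
        (by rw [card_of_mem_Ztop hS, card_of_mem_Ztop hS']))
    obtain ⟨m, hm, hm'⟩ := hex
    rw [Finset.prod_eq_zero hm ((invA_ind ν m hy).2 hm')]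
    simp
  · exact fun h => absurd hS h

section Smooth

variable {Q : Type*} [NormedAddCommGroup Q] [NormedSpace ℝ Q] {q₀ : Q} {n : WithTop ℕ∞}

lemma contDiffAt_baseA (κ : ℝ) (m : Δ) {c : Q → Δ → ℂ} {y : Q → Fin l → ℂ}
    (hc : ContDiffAt ℝ n c q₀) (hy : ContDiffAt ℝ n y q₀) (hy0 : y q₀ ∈ torus l)
    (hc0 : ∃ m, c q₀ m ≠ 0) : ContDiffAt ℝ n (fun q => baseA κ (c q) m (y q)) q₀ := by
  obtain ⟨m₀, hm₀⟩ := hc0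
  refine (contDiffAt_const.sub (ContDiffAt.log ?_ ?_)).add (ContDiffAt.log ?_ ?_)
  · exact ContDiffAt.norm_sq ℝ ((contDiffAt_monomial _ hy0).comp q₀ hy)
  · exact pow_ne_zero _ (norm_ne_zero_iff.2 (monomial_ne_zero _ hy0))
  · exact ContDiffAt.sum fun i _ => ContDiffAt.norm_sq ℝ
      (contDiffAt_coord (contDiffAt_mon hc hy hy0) i)
  · exact (sum_sq_pos (exists_mon_ne_zero hy0 hm₀)).ne'

/-- At the limit the denominators are `a_m ≥ κ > 0` for `m ∈ S` and `2 ν_m > 0` otherwise. No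
logarithm of a coefficient occurs, so coefficients may tend to zero. -/
lemma contDiffAt_hExt {κ : ℝ} (hκ : 0 < κ) (𝒮 : Finset (Finset Δ)) {S : Finset Δ}
    (hne : S.Nonempty) {ν : Δ → ℝ} (hν : ∀ m ∉ S, 0 < ν m) {c : Q → Δ → ℂ} {ε : Q → ℝ}
    {y : Q → Fin l → ℂ} (hc : ContDiffAt ℝ n c q₀) (hε : ContDiffAt ℝ n ε q₀)
    (hy : ContDiffAt ℝ n y q₀) (hy0 : y q₀ ∈ torus l) (hc0 : c q₀ = ind S) (hε0 : ε q₀ = 0) :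
    ContDiffAt ℝ n (fun q => hExt κ 𝒮 S ν (c q) (ε q) (y q)) q₀ := by
  obtain ⟨m₀, hm₀⟩ := hne
  have hc1 : ∃ m, c q₀ m ≠ 0 := ⟨m₀, by rw [hc0]; exact ind_ne_zero hm₀⟩
  refine contDiffAt_const.mul (ContDiffAt.sum fun S' _ => ContDiffAt.pow ?_ 2)
  refine contDiffAt_prod fun m _ => ?_
  have hb := contDiffAt_baseA κ m hc hy hy0 hc1
  by_cases hm : m ∈ S
  · simp only [invA, if_pos hm]
    refine hb.inv ?_
    have := aFun_eq_baseA κ (ind_ne_zero hm) hy0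
    rw [ind_of_mem hm, norm_one, Real.log_one, mul_zero, sub_zero] at this
    rw [hc0, ← this]
    exact (hκ.trans_le (le_aFun κ _ m _)).ne'
  · simp only [invA, if_neg hm]
    refine hε.div ((hε.mul hb).add contDiffAt_const) ?_
    rw [hε0]
    have := hν m hm
    simp [this.ne']

end Smooth

/-- The approximate metrics in the toric gauge, extended smoothly to `t = 0`. -/
def gExt (κ : ℝ) (𝒮 : Finset (Finset Δ)) (S : Finset Δ) (ν : Δ → ℝ) (c : Δ → ℂ) (ε : ℝ)
    (y a b : Fin l → ℂ) : ℝ :=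
  fubiniStudy (mon c y) (dmon c y a) (dmon c y b)
    + ddbar (fun y => Real.log (hExt κ 𝒮 S ν c ε y)) y a b

lemma gExt_coef {κ : ℝ} (𝒮 : Finset (Finset Δ)) {S : Finset Δ} {ν : Δ → ℝ}
    (hν : ∀ m ∈ S, ν m = 0) {r : ℝ} (hr : r ∈ Ioo (0 : ℝ) 1) (θ : ℝ) {y : Fin l → ℂ}
    (hy : y ∈ torus l) (a b : Fin l → ℂ) :
    gExt κ 𝒮 S ν (coef ν r θ) (-(Real.log r)⁻¹) y a b = gGen κ 𝒮 (coef ν r θ) y a b := by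
  rw [gExt, gGen, fderiv_mon _ hy, fderiv_mon _ hy]
  congr 1
  refine ddbar_congr ?_ a b
  filter_upwards [torus_mem_nhds hy] with z hz
  rw [hExt_coef 𝒮 hν hr θ hz]

lemma gExt_ind {w : Δ → ℝ} {κ : ℝ} {S : Finset Δ} (hS : S ∈ Ztop w) (ν : Δ → ℝ)
    {y : Fin l → ℂ} (hy : y ∈ torus l) (a b : Fin l → ℂ) :
    gExt κ (Ztop w) S ν (ind S) 0 y a b = gZero κ S y a b := by
  rw [gZero_eq, gExt, gGen, fderiv_mon _ hy, fderiv_mon _ hy]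
  congr 1
  refine ddbar_congr ?_ a b
  filter_upwards [torus_mem_nhds hy] with z hz
  rw [hExt_ind hS ν hz]

lemma contDiffAt_gExt {Q : Type*} [NormedAddCommGroup Q] [NormedSpace ℝ Q] {q₀ : Q}
    {w : Δ → ℝ} {κ : ℝ} (hκ : 0 < κ) {S : Finset Δ} (hS : S ∈ Ztop w) {ν : Δ → ℝ}
    (hν : ∀ m ∉ S, 0 < ν m) {c : Q → Δ → ℂ} {ε : Q → ℝ} {y a b : Q → Fin l → ℂ}
    (hc : ContDiffAt ℝ ∞ c q₀) (hε : ContDiffAt ℝ ∞ ε q₀) (hy : ContDiffAt ℝ ∞ y q₀)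
    (ha : ContDiffAt ℝ ∞ a q₀) (hb : ContDiffAt ℝ ∞ b q₀) (hy0 : y q₀ ∈ torus l)
    (hc0 : c q₀ = ind S) (hε0 : ε q₀ = 0) :
    ContDiffAt ℝ ∞ (fun q => gExt κ (Ztop w) S ν (c q) (ε q) (y q) (a q) (b q)) q₀ := by
  obtain ⟨m₀, hm₀⟩ := nonempty_of_mem_Ztop hS
  refine (contDiffAt_fubiniStudy (contDiffAt_mon hc hy hy0) (contDiffAt_dmon hc hy ha hy0)
    (contDiffAt_dmon hc hy hb hy0) (exists_mon_ne_zero hy0 (m := m₀)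
      (by rw [hc0]; exact ind_ne_zero hm₀))).add ?_
  refine contDiffAt_ddbar (f := fun q y => Real.log (hExt κ (Ztop w) S ν (c q) (ε q) y))
    ?_ hy ha hb
  refine ContDiffAt.log (f := fun z : Q × (Fin l → ℂ) =>
    hExt κ (Ztop w) S ν (c z.1) (ε z.1) z.2) ?_ ?_
  · exact contDiffAt_hExt (c := fun z : Q × (Fin l → ℂ) => c z.1)
      (ε := fun z : Q × (Fin l → ℂ) => ε z.1) (y := fun z : Q × (Fin l → ℂ) => z.2) hκ _
      ⟨m₀, hm₀⟩ hν (ContDiffAt.comp (g := c) (q₀, y q₀) hc contDiffAt_fst)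
      (ContDiffAt.comp (g := ε) (q₀, y q₀) hε contDiffAt_fst) contDiffAt_snd hy0 hc0 hε0
  · simp only [hc0, hε0]
    rw [hExt_ind hS ν hy0]
    exact (hGen_pos hκ (Finset.singleton_nonempty S) _ _).ne'

end

/-! ### Convergence of the pullbacks -/

section

variable {l : ℕ} {Δ : Finset (Fin l → ℤ)}

lemma tendsto_neg_inv_log : Tendsto (fun r : ℝ => -(Real.log r)⁻¹) (𝓝[>] 0) (𝓝 0) := by
  have h1 := (Real.tendsto_log_nhdsGT_zero.inv_tendsto_atBot).neg
  rw [neg_zero] at h1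
  exact h1

lemma LocalSolution.contDiffAt_Y_one {S : Finset Δ} {x₀ : Fin l → ℂ} (L : LocalSolution S x₀)
    {Q : Type*} [NormedAddCommGroup Q] [NormedSpace ℝ Q] {q₀ : Q} {x : Q → Fin l → ℂ}
    {b : Q → CoefPath Δ} (hx : ContDiffAt ℝ ∞ x q₀) (hb : ContDiffAt ℝ ∞ b q₀)
    (hx0 : x q₀ ∈ Metric.ball x₀ L.δ) (hb0 : b q₀ ∈ Metric.ball (basePath S) L.δ) :
    ContDiffAt ℝ ∞ (fun q => L.Y (x q, b q) 1) q₀ :=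
  (evalOne (l := l)).contDiff.contDiffAt.comp q₀
    (ContDiffAt.comp (g := L.Y) q₀ (L.smooth _ hx0 _ hb0) (hx.prodMk hb))

/-- In a local parametrization, the pullbacks of the approximate metrics under the flow converge
with
all derivatives, uniformly on compact sets. -/
theorem tendstoUniformlyOn_pullback {w : Δ → ℝ} {κ : ℝ} (hκ : 0 < κ) {S : Finset Δ}
    (hS : S ∈ Ztop w) {u : Fin l → ℝ} {k : ℝ} {N : ℕ} (h : Exponents S (excess w u k) N)
    {V : Set (Fin (l - 1) → ℂ)} {φ : (Fin (l - 1) → ℂ) → (Fin l → ℂ)}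
    (hφ : IsLocalParam (pants S) V φ) {K : Set (Fin (l - 1) → ℂ)} (hKV : K ⊆ V) (hK : IsCompact K)
    {ψ : ℝ × ℝ → (Fin l → ℂ) → (Fin l → ℂ)}
    (hψ : ∀ x ∈ φ '' K, ∃ (x₀ : Fin l → ℂ) (L : LocalSolution S x₀), x ∈ Metric.ball x₀ L.δ ∧
      ∃ ρ > 0, ∀ᶠ y in 𝓝 x, y ∈ pants S → ∀ τ : ℝ × ℝ, τ.1 ∈ Ioo 0 ρ →
        ψ τ y = gauge (-u) τ.1 τ.2 (L.flow h τ.1 τ.2 y))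
    (j : ℕ) (a b : Fin (l - 1) → ℂ) :
    TendstoUniformlyOn
      (fun τ p => iteratedFDeriv ℝ j (pullback (gApprox w κ τ.1 τ.2) (ψ τ ∘ φ) a b) p)
      (fun p => iteratedFDeriv ℝ j (pullback (gZero κ S) φ a b) p)
      ((𝓝[>] (0 : ℝ)) ×ˢ (⊤ : Filter ℝ)) K := by
  set ν := excess w u k with hν
  -- The dependence on `t` itself is not smooth at `0`; it passes through this parameter in a Banach
  -- space, which need only converge.
  let p : ℝ × ℝ → CoefPath Δ × ℝ := fun τ => (coefPath h τ.1 τ.2, -(Real.log τ.1)⁻¹)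
  have hp : Tendsto p ((𝓝[>] (0 : ℝ)) ×ˢ (⊤ : Filter ℝ)) (𝓝 (basePath S, 0)) :=
    (tendsto_coefPath h).prodMk_nhds (tendsto_neg_inv_log.comp tendsto_fst)
  refine tendstoUniformlyOn_iteratedFDeriv hp hK (fun q₀ hq₀ => ?_) j
  obtain ⟨x₀, L, hx, ρ, hρ, hev⟩ := hψ (φ q₀) ⟨q₀, hq₀, rfl⟩
  have hVn : ∀ q ∈ V, V ∈ 𝓝 q := fun q hq => hφ.isOpen.mem_nhds hq
  have hφs : ∀ q ∈ V, ContDiffAt ℝ ∞ φ q := fun q hq => hφ.smooth.contDiffAt (hVn q hq)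
  have hV₀ : ∀ᶠ q in 𝓝 q₀, q ∈ V := hVn q₀ (hKV hq₀)
  have hnear : ∀ᶠ q in 𝓝 q₀, q ∈ V ∧ φ q ∈ Metric.ball x₀ L.δ :=
    hV₀.and
      ((hφs q₀ (hKV hq₀)).continuousAt.eventually_mem (Metric.isOpen_ball.mem_nhds hx))
  have hbase : basePath S ∈ Metric.ball (basePath S) L.δ := Metric.mem_ball_self L.δ_pos
  let Y₁ : CoefPath Δ → (Fin (l - 1) → ℂ) → (Fin l → ℂ) := fun b q => L.Y (φ q, b) 1
  have hY₁ : ∀ᶠ q in 𝓝 q₀, Y₁ (basePath S) q = φ q := hnear.mono fun q hq => by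
    simp only [Y₁]
    rw [LocalSolution.Y_basePath hq.2]
    rfl
  -- A component of the pulled back metric in the toric gauge, as a smooth function of the chart
  -- point, the path of coefficients and `ε`. The end point of the path supplies the coefficients of
  -- the metric.
  let 𝒢 : (Fin (l - 1) → ℂ) × CoefPath Δ × ℝ → ℝ := fun z =>
    gExt κ (Ztop w) S ν (z.2.1 1).1 z.2.2 (Y₁ z.2.1 z.1) (fderiv ℝ (Y₁ z.2.1) z.1 a)
      (fderiv ℝ (Y₁ z.2.1) z.1 b)
  refine ⟨𝒢, ?_, ?_, ?_⟩
  · have hb1 : ContDiffAt ℝ ∞ (fun z : (Fin (l - 1) → ℂ) × CoefPath Δ × ℝ => z.2.1)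
        (q₀, basePath S, (0 : ℝ)) := contDiffAt_fst.comp _ contDiffAt_snd
    have hc : ContDiffAt ℝ ∞ (fun z : (Fin (l - 1) → ℂ) × CoefPath Δ × ℝ => (z.2.1 1).1)
        (q₀, basePath S, (0 : ℝ)) :=
      contDiffAt_fst.comp _ ((ContinuousMap.evalCLM ℝ (1 : unitInterval) :
        CoefPath Δ →L[ℝ] (Δ → ℂ) × (Δ → ℂ)).contDiff.contDiffAt.comp _ hb1)
    have hd : ∀ v, ContDiffAt ℝ ∞ (fun z : (Fin (l - 1) → ℂ) × CoefPath Δ × ℝ =>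
        fderiv ℝ (Y₁ z.2.1) z.1 v) (q₀, basePath S, (0 : ℝ)) := fun v => by
      refine ContDiffAt.clm_apply (ContDiffAt.fderiv
        (f := fun (z : (Fin (l - 1) → ℂ) × CoefPath Δ × ℝ) q => Y₁ z.2.1 q) (g := Prod.fst)
        (n := ∞) ?_ contDiffAt_fst le_rfl) contDiffAt_const
      exact L.contDiffAt_Y_one (x := fun y :
          ((Fin (l - 1) → ℂ) × CoefPath Δ × ℝ) × (Fin (l - 1) → ℂ) => φ y.2)
        (b := fun y : ((Fin (l - 1) → ℂ) × CoefPath Δ × ℝ) × (Fin (l - 1) → ℂ) => y.1.2.1)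
        (ContDiffAt.comp (g := φ) (f := Prod.snd) ((q₀, basePath S, (0 : ℝ)), q₀)
          (hφs q₀ (hKV hq₀)) contDiffAt_snd)
        (ContDiffAt.comp (g := fun z : (Fin (l - 1) → ℂ) × CoefPath Δ × ℝ => z.2.1)
          (f := Prod.fst) ((q₀, basePath S, (0 : ℝ)), q₀) hb1 contDiffAt_fst) hx hbase
    have hy : ContDiffAt ℝ ∞ (fun z : (Fin (l - 1) → ℂ) × CoefPath Δ × ℝ => Y₁ z.2.1 z.1)
        (q₀, basePath S, (0 : ℝ)) :=
      L.contDiffAt_Y_one (ContDiffAt.comp (g := φ) (q₀, basePath S, (0 : ℝ)) (hφs q₀ (hKV hq₀))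
        contDiffAt_fst) hb1 hx hbase
    refine contDiffAt_gExt hκ hS h.pos hc (contDiffAt_snd.comp _ contDiffAt_snd) hy (hd a) (hd b)
      ?_ rfl rfl
    simp only
    rw [hY₁.self_of_nhds]
    exact (hφ.maps (hKV hq₀)).1
  · filter_upwards [hY₁.eventually_nhds, hnear] with q hq hq'
    have e : Y₁ (basePath S) =ᶠ[𝓝 q] φ := hq
    simp only [𝒢, pullback]
    rw [e.fderiv_eq, e.eq_of_nhds]
    exact (gExt_ind hS ν (hφ.maps hq'.1).1 _ _).symm
  · have hτ : ∀ᶠ τ in (𝓝[>] (0 : ℝ)) ×ˢ (⊤ : Filter ℝ),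
        τ.1 ∈ Ioo 0 (min ρ 1) ∧ coefPath h τ.1 τ.2 ∈ Metric.ball (basePath S) L.δ := by
      refine Filter.Eventually.and ?_ ((tendsto_coefPath h).eventually
        (Metric.ball_mem_nhds _ L.δ_pos))
      exact tendsto_fst.eventually (Ioo_mem_nhdsGT (lt_min hρ one_pos))
    have hq : ∀ᶠ q in 𝓝 q₀, ∀ᶠ q' in 𝓝 q, (q' ∈ V ∧ φ q' ∈ Metric.ball x₀ L.δ) ∧
        (φ q' ∈ pants S → ∀ τ : ℝ × ℝ, τ.1 ∈ Ioo 0 ρ →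
          ψ τ (φ q') = gauge (-u) τ.1 τ.2 (L.flow h τ.1 τ.2 (φ q'))) :=
      (hnear.and ((hφs q₀ (hKV hq₀)).continuousAt.eventually hev)).eventually_nhds
    filter_upwards [hτ.prod_mk hq] with z hz
    obtain ⟨⟨hz1, hz2⟩, hz3⟩ := hz
    obtain ⟨τ, q⟩ := z
    simp only at hz1 hz2 hz3 ⊢
    obtain ⟨⟨hqV, hqb⟩, -⟩ := hz3.self_of_nhds
    set bp := coefPath h τ.1 τ.2 with hbp
    have hr0 : 0 < τ.1 := hz1.1
    have e : ψ τ ∘ φ =ᶠ[𝓝 q] fun q' => gaugeCLM (-u) τ.1 τ.2 (Y₁ bp q') := by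
      filter_upwards [hz3] with q' hq'
      exact hq'.2 (hφ.maps hq'.1.1) τ ⟨hr0, hz1.2.trans_le (min_le_left _ _)⟩
    have hYd : DifferentiableAt ℝ (Y₁ bp) q :=
      (L.contDiffAt_Y_one (hφs q hqV) contDiffAt_const hqb hz2).differentiableAt (by simp)
    have hfd : ∀ v, fderiv ℝ (ψ τ ∘ φ) q v =
        gauge (-u) τ.1 τ.2 (fderiv ℝ (Y₁ bp) q v) := fun v => by
      have hcomp : HasFDerivAt (fun q' => gaugeCLM (-u) τ.1 τ.2 (Y₁ bp q'))
          (((gaugeCLM (-u) τ.1 τ.2).restrictScalars ℝ).comp (fderiv ℝ (Y₁ bp) q)) q :=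
        HasFDerivAt.comp q
          ((gaugeCLM (-u) τ.1 τ.2).restrictScalars ℝ).hasFDerivAt hYd.hasFDerivAt
      rw [e.fderiv_eq, hcomp.fderiv]
      rfl
    have hgood : Good (Y₁ bp q) (bp 1).1 :=
      L.good _ (Metric.mem_ball.2 ((LocalSolution.mem_ball_apply hqb hz2 1).trans
        (half_lt_self L.ε_pos))) _ (LocalSolution.coefPath_mem_ball hz2 1)
    simp only [𝒢, pullback, p]
    rw [hfd, hfd, e.eq_of_nhds, gaugeCLM_apply, gApprox_gauge w hκ u k hr0 τ.2 hgood.1, ← hbp,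
      hbp, coefPath_one]
    exact (gExt_coef (Ztop w) h.zero ⟨hr0, hz1.2.trans_le (min_le_right _ _)⟩ τ.2 hgood.1 _ _).symm

end

/-! ### The flow near compact sets -/

section

variable {l : ℕ} {Δ : Finset (Fin l → ℤ)}

namespace LocalSolution

variable {S : Finset Δ} {ν : Δ → ℝ} {N : ℕ} {x₀ : Fin l → ℂ} {L : LocalSolution S x₀}
  {h : Exponents S ν N}

lemma Small.mono {ρ ρ' : ℝ} (hρ : L.Small h ρ) (hle : ρ' ≤ ρ) : L.Small h ρ' :=
  fun r hr => hρ r ⟨hr.1, hr.2.trans_le hle⟩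

lemma eventually_small (L : LocalSolution S x₀) (h : Exponents S ν N) :
    ∀ᶠ ρ in 𝓝[>] (0 : ℝ), L.Small h ρ := by
  obtain ⟨ρ, hρ, hs⟩ := L.exists_small h
  filter_upwards [Ioo_mem_nhdsGT hρ] with ρ' hρ'
  exact hs.mono hρ'.2.le

lemma contDiffAt_flow {ρ : ℝ} (hρ : L.Small h ρ) {x : Fin l → ℂ} (hx : x ∈ Metric.ball x₀ L.δ)
    {r : ℝ} (hr : r ∈ Ioo 0 ρ) (θ : ℝ) : ContDiffAt ℝ ∞ (L.flow h r θ) x :=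
  L.contDiffAt_Y_one contDiffAt_id contDiffAt_const hx (hρ r hr θ)

/-- A linear map within `1 / 2` of the identity has no kernel. -/
lemma injective_fderiv_flow {ρ : ℝ} (hρ : L.Small h ρ) {x : Fin l → ℂ}
    (hx : x ∈ Metric.ball x₀ L.δ) {r : ℝ} (hr : r ∈ Ioo 0 ρ) (θ : ℝ) :
    Function.Injective (fderiv ℝ (L.flow h r θ) x) := by
  rw [injective_iff_map_eq_zero]
  intro v hv
  have h1 := (fderiv ℝ (L.flow h r θ) x - ContinuousLinearMap.id ℝ _).le_of_opNorm_le
    (L.fderiv_near x hx _ (hρ r hr θ)) v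
  rw [_root_.sub_apply, hv, zero_sub, norm_neg, ContinuousLinearMap.id_apply] at h1
  exact norm_le_zero_iff.1 (by linarith)

/-- On the convex ball the flow minus the identity has Lipschitz constant `1 / 2`, so two points
with the same image coincide. -/
lemma injOn_flow {ρ : ℝ} (hρ : L.Small h ρ) {r : ℝ} (hr : r ∈ Ioo 0 ρ) (θ : ℝ) :
    InjOn (L.flow h r θ) (Metric.ball x₀ L.δ) := by
  intro x hx x' hx' he
  have hd : ∀ z ∈ Metric.ball x₀ L.δ, DifferentiableAt ℝ (L.flow h r θ) z := fun z hz =>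
    (contDiffAt_flow hρ hz hr θ).differentiableAt (by simp)
  have h1 := (convex_ball x₀ L.δ).norm_image_sub_le_of_norm_hasFDerivWithin_le
    (f := fun z => L.flow h r θ z - z)
    (f' := fun z => fderiv ℝ (L.flow h r θ) z - ContinuousLinearMap.id ℝ _) (C := 1 / 2)
    (fun z hz => ((hd z hz).hasFDerivAt.sub (hasFDerivAt_id z)).hasFDerivWithinAt)
    (fun z hz => L.fderiv_near z hz _ (hρ r hr θ)) hx' hx
  rw [he] at h1
  have h2 : L.flow h r θ x' - x - (L.flow h r θ x' - x') = -(x - x') := by abel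
  rw [h2, norm_neg] at h1
  exact sub_eq_zero.1 (norm_le_zero_iff.1 (by linarith))

/-- For small `t` the flow is close to the identity, uniformly on compact subsets of the domain. -/
lemma eventually_dist_flow_lt (L : LocalSolution S x₀) (h : Exponents S ν N) {η : ℝ} (hη : 0 < η) :
    ∀ᶠ ρ in 𝓝[>] (0 : ℝ), ∀ r ∈ Ioo 0 ρ, ∀ θ, ∀ x ∈ Metric.closedBall x₀ (L.δ / 2),
      dist (L.flow h r θ x) x < η := by
  have h1 : ∀ᶠ b in 𝓝 (basePath S), ∀ x ∈ Metric.closedBall x₀ (L.δ / 2),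
      dist (L.Y (x, b) 1) x < η := by
    refine IsCompact.eventually_forall_of_forall_eventually (isCompact_closedBall x₀ (L.δ / 2))
      fun x hx => ?_
    have hx' : x ∈ Metric.ball x₀ L.δ :=
      Metric.closedBall_subset_ball (half_lt_self L.δ_pos) hx
    have h2 : ContDiffAt ℝ ∞ (fun z : CoefPath Δ × (Fin l → ℂ) => L.Y (z.2, z.1) 1)
        (basePath S, x) :=
      L.contDiffAt_Y_one contDiffAt_snd contDiffAt_fst hx' (Metric.mem_ball_self L.δ_pos)
    have h3 : Tendsto (fun z : CoefPath Δ × (Fin l → ℂ) => dist (L.Y (z.2, z.1) 1) z.2)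
        (𝓝 (basePath S, x)) (𝓝 (dist (L.Y (x, basePath S) 1) x)) :=
      h2.continuousAt.dist continuousAt_snd
    rw [Y_basePath hx'] at h3
    have h4 : dist ((constCLM x : C(unitInterval, Fin l → ℂ)) 1) x = 0 := dist_self x
    rw [h4] at h3
    exact h3.eventually (gt_mem_nhds hη)
  have h2 := (tendsto_coefPath h).eventually h1
  rw [eventually_prod_iff] at h2
  obtain ⟨p, hp, q, hq, hpq⟩ := h2
  rw [eventually_top] at hq
  obtain ⟨ρ, hρ, hρ'⟩ := mem_nhdsGT_iff_exists_Ioo_subset.1 hp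
  filter_upwards [Ioo_mem_nhdsGT hρ] with ρ' hρ'' r hr θ
  exact hpq (hρ' ⟨hr.1, hr.2.trans hρ''.2⟩) (hq θ)

end LocalSolution

/-- The flow exists in the toric gauge near a compact part of a generalized pair of pants. -/
theorem exists_flow_near {w : Δ → ℝ} (hw : IsSimplicialWeight w) {S : Finset Δ} (hS : S ∈ Ztop w)
    {ν : Δ → ℝ} {N : ℕ} (h : Exponents S ν N) {F : Set (Fin l → ℂ)} (hF : IsCompact F)
    (hFp : F ⊆ pants S) :
    ∃ (U C : Set (Fin l → ℂ)) (Ψ : ℝ → ℝ → (Fin l → ℂ) → (Fin l → ℂ)), IsOpen U ∧ F ⊆ U ∧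
      IsCompact C ∧ C ⊆ torus l ∧ ∀ᶠ ρ in 𝓝[>] (0 : ℝ),
        (∀ x ∈ U, ∃ (x₀ : Fin l → ℂ) (L : LocalSolution S x₀),
          x ∈ Metric.ball x₀ (L.δ / 2) ∧ L.Small h ρ ∧
          ∀ y ∈ Metric.ball x₀ (L.δ / 2) ∩ (U ∩ pants S), ∀ r ∈ Ioo 0 ρ, ∀ θ,
            Ψ r θ y = L.flow h r θ y) ∧
        ∀ r ∈ Ioo 0 ρ, ∀ θ, MapsTo (Ψ r θ) (U ∩ pants S) C ∧ InjOn (Ψ r θ) (U ∩ pants S) := by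
  classical
  have hL : ∀ x : F, Nonempty (LocalSolution S (x : Fin l → ℂ)) := fun x =>
    exists_localSolution (good_ind hw hS (hFp x.2))
  let L : ∀ x : F, LocalSolution S (x : Fin l → ℂ) := fun x => (hL x).some
  -- The cover uses `δ / 4` while uniqueness holds on `δ / 2`; the margin makes overlapping local
  -- flows comparable and serves for global injectivity.
  obtain ⟨t, ht⟩ := hF.elim_nhds_subcover' (fun x hx => Metric.ball x ((L ⟨x, hx⟩).δ / 4))
    fun x hx => Metric.ball_mem_nhds _ (by have := (L ⟨x, hx⟩).δ_pos; positivity)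
  let U : Set (Fin l → ℂ) := ⋃ i ∈ t, Metric.ball (i : Fin l → ℂ) ((L i).δ / 4)
  have hU : ∀ x ∈ U, ∃ i ∈ t, x ∈ Metric.ball (i : Fin l → ℂ) ((L i).δ / 4) := fun x hx => by
    simpa [U] using hx
  let Ψ : ℝ → ℝ → (Fin l → ℂ) → (Fin l → ℂ) := fun r θ x =>
    if hx : x ∈ U then (L (hU x hx).choose).flow h r θ x else x
  let C : Set (Fin l → ℂ) := ⋃ i ∈ t, Metric.closedBall (i : Fin l → ℂ) ((L i).ε / 2)
  refine ⟨U, C, Ψ, isOpen_biUnion fun i _ => Metric.isOpen_ball, ht,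
    t.finite_toSet.isCompact_biUnion fun i _ => isCompact_closedBall _ _, ?_, ?_⟩
  · refine iUnion₂_subset fun i _ x hx => ?_
    exact ((L i).good x (Metric.closedBall_subset_ball (half_lt_self (L i).ε_pos) hx)
      (ind S, 0) (Metric.mem_ball_self (L i).ε_pos)).1
  have hquarter : ∀ i : F, Metric.ball (i : Fin l → ℂ) ((L i).δ / 4) ⊆
      Metric.ball (i : Fin l → ℂ) ((L i).δ / 2) := fun i =>
    Metric.ball_subset_ball (by have := (L i).δ_pos; linarith)
  have hhalf : ∀ i : F, Metric.ball (i : Fin l → ℂ) ((L i).δ / 2) ⊆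
      Metric.ball (i : Fin l → ℂ) (L i).δ := fun i =>
    Metric.ball_subset_ball (half_le_self (L i).δ_pos.le)
  -- If two points have the same image and each is moved by less than `η / 2`, they are closer than
  -- every `δ / 4`. Both then lie in the `δ / 2` ball of one local solution, whose flow is
  -- injective.
  obtain ⟨η, hη, hη0⟩ : ∃ η, (∀ i ∈ t, η < (L i).δ / 4) ∧ (0 : ℝ) < η :=
    (((t.eventually_all).2 fun i _ => (Ioo_mem_nhdsGT
      (by have := (L i).δ_pos; positivity : 0 < (L i).δ / 4) : ∀ᶠ η in 𝓝[>] (0 : ℝ),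
        η ∈ Ioo 0 ((L i).δ / 4))).mono fun η hη i hi => (hη i hi).2).and
        self_mem_nhdsWithin |>.exists
  have hsm : ∀ᶠ ρ in 𝓝[>] (0 : ℝ), ∀ i ∈ t, (L i).Small h ρ ∧ ∀ r ∈ Ioo 0 ρ, ∀ θ,
      ∀ x ∈ Metric.closedBall (i : Fin l → ℂ) ((L i).δ / 2), dist ((L i).flow h r θ x) x < η / 2 :=
    (t.eventually_all).2 fun i _ => ((L i).eventually_small h).and
      ((L i).eventually_dist_flow_lt h (half_pos hη0))
  filter_upwards [hsm] with ρ hρ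
  have hΨ : ∀ x ∈ U, ∃ i ∈ t, x ∈ Metric.ball (i : Fin l → ℂ) ((L i).δ / 4) ∧
      ∀ r θ, Ψ r θ x = (L i).flow h r θ x := fun x hx => by
    refine ⟨_, (hU x hx).choose_spec.1, (hU x hx).choose_spec.2, fun r θ => ?_⟩
    simp only [Ψ, dif_pos hx]
  have hagree : ∀ i ∈ t, ∀ y ∈ Metric.ball (i : Fin l → ℂ) ((L i).δ / 2) ∩ (U ∩ pants S),
      ∀ r ∈ Ioo 0 ρ, ∀ θ, Ψ r θ y = (L i).flow h r θ y := by
    intro i hi y hy r hr θ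
    obtain ⟨j, hj, hyj, hjΨ⟩ := hΨ y hy.2.1
    have hyj' := hhalf j (hquarter j hyj)
    rw [hjΨ]
    exact LocalSolution.eq_flow (hρ i hi).1 hy.1
      (LocalSolution.isGaugeFlow_flow (hρ j hj).1 hyj' hy.2.2 θ)
      (LocalSolution.tendsto_flow hyj' θ) hr
  refine ⟨fun x hx => ?_, fun r hr θ => ⟨fun x hx => ?_, fun x hx x' hx' he => ?_⟩⟩
  · obtain ⟨i, hi, hxi, -⟩ := hΨ x hx
    exact ⟨i, L i, hquarter i hxi, (hρ i hi).1, hagree i hi⟩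
  · obtain ⟨i, hi, hxi, hiΨ⟩ := hΨ x hx.1
    rw [hiΨ]
    exact mem_biUnion hi (Metric.mem_closedBall.2 (LocalSolution.mem_ball_apply
      (hhalf i (hquarter i hxi)) ((hρ i hi).1 r hr θ) 1).le)
  · obtain ⟨i, hi, hxi, hiΨ⟩ := hΨ x hx.1
    obtain ⟨j, hj, hxj, hjΨ⟩ := hΨ x' hx'.1
    have d1 := (hρ i hi).2 r hr θ x (Metric.ball_subset_closedBall (hquarter i hxi))
    have d2 := (hρ j hj).2 r hr θ x' (Metric.ball_subset_closedBall (hquarter j hxj))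
    rw [← hiΨ] at d1
    rw [← hjΨ, ← he] at d2
    have d3 : dist x' x < η := by
      calc dist x' x ≤ dist x' (Ψ r θ x) + dist (Ψ r θ x) x := dist_triangle _ _ _
        _ < η / 2 + η / 2 := add_lt_add (by rwa [dist_comm]) d1
        _ = η := add_halves η
    have hx'i : x' ∈ Metric.ball (i : Fin l → ℂ) ((L i).δ / 2) := by
      have := hη i hi
      have h2 := Metric.mem_ball.1 hxi
      have := dist_triangle x' x i
      exact Metric.mem_ball.2 (by linarith)
    rw [hiΨ, hagree i hi x' ⟨hx'i, hx'⟩ r hr θ] at he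
    exact LocalSolution.injOn_flow (hρ i hi).1 hr θ (hhalf i (hquarter i hxi)) (hhalf i hx'i) he

end

/-! ### Properties of the flow -/

section

variable {l : ℕ} {Δ : Finset (Fin l → ℤ)}

/-- Two supporting functions of equal slope, each touching `w` somewhere, have the same constant,
hence the same contact set. -/
lemma Supports.slope_injective {w : Δ → ℝ} {S S' : Finset Δ} (hne : S.Nonempty)
    (hne' : S'.Nonempty) {u : Fin l → ℝ} {k k' : ℝ} (h : Supports w S u k)
    (h' : Supports w S' u k') : S = S' := by
  obtain ⟨m, hm⟩ := hne
  obtain ⟨m', hm'⟩ := hne'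
  have h1 := (h.2 m).1 hm
  have h2 := h'.1 m
  have h3 := (h'.2 m').1 hm'
  have h4 := h.1 m'
  simp only [affineFn] at h1 h2 h3 h4
  have hk : k = k' := by linarith
  subst hk
  ext m''
  rw [h.2, h'.2]

lemma exists_bound_log_norm {C : Set (Fin l → ℂ)} (hC : IsCompact C) (hCt : C ⊆ torus l)
    (i : Fin l) : ∃ B, ∀ y ∈ C, |Real.log ‖y i‖| ≤ B := by
  have hc : ContinuousOn (fun y : Fin l → ℂ => Real.log ‖y i‖) C :=
    ContinuousOn.log (by fun_prop) fun y hy => norm_ne_zero_iff.2 (hCt hy i)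
  exact hC.exists_bound_of_continuousOn hc

/-- Toric translations with different slopes separate compact subsets of the torus. -/
lemma eventually_gauge_ne {C C' : Set (Fin l → ℂ)} (hC : IsCompact C) (hCt : C ⊆ torus l)
    (hC' : IsCompact C') (hCt' : C' ⊆ torus l) {u u' : Fin l → ℝ} (hne : u ≠ u') :
    ∀ᶠ ρ in 𝓝[>] (0 : ℝ), ∀ r ∈ Ioo 0 ρ, ∀ θ, ∀ y ∈ C, ∀ y' ∈ C',
      gauge (-u) r θ y ≠ gauge (-u') r θ y' := by
  obtain ⟨i, hi⟩ := Function.ne_iff.1 hne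
  obtain ⟨B, hB⟩ := exists_bound_log_norm hC hCt i
  obtain ⟨B', hB'⟩ := exists_bound_log_norm hC' hCt' i
  have hpos : 0 < |u i - u' i| := abs_pos.2 (sub_ne_zero.2 hi)
  have hlog : ∀ᶠ r in 𝓝[>] (0 : ℝ), Real.log r < -((B + B') / |u i - u' i|) :=
    Real.tendsto_log_nhdsGT_zero.eventually_lt_atBot _
  obtain ⟨ρ, hρ, hρ'⟩ := mem_nhdsGT_iff_exists_Ioo_subset.1 hlog
  filter_upwards [Ioo_mem_nhdsGT hρ] with ρ' hρ'' r hr θ y hy y' hy' he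
  have hlt : Real.log r < -((B + B') / |u i - u' i|) := hρ' ⟨hr.1, hr.2.trans hρ''.2⟩
  have h1 := congrArg (fun z : Fin l → ℂ => Real.log ‖z i‖) he
  simp only [gauge, norm_mul, norm_tpow hr.1.le, Pi.neg_apply] at h1
  rw [Real.log_mul (Real.rpow_pos_of_pos hr.1 _).ne' (norm_ne_zero_iff.2 (hCt hy i)),
    Real.log_mul (Real.rpow_pos_of_pos hr.1 _).ne' (norm_ne_zero_iff.2 (hCt' hy' i)),
    Real.log_rpow hr.1, Real.log_rpow hr.1] at h1
  -- The right side is bounded on the compact sets, while the left side is unbounded as `r → 0`; the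
  -- phases play no role.
  have h2 : (u i - u' i) * Real.log r = Real.log ‖y i‖ - Real.log ‖y' i‖ := by linarith
  have h3 : |u i - u' i| * |Real.log r| ≤ B + B' := by
    rw [← abs_mul, h2]
    exact (abs_sub _ _).trans (add_le_add (hB y hy) (hB' y' hy'))
  have h4 : (B + B') / |u i - u' i| < |Real.log r| := by
    linarith [neg_abs_le (Real.log r)]
  rw [div_lt_iff₀ hpos] at h4
  linarith

variable {w : Δ → ℝ} {S : Finset Δ} {u : Fin l → ℝ} {k : ℝ} {N : ℕ}
  {h : Exponents S (excess w u k) N} {U : Set (Fin l → ℂ)}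
  {Ψ : ℝ → ℝ → (Fin l → ℂ) → (Fin l → ℂ)} {ρ : ℝ}

/-- On `U`, the map `Ψ` is locally given by local solutions of the flow equation in the toric
gauge. -/
def IsLocalFlow (h : Exponents S (excess w u k) N) (U : Set (Fin l → ℂ)) (ρ : ℝ)
    (Ψ : ℝ → ℝ → (Fin l → ℂ) → (Fin l → ℂ)) : Prop :=
  ∀ x ∈ U, ∃ (x₀ : Fin l → ℂ) (L : LocalSolution S x₀),
    x ∈ Metric.ball x₀ (L.δ / 2) ∧ L.Small h ρ ∧
    ∀ y ∈ Metric.ball x₀ (L.δ / 2) ∩ (U ∩ pants S), ∀ r ∈ Ioo 0 ρ, ∀ θ, Ψ r θ y = L.flow h r θ y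

lemma LocalSolution.half_ball_subset {x₀ : Fin l → ℂ} (L : LocalSolution S x₀) :
    Metric.ball x₀ (L.δ / 2) ⊆ Metric.ball x₀ L.δ :=
  Metric.ball_subset_ball (half_le_self L.δ_pos.le)

namespace IsLocalFlow

lemma isFlowLine (hΨ : IsLocalFlow h U ρ Ψ) (hw : IsSimplicialWeight w) (hS : S ∈ Ztop w)
    (hu : Supports w S u k) {x : Fin l → ℂ} (hx : x ∈ U ∩ pants S) (hρ : 0 < ρ) (θ : ℝ) :
    IsFlowLine w S θ ρ x (fun r => gauge (-u) r θ (Ψ r θ x)) := by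
  obtain ⟨x₀, L, h1, h2, h3⟩ := hΨ x hx.1
  have hx' := L.half_ball_subset h1
  have heq : ∀ r ∈ Ioo 0 ρ, Ψ r θ x = L.flow h r θ x := fun r hr => h3 x ⟨h1, hx⟩ r hr θ
  have hev : ∀ r ∈ Ioo 0 ρ, (fun r => Ψ r θ x) =ᶠ[𝓝 r] fun r => L.flow h r θ x := fun r hr => by
    filter_upwards [Ioo_mem_nhds hr.1 hr.2] with r' hr' using heq r' hr'
  have hev' : ∀ r ∈ Ioo 0 ρ, (fun r => gauge u r θ (gauge (-u) r θ (Ψ r θ x))) =ᶠ[𝓝 r]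
      fun r => L.flow h r θ x := fun r hr => by
    filter_upwards [Ioo_mem_nhds hr.1 hr.2] with r' hr'
    rw [gauge_gauge_neg u hr'.1, heq r' hr']
  have ht : Tendsto (fun r => gauge u r θ (gauge (-u) r θ (Ψ r θ x))) (𝓝[>] 0) (𝓝 x) := by
    refine (LocalSolution.tendsto_flow (h := h) hx' θ).congr' ?_
    filter_upwards [Ioo_mem_nhdsGT hρ] with r hr
    rw [gauge_gauge_neg u hr.1, heq r hr]
  refine (isFlowLine_iff (nonempty_of_mem_Ztop hS) (separating_of_mem_Ztop hw hS) hu).2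
    ⟨fun r hr => ?_, ?_, ht⟩
  · refine differentiableAt_gauge (-u) hr.1 θ ?_
    exact ((LocalSolution.hasDerivAt_flow h2 hx' hr).differentiableAt).congr_of_eventuallyEq
      (hev r hr)
  · refine isGaugeFlow_of_hasDerivAt h.zero h.pos hx.2 (fun r hr => ?_) (fun r hr => ?_) ht
    · rw [(hev' r hr).eq_of_nhds]
      exact LocalSolution.flow_good h2 hx' hr
    · rw [(hev' r hr).eq_of_nhds]
      exact (LocalSolution.hasDerivAt_flow h2 hx' hr).congr_of_eventuallyEq (hev' r hr)

lemma eq_of_isFlowLine (hΨ : IsLocalFlow h U ρ Ψ) (hw : IsSimplicialWeight w) (hS : S ∈ Ztop w)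
    (hu : Supports w S u k) {x : Fin l → ℂ} (hx : x ∈ U ∩ pants S) {θ : ℝ} {γ : ℝ → Fin l → ℂ}
    (hγ : IsFlowLine w S θ ρ x γ) {r : ℝ} (hr : r ∈ Ioo 0 ρ) :
    γ r = gauge (-u) r θ (Ψ r θ x) := by
  obtain ⟨x₀, L, h1, h2, h3⟩ := hΨ x hx.1
  obtain ⟨-, h4, h5⟩ := (isFlowLine_iff (nonempty_of_mem_Ztop hS) (separating_of_mem_Ztop hw hS)
    hu).1 hγ
  rw [h3 x ⟨h1, hx⟩ r hr θ, ← LocalSolution.eq_flow h2 h1 h4 h5 hr, gauge_neg_gauge u hr.1]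

lemma fderiv_section_ne_zero (hΨ : IsLocalFlow h U ρ Ψ) {x : Fin l → ℂ} (hx : x ∈ U ∩ pants S)
    {r : ℝ} (hr : r ∈ Ioo 0 ρ) (θ : ℝ) :
    fderiv ℂ (section_ w r θ) (gauge (-u) r θ (Ψ r θ x)) ≠ 0 := by
  obtain ⟨x₀, L, h1, h2, h3⟩ := hΨ x hx.1
  have hg := LocalSolution.flow_good (θ := θ) h2 (L.half_ball_subset h1) hr
  rw [← h3 x ⟨h1, hx⟩ r hr θ] at hg
  obtain ⟨v, hv⟩ := hg.exists_fderiv_ne_zero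
  intro h0
  have h6 := fderiv_section_gauge w u k hr.1 θ ((gauge_mem_torus (-u) hr.1 θ).2 hg.1)
    (gauge (-u) r θ v)
  rw [h0, gauge_gauge_neg u hr.1, gauge_gauge_neg u hr.1] at h6
  exact mul_ne_zero (tpow_ne_zero hr.1 θ k) hv h6.symm

lemma contDiffAt_comp (hΨ : IsLocalFlow h U ρ Ψ) (hU : IsOpen U) {V : Set (Fin (l - 1) → ℂ)}
    {φ : (Fin (l - 1) → ℂ) → (Fin l → ℂ)} (hφ : IsLocalParam (pants S) V φ)
    {p : Fin (l - 1) → ℂ} (hp : p ∈ V ∩ φ ⁻¹' U) {r : ℝ} (hr : r ∈ Ioo 0 ρ) (θ : ℝ) :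
    ContDiffAt ℝ ∞ ((fun x => gauge (-u) r θ (Ψ r θ x)) ∘ φ) p ∧
      Function.Injective (fderiv ℝ ((fun x => gauge (-u) r θ (Ψ r θ x)) ∘ φ) p) := by
  obtain ⟨x₀, L, h1, h2, h3⟩ := hΨ (φ p) hp.2
  have hVp := hφ.isOpen.mem_nhds hp.1
  have hφs : ContDiffAt ℝ ∞ φ p := hφ.smooth.contDiffAt hVp
  have hx' := L.half_ball_subset h1
  have hfl := LocalSolution.contDiffAt_flow h2 hx' hr θ
  let T : (Fin l → ℂ) →L[ℝ] (Fin l → ℂ) := (gaugeCLM (-u) r θ).restrictScalars ℝ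
  have hev : (fun x => gauge (-u) r θ (Ψ r θ x)) ∘ φ =ᶠ[𝓝 p]
      fun q => T (L.flow h r θ (φ q)) := by
    filter_upwards [hVp, hφs.continuousAt.eventually_mem (hU.mem_nhds hp.2),
      hφs.continuousAt.eventually_mem (Metric.isOpen_ball.mem_nhds h1)] with q hq1 hq2 hq3
    simp only [Function.comp_apply]
    rw [h3 (φ q) ⟨hq3, hq2, hφ.maps hq1⟩ r hr θ]
    rfl
  have hd : HasFDerivAt (fun q => T (L.flow h r θ (φ q)))
      (T.comp ((fderiv ℝ (L.flow h r θ) (φ p)).comp (fderiv ℝ φ p))) p :=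
    T.hasFDerivAt.comp p (HasFDerivAt.comp p (hfl.differentiableAt (by simp)).hasFDerivAt
      (hφs.differentiableAt (by simp)).hasFDerivAt)
  refine ⟨ContDiffAt.congr_of_eventuallyEq (T.contDiff.contDiffAt.comp p (hfl.comp p hφs)) hev, ?_⟩
  rw [hev.fderiv_eq, hd.fderiv]
  have hT : Function.Injective T :=
    Function.LeftInverse.injective (g := gauge u r θ) fun x => gauge_gauge_neg u hr.1 θ x
  exact hT.comp ((LocalSolution.injective_fderiv_flow h2 hx' hr θ).comp (hφ.immersion p hp.1))

lemma pullbackConvergesCk (hΨ : IsLocalFlow h U ρ Ψ) (hU : IsOpen U) {F : Set (Fin l → ℂ)}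
    (hFU : F ⊆ U) (hS : S ∈ Ztop w) (hρ : 0 < ρ) {κ : ℝ} (hκ : 0 < κ) (n : ℕ) :
    PullbackConvergesCk ((𝓝[>] (0 : ℝ)) ×ˢ (⊤ : Filter ℝ)) n (pants S) F
      (fun τ => gApprox w κ τ.1 τ.2)
      (fun τ x => gauge (-u) τ.1 τ.2 (Ψ τ.1 τ.2 x)) (gZero κ S) := by
  intro V φ hφ K hKV hK hKF j _ a b
  refine tendstoUniformlyOn_pullback hκ hS h hφ hKV hK (fun x hx => ?_) j a b
  obtain ⟨x₀, L, h1, -, h3⟩ := hΨ x (hFU (hKF hx))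
  refine ⟨x₀, L, L.half_ball_subset h1, ρ, hρ, ?_⟩
  filter_upwards [hU.mem_nhds (hFU (hKF hx)), Metric.isOpen_ball.mem_nhds h1] with y hy1 hy2 hy3
      τ hτ
  rw [h3 y ⟨hy2, hy1, hy3⟩ τ.1 hτ τ.2]

end IsLocalFlow

end

end Degeneration

end

/-! ### Assembly of the proposition -/

open Degeneration in
theorem proposition5p5 {l : ℕ} (Δ : Finset (Fin l → ℤ)) (hΔ : IsIntegralPolytope Δ)
    (w : Δ → ℝ) (hw : IsSimplicialWeight w) :
    ∃ κ₀ : ℝ, 0 < κ₀ ∧ ∀ κ ≥ κ₀,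
      -- `g_t` is a Riemannian metric on `X_t`
      (∀ r > 0, ∀ θ : ℝ, IsPosDefOn (hyp w r θ) (section_ w r θ) (gApprox w κ r θ)) ∧
      -- `g̃_0` is a complete Riemannian metric on the smooth part of `X̃_0`
      (∀ S ∈ Ztop w, IsPosDefOn (pants S) (sectionZero S) (gZero κ S) ∧
        IsCompleteOn (pants S) (gZero κ S)) ∧
      -- a compact subset of the smooth part is a family of compact subsets of its components
      ∀ F : Finset Δ → Set (Fin l → ℂ), (∀ S ∈ Ztop w, IsCompact (F S) ∧ F S ⊆ pants S) →
        ∃ (U : Finset Δ → Set (Fin l → ℂ)) (ρ : ℝ)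
          (ψ : Finset Δ → ℝ → ℝ → (Fin l → ℂ) → (Fin l → ℂ)),
          (∀ S ∈ Ztop w, IsOpen (U S) ∧ F S ⊆ U S) ∧ 0 < ρ ∧
          -- near `F` and for small `t` the Hamiltonian-gradient flow exists, and it is unique
          IsFlow w U ρ ψ ∧
          (∀ ψ', IsFlow w U ρ ψ' → ∀ S ∈ Ztop w, ∀ θ, ∀ r ∈ Set.Ioo 0 ρ,
            Set.EqOn (ψ' S θ r) (ψ S θ r) (U S ∩ pants S)) ∧
          (∀ θ, ∀ r ∈ Set.Ioo 0 ρ, IsEmbeddingOn w r θ U (fun S => ψ S θ r)) ∧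
          -- `ψ_t^* g_t → g̃_0` on `F` in `C^k` as `t = r e^{iθ} → 0`, uniformly in `θ`
          ∀ k : ℕ, ∀ S ∈ Ztop w,
            PullbackConvergesCk ((𝓝[>] (0 : ℝ)) ×ˢ (⊤ : Filter ℝ)) k (pants S) (F S)
              (fun τ => gApprox w κ τ.1 τ.2) (fun τ => ψ S τ.2 τ.1) (gZero κ S) := by
  classical
  refine ⟨4 * (l + 1), by positivity, fun κ hκ => ?_⟩
  have hκ0 : 0 < κ := lt_of_lt_of_le (by positivity) hκ
  refine ⟨fun r hr θ => isPosDefOn_gApprox hΔ w hκ hr θ,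
    fun S hS => ⟨isPosDefOn_gZero hw hκ hS, isCompleteOn_gZero hw hκ hS⟩, fun F hF => ?_⟩
  have hcell : ∀ S ∈ Ztop w, ∃ u k, Supports w S u k := fun S hS =>
    (Finset.mem_filter.1 hS).2.2.2
  choose! u k hu using hcell
  have hexp : ∀ S ∈ Ztop w, ∃ N, Exponents S (excess w (u S) (k S)) N := fun S hS =>
    exists_exponents (hu S hS)
  choose! N hN using hexp
  have hflow := fun S (hS : S ∈ Ztop w) => exists_flow_near hw hS (hN S hS) (hF S hS).1 (hF S hS).2
  choose! U C Ψ hUo hFU hC hCt hev using hflow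
  -- In their gauges the images stay in the compact sets `C S`. Distinct cells have distinct slopes,
  -- so for small `t` the images of different components in the torus are disjoint.
  have hsep : ∀ᶠ ρ in 𝓝[>] (0 : ℝ), ∀ S ∈ Ztop w, ∀ S' ∈ Ztop w, S ≠ S' → ∀ r ∈ Ioo 0 ρ, ∀ θ,
      ∀ y ∈ C S, ∀ y' ∈ C S', gauge (-u S) r θ y ≠ gauge (-u S') r θ y' := by
    refine (Finset.eventually_all _).2 fun S hS => (Finset.eventually_all _).2 fun S' hS' => ?_
    by_cases hne : S = S'
    · exact Eventually.of_forall fun ρ h => absurd hne h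
    · refine (eventually_gauge_ne (hC S hS) (hCt S hS) (hC S' hS') (hCt S' hS') ?_).mono
        fun ρ h _ => h
      intro he
      have h1 := hu S hS
      rw [he] at h1
      exact hne (h1.slope_injective (nonempty_of_mem_Ztop hS) (nonempty_of_mem_Ztop hS')
        (hu S' hS'))
  have hall : ∀ᶠ ρ in 𝓝[>] (0 : ℝ), ∀ S ∈ Ztop w, ∀ hS : S ∈ Ztop w,
      IsLocalFlow (hN S hS) (U S) ρ (Ψ S) ∧ ∀ r ∈ Ioo 0 ρ, ∀ θ,
        MapsTo (Ψ S r θ) (U S ∩ pants S) (C S) ∧ InjOn (Ψ S r θ) (U S ∩ pants S) :=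
    (Finset.eventually_all _).2 fun S hS => (hev S hS).mono fun ρ h _ => h
  -- Only finitely many cells occur, so one radius serves for all of them.
  obtain ⟨ρ, ⟨hev', hsep'⟩, hρ⟩ := ((hall.and hsep).and self_mem_nhdsWithin).exists
  have hΨ : ∀ S (hS : S ∈ Ztop w), IsLocalFlow (hN S hS) (U S) ρ (Ψ S) := fun S hS => (hev' S hS
      hS).1
  have hline : ∀ S ∈ Ztop w, ∀ θ, ∀ x ∈ U S ∩ pants S,
      IsFlowLine w S θ ρ x (fun r => gauge (-u S) r θ (Ψ S r θ x)) := fun S hS θ x hx =>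
    (hΨ S hS).isFlowLine hw hS (hu S hS) hx hρ θ
  refine ⟨U, ρ, fun S θ r x => gauge (-u S) r θ (Ψ S r θ x), fun S hS => ⟨hUo S hS, hFU S hS⟩, hρ,
    hline, ?_, ?_, ?_⟩
  · intro ψ' hψ' S hS θ r hr x hx
    exact (hΨ S hS).eq_of_isFlowLine hw hS (hu S hS) hx (hψ' S hS θ x hx) hr
  · intro θ r hr
    refine ⟨fun S hS x hx => ?_, fun S hS V φ hφ p hp => ?_, fun S hS V φ hφ p hp => ?_,
      fun S hS S' hS' x hx x' hx' he => ?_⟩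
    · exact ⟨(hline S hS θ x hx).mem r hr, (hΨ S hS).fderiv_section_ne_zero hx hr θ⟩
    · exact ((hΨ S hS).contDiffAt_comp (hUo S hS) hφ hp hr θ).1.contDiffWithinAt
    · exact ((hΨ S hS).contDiffAt_comp (hUo S hS) hφ hp hr θ).2
    · have hmaps := fun S hS => (hev' S hS hS).2 r hr θ
      have hSS : S = S' := by
        by_contra hne
        exact hsep' S hS S' hS' hne r hr θ _ ((hmaps S hS).1 hx) _ ((hmaps S' hS').1 hx') he
      subst hSS
      refine ⟨rfl, (hmaps S hS).2 hx hx' ?_⟩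
      have h1 := congrArg (gauge (u S) r θ) he
      simpa only [gauge_gauge_neg _ hr.1] using h1
  · intro n S hS
    exact (hΨ S hS).pullbackConvergesCk (hUo S hS) (hFU S hS) hS hρ hκ0 n
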